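/- Let $d\ge 5$, $0<\alpha<1$, and let $\overline X$ be a connected smooth $d$-manifold with boundary $\partial X$ and interior $X$. Let $g^+$ be a Riemannian metric on $X$ with $\mathrm{Ric}[g^+]=-(d-1)g^+$, and let $g=\rho^2g^+$ be an adapted $C^{2,\alpha}$ conformal compactification of it. That is, $\rho\ge 0$ is a function of class $C^{2,\alpha}$ on $\overline X$ with $\{\rho=0\}=\partial X$ and $d\rho\ne0$ on $\partial X$; the metric $g$ extends to a Riemannian metric of class $C^{2,\alpha}$ on $\overline X$; and $v=\rho^{(d-4)/2}$ solves $$-\Delta_{g^+}v-\frac{(d-1)^2-9}{4}\,v=0\quad\text{on }X.$$ Let $d_g$ be the Riemannian distance of $g$ on $\overline X$. Assume that $(\overline X,d_g)$ is complete and that $(\partial X,g|_{T\partial X})$ is isometric to the Euclidean space $\mathbb R^{d-1}$, with which it is identified. Assume moreover that 1. the scalar curvature of $g$ is non-negative and $|Rm[g]|_g\le 1$ on $\overline X$; 2. for some point $p\in\overline X$ and some real number $\varepsilon<\frac12$, $$\limsup_{x\to\infty}|\mathrm{Ric}[g](x)|_g\,(1+d_g(x,p))^2<\varepsilon,$$ where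 $|\cdot|_g$ is the tensor (Hilbert–Schmidt) norm; 3. the interior and the boundary injectivity radius of $g$ are positive. That is, there is $i_0>0$ such that the exponential map at every $x\in X$ is a diffeomorphism onto its image on the ball of radius $\min(i_0,d_g(x,\partial X))$, and the normal exponential map of $\partial X$ is a diffeomorphism of $\partial X\times[0,i_0)$ onto its image. Then, for every $O\in\partial X=\mathbb R^{d-1}$, $$d_g(y,O)\le |y-O|\qquad\text{for all }y\in\mathbb R^{d-1},$$ where $|\cdot|$ is the Euclidean norm, and $$\lim_{a\to\infty}\frac{\inf\{d_g(y,O): y\in\mathbb R^{d-1},\ |y-O|=a\}}{a^{\frac{1}{1+\varepsilon/2}}}=+\infty .$$ -/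

import Mathlib

open scoped Manifold ContDiff Topology Bundle NNReal ENNReal

noncomputable section

namespace AdaptedEinstein

/-- Euclidean space `ℝᵈ`. -/
abbrev Euc (d : ℕ) : Type := EuclideanSpace ℝ (Fin d)

/-! ### Tensor calculus in coordinates

`S ⊆ ℝᵈ` is the range of the coordinates (a half space, for a manifold with boundary; derivatives
are taken relative to `S`), and `G u` is the matrix of the components of a metric at `u`. -/

/-- The partial derivative `∂ᵢ f`, relative to `S`. -/
def pd {d : ℕ} (S : Set (Euc d)) (f : Euc d → ℝ) (i : Fin d) (u : Euc d) : ℝ :=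
  fderivWithin ℝ f S u (EuclideanSpace.single i 1)

/-- The Christoffel symbol
`Γᵏᵢⱼ = ½ gᵏˡ (∂ᵢ gⱼₗ + ∂ⱼ gᵢₗ - ∂ₗ gᵢⱼ)`. -/
def christoffel {d : ℕ} (S : Set (Euc d)) (G : Euc d → Matrix (Fin d) (Fin d) ℝ)
    (k i j : Fin d) (u : Euc d) : ℝ :=
  (1 / 2) * ∑ l, (G u)⁻¹ k l *
    (pd S (fun w => G w j l) i u + pd S (fun w => G w i l) j u - pd S (fun w => G w i j) l u)

/-- The component `Rˡₖᵢⱼ` of the curvature tensor, where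
`R(∂ᵢ, ∂ⱼ) ∂ₖ = ∇ᵢ ∇ⱼ ∂ₖ - ∇ⱼ ∇ᵢ ∂ₖ = Rˡₖᵢⱼ ∂ₗ`. -/
def riemannUp {d : ℕ} (S : Set (Euc d)) (G : Euc d → Matrix (Fin d) (Fin d) ℝ)
    (l k i j : Fin d) (u : Euc d) : ℝ :=
  pd S (christoffel S G l j k) i u - pd S (christoffel S G l i k) j u
    + ∑ m, (christoffel S G l i m u * christoffel S G m j k u
        - christoffel S G l j m u * christoffel S G m i k u)

/-- The component `Rₗₖᵢⱼ = gₗₘ Rᵐₖᵢⱼ` of the curvature tensor with all indices lowered. -/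
def riemannLow {d : ℕ} (S : Set (Euc d)) (G : Euc d → Matrix (Fin d) (Fin d) ℝ)
    (l k i j : Fin d) (u : Euc d) : ℝ :=
  ∑ m, G u l m * riemannUp S G m k i j u

/-- The Ricci tensor `Ricⱼₖ = Rⁱₖᵢⱼ` (positive on round spheres). -/
def ricci {d : ℕ} (S : Set (Euc d)) (G : Euc d → Matrix (Fin d) (Fin d) ℝ) (u : Euc d) :
    Matrix (Fin d) (Fin d) ℝ :=
  Matrix.of fun j k => ∑ i, riemannUp S G i k i j u

/-- The scalar curvature `R = gⁱʲ Ricᵢⱼ`. -/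
def scalar {d : ℕ} (S : Set (Euc d)) (G : Euc d → Matrix (Fin d) (Fin d) ℝ) (u : Euc d) : ℝ :=
  ∑ i, ∑ j, (G u)⁻¹ i j * ricci S G u i j

/-- The tensor norm of the Ricci tensor, `|Ric|²` being the full contraction of `Ric ⊗ Ric`
with the inverse metric. -/
def ricciNorm {d : ℕ} (S : Set (Euc d)) (G : Euc d → Matrix (Fin d) (Fin d) ℝ) (u : Euc d) : ℝ :=
  √(∑ i, ∑ j, ∑ a, ∑ b,
    (G u)⁻¹ i a * (G u)⁻¹ j b * ricci S G u i j * ricci S G u a b)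

/-- The tensor norm of the Riemann curvature tensor,
`|Rm|²`, the full contraction of `Rm ⊗ Rm` with the inverse metric. -/
def riemannNorm {d : ℕ} (S : Set (Euc d)) (G : Euc d → Matrix (Fin d) (Fin d) ℝ) (u : Euc d) : ℝ :=
  √(∑ i, ∑ j, ∑ k, ∑ l, ∑ a, ∑ b, ∑ c, ∑ e,
    (G u)⁻¹ i a * (G u)⁻¹ j b * (G u)⁻¹ k c * (G u)⁻¹ l e
      * riemannLow S G i j k l u * riemannLow S G a b c e u)

/-- The Laplace-Beltrami operator (trace of the Hessian)
`Δ f = gⁱʲ (∂ᵢ ∂ⱼ f - Γᵏᵢⱼ ∂ₖ f)`. -/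
def laplacian {d : ℕ} (S : Set (Euc d)) (G : Euc d → Matrix (Fin d) (Fin d) ℝ)
    (f : Euc d → ℝ) (u : Euc d) : ℝ :=
  ∑ i, ∑ j, (G u)⁻¹ i j * (pd S (pd S f j) i u - ∑ k, christoffel S G k i j u * pd S f k u)

/-- `f` is of class `C^{2,α}` on `U`: it is `C²` on `U`, and its second derivative is
`α`-Hölder on the compact subsets of `U`. -/
def IsC2HolderOn {d : ℕ} (α : ℝ≥0) (f : Euc d → ℝ) (U : Set (Euc d)) : Prop :=
  ContDiffOn ℝ 2 f U ∧ ∀ K ⊆ U, IsCompact K →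
    ∃ C : ℝ≥0, HolderOnWith C α (iteratedFDerivWithin ℝ 2 f U) K

/-! ### Tensor fields on a manifold with boundary -/

/-- A field of bilinear forms on the tangent spaces of a manifold with boundary. -/
abbrev FormField (d : ℕ) [NeZero d] (M : Type*) [TopologicalSpace M]
    [ChartedSpace (EuclideanHalfSpace d) M] : Type _ :=
  ∀ x : M, TangentSpace (𝓡∂ d) x →ₗ[ℝ] TangentSpace (𝓡∂ d) x →ₗ[ℝ] ℝ

section Fields

variable {d : ℕ} [NeZero d] {M : Type*} [TopologicalSpace M]
  [ChartedSpace (EuclideanHalfSpace d) M]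

/-- The components of `h` in the preferred chart around `c`, as functions of the coordinates. -/
def coordMatrix (h : FormField d M) (c : M) (u : Euc d) : Matrix (Fin d) (Fin d) ℝ :=
  Matrix.of fun i j =>
    h ((extChartAt (𝓡∂ d) c).symm u)
      (mfderivWithin 𝓘(ℝ, Euc d) (𝓡∂ d) (extChartAt (𝓡∂ d) c).symm (Set.range (𝓡∂ d)) u
        (EuclideanSpace.single i (1 : ℝ) : Euc d))
      (mfderivWithin 𝓘(ℝ, Euc d) (𝓡∂ d) (extChartAt (𝓡∂ d) c).symm (Set.range (𝓡∂ d)) u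
        (EuclideanSpace.single j (1 : ℝ) : Euc d))

/-- The metric `h` is of class `C^{2,α}`, up to the boundary. -/
def IsC2HolderForm (α : ℝ≥0) (h : FormField d M) : Prop :=
  ∀ c : M, ∀ i j, IsC2HolderOn α (fun u => coordMatrix h c u i j) (extChartAt (𝓡∂ d) c).target

/-- The function `f` is of class `C^{2,α}`, up to the boundary. -/
def IsC2HolderFun (d : ℕ) [NeZero d] {M : Type*} [TopologicalSpace M]
    [ChartedSpace (EuclideanHalfSpace d) M] (α : ℝ≥0) (f : M → ℝ) : Prop :=
  ∀ c : M, IsC2HolderOn α (f ∘ (extChartAt (𝓡∂ d) c).symm) (extChartAt (𝓡∂ d) c).target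

/-! The following are tensorial or scalar, so that they may be computed at `x` in the preferred
chart around `x`. -/

/-- The scalar curvature of `h` at `x`. -/
def scalarAt (h : FormField d M) (x : M) : ℝ :=
  scalar (Set.range (𝓡∂ d)) (coordMatrix h x) (extChartAt (𝓡∂ d) x x)

/-- The norm `|Ric|` of the Ricci tensor of `h` at `x`, with respect to `h`. -/
def ricciNormAt (h : FormField d M) (x : M) : ℝ :=
  ricciNorm (Set.range (𝓡∂ d)) (coordMatrix h x) (extChartAt (𝓡∂ d) x x)

/-- The norm `|Rm|` of the Riemann tensor of `h` at `x`, with respect to `h`. -/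
def riemannNormAt (h : FormField d M) (x : M) : ℝ :=
  riemannNorm (Set.range (𝓡∂ d)) (coordMatrix h x) (extChartAt (𝓡∂ d) x x)

/-- The Laplacian with respect to `h` of the function `f`, at `x`. -/
def laplacianAt (h : FormField d M) (f : M → ℝ) (x : M) : ℝ :=
  laplacian (Set.range (𝓡∂ d)) (coordMatrix h x) (f ∘ (extChartAt (𝓡∂ d) x).symm)
    (extChartAt (𝓡∂ d) x x)

/-- `Ric[h] = -(d-1) h` in the interior. -/
def IsPoincareEinstein (h : FormField d M) : Prop :=
  ∀ x ∈ (𝓡∂ d).interior M,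
    ricci (Set.range (𝓡∂ d)) (coordMatrix h x) (extChartAt (𝓡∂ d) x x)
      = (-((d : ℝ) - 1)) • coordMatrix h x (extChartAt (𝓡∂ d) x x)

/-- `ρ` is a defining function of the boundary, of class `C^{2,α}`. -/
structure IsDefiningFunction (d : ℕ) [NeZero d] {M : Type*} [TopologicalSpace M]
    [ChartedSpace (EuclideanHalfSpace d) M] (α : ℝ≥0) (ρ : M → ℝ) : Prop where
  regular : IsC2HolderFun d α ρ
  nonneg : ∀ x, 0 ≤ ρ x
  eq_zero_iff : ∀ x, ρ x = 0 ↔ x ∈ (𝓡∂ d).boundary M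
  deriv_ne_zero : ∀ x ∈ (𝓡∂ d).boundary M, mfderiv (𝓡∂ d) 𝓘(ℝ, ℝ) ρ x ≠ 0

/-- The adapted equation: `v = ρ ^ ((d - 4) / 2)` solves
`-Δ v - ((d - 1)² - 9) / 4 * v = 0` in the interior, `Δ` being the Laplacian of `h`. -/
def IsAdapted (h : FormField d M) (ρ : M → ℝ) : Prop :=
  ∀ x ∈ (𝓡∂ d).interior M,
    -laplacianAt h (fun y => ρ y ^ (((d : ℝ) - 4) / 2)) x
      - (((d : ℝ) - 1) ^ 2 - 9) / 4 * ρ x ^ (((d : ℝ) - 4) / 2) = 0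

/-- `γ` is a geodesic of `h` on the interval `J`: at each time `t`, the coordinates of `γ` in the
preferred chart around `γ t` satisfy `γ''ᵏ + Γᵏᵢⱼ γ'ⁱ γ'ʲ = 0`. -/
def IsGeodesicOn (h : FormField d M) (γ : ℝ → M) (J : Set ℝ) : Prop :=
  ContinuousOn γ J ∧ ∀ t ∈ J,
    ContDiffWithinAt ℝ 2 (fun s => extChartAt (𝓡∂ d) (γ t) (γ s)) J t ∧
    ∀ k : Fin d,
      iteratedDerivWithin 2 (fun s => extChartAt (𝓡∂ d) (γ t) (γ s)) J t k
        + ∑ i, ∑ j, christoffel (Set.range (𝓡∂ d)) (coordMatrix h (γ t)) k i j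
              (extChartAt (𝓡∂ d) (γ t) (γ t))
            * derivWithin (fun s => extChartAt (𝓡∂ d) (γ t) (γ s)) J t i
            * derivWithin (fun s => extChartAt (𝓡∂ d) (γ t) (γ s)) J t j = 0

/-- On the ball of radius `r` in the tangent space of `x`, the exponential map of `h` at `x` is
defined, with values in `M`, and is a diffeomorphism onto its image. -/
def ExpIsDiffeoOn (h : FormField d M) (x : M) (r : ℝ≥0∞) : Prop :=
  ∃ e : Euc d → M,
    let B : Set (Euc d) := {v | ENNReal.ofReal √(h x v v) < r}
    e 0 = x ∧
    (∀ v ∈ B, IsGeodesicOn h (fun t => e (t • v)) (Set.Icc 0 1) ∧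
      HasMFDerivWithinAt 𝓘(ℝ, ℝ) (𝓡∂ d) (fun t : ℝ => e (t • v)) (Set.Icc 0 1) 0
        (ContinuousLinearMap.toSpanSingleton ℝ v)) ∧
    Set.InjOn e B ∧ ContMDiffOn 𝓘(ℝ, Euc d) (𝓡∂ d) 1 e B ∧
    ∀ v ∈ B, Function.Bijective (mfderiv 𝓘(ℝ, Euc d) (𝓡∂ d) e v)

end Fields

section Radii

variable {d : ℕ} [NeZero d] {M : Type*} [MetricSpace M] [ChartedSpace (EuclideanHalfSpace d) M]

/-- The interior injectivity radius is positive: for some `i₀ > 0`, at every interior point `x` the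
exponential map is a diffeomorphism on the ball of radius `min i₀ (d(x, ∂M))`. -/
def InteriorInjRadiusPos (h : FormField d M) : Prop :=
  ∃ i₀ : ℝ, 0 < i₀ ∧ ∀ x ∈ (𝓡∂ d).interior M,
    ExpIsDiffeoOn h x (min (ENNReal.ofReal i₀) (Metric.infEDist x ((𝓡∂ d).boundary M)))

/-- The boundary injectivity radius is positive, `Φ` being a parametrization of the boundary: for
some `i₀ > 0`, the normal exponential map `(y, t) ↦ exp_{Φ y} (t ν)`, with `ν` the inward unit
normal, is a diffeomorphism from `∂M × [0, i₀)` onto its image. -/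
def BoundaryInjRadiusPos (h : FormField d M) (Φ : Euc (d - 1) → M) : Prop :=
  ∃ i₀ : ℝ, 0 < i₀ ∧ ∃ N : Euc (d - 1) × ℝ → M,
    (∀ y, N (y, 0) = Φ y) ∧
    (∀ y, IsGeodesicOn h (fun t => N (y, t)) (Set.Ico 0 i₀) ∧
      ∃ ν : TangentSpace (𝓡∂ d) (Φ y), h (Φ y) ν ν = 1 ∧
        (∀ w, h (Φ y) ν (mfderiv 𝓘(ℝ, Euc (d - 1)) (𝓡∂ d) Φ y w) = 0) ∧
        HasMFDerivWithinAt 𝓘(ℝ, ℝ) (𝓡∂ d) (fun t : ℝ => N (y, t)) (Set.Ico 0 i₀) 0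
          (ContinuousLinearMap.toSpanSingleton ℝ (ν : Euc d))) ∧
    Set.InjOn N (Set.univ ×ˢ Set.Ico 0 i₀) ∧
    ContMDiffOn 𝓘(ℝ, Euc (d - 1) × ℝ) (𝓡∂ d) 1 N (Set.univ ×ˢ Set.Ico 0 i₀) ∧
    ∀ p ∈ (Set.univ : Set (Euc (d - 1))) ×ˢ Set.Ico (0 : ℝ) i₀,
      Function.Bijective (mfderivWithin 𝓘(ℝ, Euc (d - 1) × ℝ) (𝓡∂ d) N
        (Set.univ ×ˢ Set.Ico 0 i₀) p)

end Radii

section Metric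

variable (d : ℕ) [NeZero d] (M : Type*) [MetricSpace M] [ChartedSpace (EuclideanHalfSpace d) M]
  [Bundle.RiemannianBundle (fun x : M => TangentSpace (𝓡∂ d) x)]

/-- The Riemannian metric of `M`, as a field of bilinear forms. -/
def metricForm : FormField d M := fun x => innerₗ (TangentSpace (𝓡∂ d) x)

/-- `Φ` is an isometry (of class `C¹`) of the Euclidean space `ℝ^{d-1}` onto the boundary with the
metric induced by that of `M`. -/
structure IsBoundaryIsometry (Φ : Euc (d - 1) → M) : Prop where
  contMDiff : ContMDiff 𝓘(ℝ, Euc (d - 1)) (𝓡∂ d) 1 Φ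
  isEmbedding : Topology.IsEmbedding Φ
  range_eq : Set.range Φ = (𝓡∂ d).boundary M
  pullback_eq : ∀ (y v w : Euc (d - 1)),
    metricForm d M (Φ y) (mfderiv 𝓘(ℝ, Euc (d - 1)) (𝓡∂ d) Φ y v)
      (mfderiv 𝓘(ℝ, Euc (d - 1)) (𝓡∂ d) Φ y w) = inner ℝ v w

end Metric

end AdaptedEinstein

end

noncomputable section

namespace AdaptedEinstein

open Filter Set

/-! ### Calculus in coordinates -/

section Coordinates

variable {d : ℕ}

/-! Write R for the scalar curvature of g, and δ(y) for the distance of y to O in g. The inequality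
δ(y) ≤ |y - O| only says that a straight segment of the boundary is a curve in the manifold. The
growth of δ rests on a contraction towards the boundary.

Expressed through g, the Einstein equation and the adapted equation become |∇ρ|² = 1 - Rρ²/(2(d-1))
and Hess ρ = -(ρ/(d-2)) (Ric + (d-4)/(4(d-1)) R g), which is `gradSq_and_hess_of_einstein`. As R ≥
0, the function ρ is 1-Lipschitz, so that ρ ≤ ρ(p) + d(·,p). The decay of Ric then gives, far from
p, |Ric|(1+ρ)² ≤ 1.01 ε, hence |∇ρ|² ≥ 0.85 and Hess ρ ≥ -0.404 ε/(1+ρ) (`gradSq_hess_bounds`,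
`gradSq_hess_pos`).

Let X = -ρ∇ρ. The Lie derivative of g along X is -2(dρ⊗dρ + ρ Hess ρ). If g is replaced by
(1+ρ)^(2κ) g with κ = 0.49 ε, the derivative of the weight contributes the further term
-2ρκ|∇ρ|²/(1+ρ), which beats the Hessian. So X contracts the weighted metric outside a ball
(`eventually_quad_pushField_le`), and points can be pushed towards the boundary without increasing
weighted distances. Consequently distances in the boundary are dominated by the weighted distance
dw: |y - O| ≤ C + 16 dw(O, y) (`IsPush.exists_norm_sub_le`). Conversely, an almost shortest curve of
g from O stays essentially where ρ ≤ δ(y), so dw(O, y) ≤ (1+δ)^κ δ (`wDist_le_rpow`). Together |y -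
O| ≤ C + 16 (1+δ)^κ δ, and κ < ε/2 gives the claim (`tendsto_sInf_sphere_div_rpow`).

The field is never integrated, and no geodesics are used. Only short curves with initial velocity X
and their first order behaviour enter (`IsPush`, `isPush_pushCurve`). The passage from infinitesimal
to global is made by minimization in the proper space M. `IsPush.eventually_le` shows that the
weighted distance D to a large compact set S does not increase along the push to first order.
`IsPush.exists_descent` deduces, by minimizing ρ, that a boundary point outside S has boundary
points nearby with definitely smaller D. Minimizing D plus a small multiple of the Euclidean
distance then leads from any boundary point into S. As X vanishes on the boundary, the curvature
estimates are needed only in the interior. -/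

lemma pd_of_mem_nhds {S : Set (Euc d)} {f : Euc d → ℝ} {i : Fin d} {u : Euc d} (hS : S ∈ 𝓝 u) :
    pd S f i u = fderiv ℝ f u (EuclideanSpace.single i 1) := by
  rw [pd, fderivWithin_of_mem_nhds hS]

lemma pd_univ (f : Euc d → ℝ) (i : Fin d) (u : Euc d) :
    pd univ f i u = fderiv ℝ f u (EuclideanSpace.single i 1) :=
  pd_of_mem_nhds univ_mem

/-- At an interior point, derivatives relative to the half space are ordinary derivatives. This and
the next congruence lemmas reduce all tensor computations to derivatives on an open set, written
with `univ`. -/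
lemma pd_congr {S : Set (Euc d)} {f g : Euc d → ℝ} {u : Euc d} (hS : S ∈ 𝓝 u)
    (h : f =ᶠ[𝓝 u] g) (i : Fin d) : pd S f i =ᶠ[𝓝 u] pd univ g i := by
  filter_upwards [eventually_mem_nhds_iff.2 hS, h.eventuallyEq_nhds] with w hw hfg
  rw [pd_of_mem_nhds hw, pd_univ, hfg.fderiv_eq]

lemma christoffel_congr {S : Set (Euc d)} {G G' : Euc d → Matrix (Fin d) (Fin d) ℝ} {u : Euc d}
    (hS : S ∈ 𝓝 u) (h : G =ᶠ[𝓝 u] G') (k i j : Fin d) :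
    christoffel S G k i j =ᶠ[𝓝 u] christoffel univ G' k i j := by
  have h1 : ∀ a b c, ∀ᶠ w in 𝓝 u,
      pd S (fun w => G w a b) c w = pd univ (fun w => G' w a b) c w := fun a b c =>
    pd_congr hS (h.mono fun w hw => by simp only [hw]) c
  have h2 : ∀ᶠ w in 𝓝 u, ∀ a b c,
      pd S (fun w => G w a b) c w = pd univ (fun w => G' w a b) c w := by
    simp only [eventually_all]; exact h1
  filter_upwards [h2, h] with w hw hw'
  simp only [christoffel, hw, hw']

lemma ricci_congr {S : Set (Euc d)} {G G' : Euc d → Matrix (Fin d) (Fin d) ℝ} {u : Euc d}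
    (hS : S ∈ 𝓝 u) (h : G =ᶠ[𝓝 u] G') : ricci S G u = ricci univ G' u := by
  ext j k
  simp only [ricci, riemannUp, Matrix.of_apply]
  have h1 : ∀ k i j, christoffel S G k i j u = christoffel univ G' k i j u := fun k i j =>
    (christoffel_congr hS h k i j).self_of_nhds
  have h2 : ∀ k i j a, pd S (christoffel S G k i j) a u = pd univ (christoffel univ G' k i j) a u :=
    fun k i j a => (pd_congr hS (christoffel_congr hS h k i j) a).self_of_nhds
  simp only [h1, h2]

lemma laplacian_congr {S : Set (Euc d)} {G G' : Euc d → Matrix (Fin d) (Fin d) ℝ}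
    {f f' : Euc d → ℝ} {u : Euc d} (hS : S ∈ 𝓝 u) (h : G =ᶠ[𝓝 u] G') (hf : f =ᶠ[𝓝 u] f') :
    laplacian S G f u = laplacian univ G' f' u := by
  have h1 : ∀ k i j, christoffel S G k i j u = christoffel univ G' k i j u := fun k i j =>
    (christoffel_congr hS h k i j).self_of_nhds
  have h2 : ∀ j, pd S f j u = pd univ f' j u := fun j => (pd_congr hS hf j).self_of_nhds
  have h3 : ∀ i j, pd S (pd S f j) i u = pd univ (pd univ f' j) i u := fun i j =>
    (pd_congr hS (pd_congr hS hf j) i).self_of_nhds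
  simp only [laplacian, h1, h2, h3, h.self_of_nhds]

lemma pd_add {f g : Euc d → ℝ} {u : Euc d} (hf : DifferentiableAt ℝ f u)
    (hg : DifferentiableAt ℝ g u) (i : Fin d) :
    pd univ (fun w => f w + g w) i u = pd univ f i u + pd univ g i u := by
  simp only [pd_univ]; rw [fderiv_fun_add hf hg]; rfl

lemma pd_sub {f g : Euc d → ℝ} {u : Euc d} (hf : DifferentiableAt ℝ f u)
    (hg : DifferentiableAt ℝ g u) (i : Fin d) :
    pd univ (fun w => f w - g w) i u = pd univ f i u - pd univ g i u := by
  simp only [pd_univ]; rw [fderiv_fun_sub hf hg]; rfl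

lemma pd_mul {f g : Euc d → ℝ} {u : Euc d} (hf : DifferentiableAt ℝ f u)
    (hg : DifferentiableAt ℝ g u) (i : Fin d) :
    pd univ (fun w => f w * g w) i u = pd univ f i u * g u + f u * pd univ g i u := by
  simp only [pd_univ]; rw [fderiv_fun_mul hf hg]
  simp [mul_comm, add_comm]

lemma pd_const (c : ℝ) (i : Fin d) (u : Euc d) : pd univ (fun _ => c) i u = 0 := by
  simp [pd_univ]

lemma pd_const_mul {f : Euc d → ℝ} {u : Euc d} (c : ℝ) (hf : DifferentiableAt ℝ f u) (i : Fin d) :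
    pd univ (fun w => c * f w) i u = c * pd univ f i u := by
  rw [pd_mul (differentiableAt_const c) hf, pd_const]; ring

lemma pd_sum {ι : Type*} (s : Finset ι) {f : ι → Euc d → ℝ} {u : Euc d}
    (hf : ∀ a ∈ s, DifferentiableAt ℝ (f a) u) (i : Fin d) :
    pd univ (fun w => ∑ a ∈ s, f a w) i u = ∑ a ∈ s, pd univ (f a) i u := by
  simp only [pd_univ]; rw [fderiv_fun_sum hf]; simp

lemma pd_comp_real {f : Euc d → ℝ} {φ : ℝ → ℝ} {φ' : ℝ} {u : Euc d} (hφ : HasDerivAt φ φ' (f u))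
    (hf : DifferentiableAt ℝ f u) (i : Fin d) :
    pd univ (fun w => φ (f w)) i u = φ' * pd univ f i u := by
  simp only [pd_univ]
  have := (hφ.comp_hasFDerivAt u hf.hasFDerivAt).fderiv
  simp only [Function.comp_def] at this
  rw [this]; simp

lemma fderiv_apply_eq_sum (f : Euc d → ℝ) (u v : Euc d) :
    fderiv ℝ f u v = ∑ i, v i * pd univ f i u := by
  have hv : v = ∑ i, v i • EuclideanSpace.single i (1 : ℝ) := by
    ext j; simp [Finset.sum_apply, Pi.single_apply]
  conv_lhs => rw [hv]
  simp [map_sum, pd_univ]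

lemma contDiffAt_pd {f : Euc d → ℝ} {u : Euc d} {n m : WithTop ℕ∞} (hf : ContDiffAt ℝ n f u)
    (hmn : m + 1 ≤ n) (i : Fin d) : ContDiffAt ℝ m (pd univ f i) u := by
  have : pd univ f i = fun w => fderiv ℝ f w (EuclideanSpace.single i 1) := by
    ext w; exact pd_univ f i w
  rw [this]
  exact (hf.fderiv_right hmn).clm_apply contDiffAt_const

lemma pd_pd_comm {f : Euc d → ℝ} {u : Euc d} (hf : ContDiffAt ℝ 2 f u) (i j : Fin d) :
    pd univ (pd univ f j) i u = pd univ (pd univ f i) j u := by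
  have key : ∀ a b : Fin d, pd univ (pd univ f a) b u =
      fderiv ℝ (fderiv ℝ f) u (EuclideanSpace.single b 1) (EuclideanSpace.single a 1) := by
    intro a b
    have : pd univ f a = fun w => fderiv ℝ f w (EuclideanSpace.single a 1) := by
      ext w; exact pd_univ f a w
    rw [pd_univ, this]
    have hd : DifferentiableAt ℝ (fderiv ℝ f) u :=
      (hf.fderiv_right (m := 1) (by norm_num)).differentiableAt (by norm_num)
    rw [fderiv_clm_apply hd (differentiableAt_const _)]
    simp
  rw [key, key]
  exact (hf.isSymmSndFDerivAt (by simp)).eq _ _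

lemma contDiffAt_det {n : WithTop ℕ∞} {A : Euc d → Matrix (Fin d) (Fin d) ℝ} {u : Euc d}
    (hA : ∀ i j, ContDiffAt ℝ n (fun w => A w i j) u) : ContDiffAt ℝ n (fun w => (A w).det) u := by
  simp only [Matrix.det_apply']
  refine ContDiffAt.sum fun σ _ => contDiffAt_const.mul ?_
  exact contDiffAt_prod fun i _ => hA _ _

lemma contDiffAt_inv_apply {n : WithTop ℕ∞} {A : Euc d → Matrix (Fin d) (Fin d) ℝ} {u : Euc d}
    (hA : ∀ i j, ContDiffAt ℝ n (fun w => A w i j) u) (hdet : (A u).det ≠ 0) (i j : Fin d) :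
    ContDiffAt ℝ n (fun w => (A w)⁻¹ i j) u := by
  simp only [Matrix.inv_def, Matrix.smul_apply, smul_eq_mul, Ring.inverse_eq_inv',
    Matrix.adjugate_apply]
  refine ((contDiffAt_det hA).inv hdet).mul (contDiffAt_det fun a b => ?_)
  by_cases h : a = j
  · subst h; simpa using contDiffAt_const
  · simpa [Matrix.updateRow_apply, h] using hA a b

end Coordinates

/-! ### Conformal change of the connection, and the difference tensor. -/

section Conformal

variable {d : ℕ} {G : Euc d → Matrix (Fin d) (Fin d) ℝ} {u : Euc d}

lemma sum_inv_mul_metric (hdet : (G u).det ≠ 0) (k j : Fin d) :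
    ∑ l, (G u)⁻¹ k l * G u l j = if k = j then 1 else 0 := by
  have := congrFun (congrFun (Matrix.nonsing_inv_mul (G u) (isUnit_iff_ne_zero.2 hdet)) k) j
  simpa [Matrix.mul_apply, Matrix.one_apply] using this

lemma sum_metric_mul_inv (hdet : (G u).det ≠ 0) (k j : Fin d) :
    ∑ l, G u k l * (G u)⁻¹ l j = if k = j then 1 else 0 := by
  have := congrFun (congrFun (Matrix.mul_nonsing_inv (G u) (isUnit_iff_ne_zero.2 hdet)) k) j
  simpa [Matrix.mul_apply, Matrix.one_apply] using this

lemma christoffel_symm (hsymm : ∀ w i j, G w i j = G w j i) (k i j : Fin d) :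
    christoffel univ G k i j u = christoffel univ G k j i u := by
  have h : (fun w => G w i j) = fun w => G w j i := by ext w; exact hsymm w i j
  simp only [christoffel, h]
  congr 1
  refine Finset.sum_congr rfl fun l _ => ?_
  ring

lemma sum_metric_christoffel (hdet : (G u).det ≠ 0) (a i j : Fin d) :
    ∑ k, G u j k * christoffel univ G k a i u = (1 / 2) *
      (pd univ (fun w => G w i j) a u + pd univ (fun w => G w a j) i u
        - pd univ (fun w => G w a i) j u) := by
  have h1 : ∀ T : Fin d → ℝ, ∑ k, G u j k * ((1 / 2) * ∑ l, (G u)⁻¹ k l * T l) =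
      (1 / 2) * T j := by
    intro T
    calc _ = (1 / 2) * ∑ l, (∑ k, G u j k * (G u)⁻¹ k l) * T l := by
          simp only [Finset.mul_sum, Finset.sum_mul]
          rw [Finset.sum_comm]
          refine Finset.sum_congr rfl fun l _ => Finset.sum_congr rfl fun k _ => ?_
          ring
      _ = _ := by simp [sum_metric_mul_inv hdet]
  simp only [christoffel]
  exact h1 fun l => pd univ (fun w => G w i l) a u + pd univ (fun w => G w a l) i u
    - pd univ (fun w => G w a i) l u

/-- This is ∇G = 0 in coordinates: the sum of two Christoffel symbols of the first kind. -/
lemma pd_metric (hsymm : ∀ w i j, G w i j = G w j i) (hdet : (G u).det ≠ 0) (a i j : Fin d) :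
    pd univ (fun w => G w i j) a u = ∑ k, G u j k * christoffel univ G k a i u
      + ∑ k, G u i k * christoffel univ G k a j u := by
  rw [sum_metric_christoffel hdet, sum_metric_christoffel hdet]
  have h : ∀ i j, (fun w => G w i j) = fun w => G w j i := by
    intro i j; ext w; exact hsymm w i j
  rw [h j i]
  ring

/-- The Christoffel symbols of a conformal metric `E • G`, where `∂ₖ E = 2 E fₖ`. -/
lemma christoffel_conformal (hsymm : ∀ w i j, G w i j = G w j i) (hdet : (G u).det ≠ 0)
    (hG : ∀ i j, DifferentiableAt ℝ (fun w => G w i j) u) {E : Euc d → ℝ} (hE : E u ≠ 0)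
    (hEd : DifferentiableAt ℝ E u) {f : Fin d → ℝ} (hf : ∀ k, pd univ E k u = 2 * E u * f k)
    (k i j : Fin d) :
    christoffel univ (fun w => E w • G w) k i j u = christoffel univ G k i j u
      + ((if k = i then f j else 0) + (if k = j then f i else 0)
        - G u i j * ∑ l, (G u)⁻¹ k l * f l) := by
  have hinv : (E u • G u)⁻¹ = (E u)⁻¹ • (G u)⁻¹ := by
    have := Matrix.inv_smul' (G u) (Units.mk0 (E u) hE) (isUnit_iff_ne_zero.2 hdet)
    simpa [Units.smul_def] using this
  have hp : ∀ a b c, pd univ (fun w => E w * G w a b) c u =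
      2 * E u * f c * G u a b + E u * pd univ (fun w => G w a b) c u := by
    intro a b c
    rw [pd_mul hEd (hG a b), hf]
  simp only [christoffel, hinv, Matrix.smul_apply, smul_eq_mul, hp]
  -- The Kronecker deltas are written as G⁻¹G, so that both sides become sums over the same index
  -- and can be compared term by term.
  have e1 : (if k = i then f j else 0) = ∑ l, (G u)⁻¹ k l * (f j * G u i l) := by
    have := sum_inv_mul_metric hdet k i
    simp only [hsymm u i]
    rw [show ∑ l, (G u)⁻¹ k l * (f j * G u l i) = f j * ∑ l, (G u)⁻¹ k l * G u l i by
      rw [Finset.mul_sum]; exact Finset.sum_congr rfl fun l _ => by ring, this]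
    simp
  have e2 : (if k = j then f i else 0) = ∑ l, (G u)⁻¹ k l * (f i * G u j l) := by
    have := sum_inv_mul_metric hdet k j
    simp only [hsymm u j]
    rw [show ∑ l, (G u)⁻¹ k l * (f i * G u l j) = f i * ∑ l, (G u)⁻¹ k l * G u l j by
      rw [Finset.mul_sum]; exact Finset.sum_congr rfl fun l _ => by ring, this]
    simp
  rw [e1, e2]
  simp only [Finset.mul_sum, ← Finset.sum_add_distrib, ← Finset.sum_sub_distrib]
  refine Finset.sum_congr rfl fun l _ => ?_
  field_simp
  ring

/-- The algebra behind the conformal change of the Ricci tensor: `C` is the difference tensor of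
the two connections, `Γ` the connection of the metric `g`, and `dC`, `dg`, `dF` are derivatives. -/
lemma sum_difference_tensor {g : Fin d → Fin d → ℝ} {Γ : Fin d → Fin d → Fin d → ℝ}
    {f F : Fin d → ℝ} {f2 dF : Fin d → Fin d → ℝ} {dg : Fin d → Fin d → Fin d → ℝ}
    {C : Fin d → Fin d → Fin d → ℝ} {dC : Fin d → Fin d → Fin d → Fin d → ℝ}
    (hg : ∀ i j, g i j = g j i) (hΓ : ∀ k i j, Γ k i j = Γ k j i)
    (hdg : ∀ a i j, dg a i j = ∑ k, g j k * Γ k a i + ∑ k, g i k * Γ k a j)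
    (hF : ∀ i, ∑ k, g i k * F k = f i) (hf2 : ∀ i j, f2 i j = f2 j i)
    (hdF : ∀ b k, ∑ i, (dg b i k * F i + g i k * dF b i) = f2 b k)
    (hC : ∀ k i j, C k i j = (if k = i then f j else 0) + (if k = j then f i else 0)
      - g i j * F k)
    (hdC : ∀ a k i j, dC a k i j = (if k = i then f2 a j else 0) + (if k = j then f2 a i else 0)
      - (dg a i j * F k + g i j * dF a k)) (j k : Fin d) :
    ∑ i, (dC i i j k - dC j i i k + ∑ m, ((Γ i i m + C i i m) * (Γ m j k + C m j k)
        - (Γ i j m + C i j m) * (Γ m i k + C m i k)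
        - (Γ i i m * Γ m j k - Γ i j m * Γ m i k)))
      = -((d : ℝ) - 2) * (f2 j k - ∑ m, f m * Γ m j k - f j * f k)
        - g j k * (∑ i, (dF i i + ∑ m, Γ i i m * F m) + ((d : ℝ) - 2) * ∑ i, f i * F i) := by
  -- The terms in dC, in ΓC and in CC are contracted separately. The derivatives of the metric
  -- coming from dC cancel against ΓC terms, and the remaining Γ terms complete the derivatives of f
  -- and F to covariant derivatives.
  have hS1 : ∀ m, ∑ i, C i i m = d * f m := by
    intro m
    have h0 : ∑ i, g i m * F i = f m := by rw [← hF m]; simp only [hg m]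
    simp only [hC, Finset.sum_sub_distrib, Finset.sum_add_distrib]
    rw [h0]
    simp
  have hT2 : ∑ i, dC j i i k = d * f2 j k := by
    simp only [hdC, Finset.sum_sub_distrib, Finset.sum_add_distrib (f := fun i => ite _ _ _), hdF]
    simp
  have hT1 : ∑ i, dC i i j k = 2 * f2 j k - (∑ i, dg i j k * F i + g j k * ∑ i, dF i i) := by
    simp only [hdC, Finset.sum_sub_distrib, Finset.sum_add_distrib, Finset.mul_sum]
    simp [hf2 k j]; ring
  have hDg : ∑ i, dg i j k * F i = ∑ i, ∑ m, Γ i j m * g i k * F m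
      + ∑ i, ∑ m, g j m * F i * Γ m i k := by
    simp only [hdg, add_mul, Finset.sum_add_distrib, Finset.sum_mul]
    congr 1
    · rw [Finset.sum_comm]
      refine Finset.sum_congr rfl fun i _ => Finset.sum_congr rfl fun m _ => ?_
      rw [hΓ i j m, hg i k]; ring
    · refine Finset.sum_congr rfl fun i _ => Finset.sum_congr rfl fun m _ => ?_
      ring
  have hM1 : ∑ i, ∑ m, Γ i i m * C m j k = (∑ i, Γ i i j) * f k + (∑ i, Γ i i k) * f j
      - g j k * ∑ i, ∑ m, Γ i i m * F m := by
    simp only [hC, mul_sub, mul_add, Finset.sum_sub_distrib, Finset.sum_add_distrib, mul_ite,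
      mul_zero, Finset.sum_ite_eq', Finset.mem_univ, if_true, Finset.sum_mul, Finset.mul_sum]
    congr 1
    refine Finset.sum_congr rfl fun i _ => Finset.sum_congr rfl fun m _ => ?_
    ring
  have hM2 : ∑ i, ∑ m, C i i m * Γ m j k = d * ∑ m, f m * Γ m j k := by
    rw [Finset.sum_comm]
    simp only [← Finset.sum_mul, hS1, Finset.mul_sum, mul_assoc]
  have hM3 : ∑ i, ∑ m, Γ i j m * C m i k = (∑ i, Γ i i j) * f k + ∑ m, f m * Γ m j k
      - ∑ i, ∑ m, Γ i j m * g i k * F m := by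
    simp only [hC, mul_sub, mul_add, Finset.sum_sub_distrib, Finset.sum_add_distrib, mul_ite,
      mul_zero, Finset.sum_ite_eq', Finset.mem_univ, if_true, Finset.sum_mul, ← mul_assoc]
    congr 2
    · exact Finset.sum_congr rfl fun i _ => by rw [hΓ i j i]
    · exact Finset.sum_congr rfl fun i _ => by ring
  have hM4 : ∑ i, ∑ m, C i j m * Γ m i k = ∑ m, f m * Γ m j k + (∑ i, Γ i i k) * f j
      - ∑ i, ∑ m, g j m * F i * Γ m i k := by
    simp only [hC, sub_mul, add_mul, Finset.sum_sub_distrib, Finset.sum_add_distrib, ite_mul,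
      zero_mul, Finset.sum_mul]
    congr 2
    · rw [Finset.sum_comm]; simp
    · simp [mul_comm]
  have hN : ∀ i, ∑ m, g m i * F m = f i := by
    intro i; rw [← hF i]; simp only [hg i]
  have hQ1 : ∑ i, ∑ m, C i i m * C m j k = d * (2 * (f j * f k) - g j k * ∑ i, f i * F i) := by
    rw [Finset.sum_comm]
    simp only [← Finset.sum_mul, hS1]
    simp only [hC, mul_sub, mul_add, Finset.sum_sub_distrib, Finset.sum_add_distrib, mul_ite,
      mul_zero, Finset.sum_ite_eq', Finset.mem_univ, if_true, Finset.mul_sum]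
    rw [show ∑ i, (d : ℝ) * f i * (g j k * F i) = ∑ i, (d : ℝ) * (g j k * (f i * F i)) from
      Finset.sum_congr rfl fun i _ => by ring]
    ring
  have hQ2 : ∑ i, ∑ m, C i j m * C m i k = (d + 2) * (f j * f k)
      - 2 * (g j k * ∑ i, f i * F i) := by
    have e1 : ∀ i, ∑ m, C i j m * C m i k = (if i = j then ∑ m, f m * C m i k else 0)
        + f j * C i i k - F i * ∑ m, g j m * C m i k := by
      intro i
      simp only [hC i j, sub_mul, add_mul, Finset.sum_sub_distrib, Finset.sum_add_distrib, ite_mul,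
        zero_mul, Finset.mul_sum]
      congr 1
      · congr 1
        · split_ifs <;> simp
        · simp
      · exact Finset.sum_congr rfl fun m _ => by ring
    have e2 : ∀ i, ∑ m, f m * C m i k = 2 * (f i * f k) - g i k * ∑ m, f m * F m := by
      intro i
      simp only [hC, mul_sub, mul_add, Finset.sum_sub_distrib, Finset.sum_add_distrib, mul_ite,
        mul_zero, Finset.sum_ite_eq', Finset.mem_univ, if_true, Finset.mul_sum]
      congr 1
      · ring
      · exact Finset.sum_congr rfl fun m _ => by ring
    have e3 : ∀ i, ∑ m, g j m * C m i k = g j i * f k + g j k * f i - g i k * f j := by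
      intro i
      rw [← hF j]
      simp only [hC, mul_sub, mul_add, Finset.sum_sub_distrib, Finset.sum_add_distrib, mul_ite,
        mul_zero, Finset.sum_ite_eq', Finset.mem_univ, if_true, Finset.mul_sum]
      congr 1
      exact Finset.sum_congr rfl fun m _ => by ring
    have e4 : ∑ i, F i * (g j i * f k + g j k * f i - g i k * f j)
        = f j * f k + g j k * ∑ i, f i * F i - f k * f j := by
      have a1 : f j * f k = ∑ i, F i * (g j i * f k) := by
        rw [← hF j, Finset.sum_mul]; exact Finset.sum_congr rfl fun m _ => by ring
      have a2 : f k * f j = ∑ i, F i * (g i k * f j) := by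
        rw [← hN k, Finset.sum_mul]; exact Finset.sum_congr rfl fun m _ => by ring
      rw [a1, a2, Finset.mul_sum, ← Finset.sum_add_distrib, ← Finset.sum_sub_distrib]
      exact Finset.sum_congr rfl fun m _ => by ring
    simp only [e1, e3, Finset.sum_add_distrib, Finset.sum_sub_distrib, ← Finset.mul_sum, hS1]
    rw [e4, Finset.sum_ite_eq']
    simp only [Finset.mem_univ, if_true, e2]
    ring
  have hexp : ∀ i, ∑ m, ((Γ i i m + C i i m) * (Γ m j k + C m j k)
        - (Γ i j m + C i j m) * (Γ m i k + C m i k) - (Γ i i m * Γ m j k - Γ i j m * Γ m i k))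
      = ∑ m, Γ i i m * C m j k + ∑ m, C i i m * Γ m j k - ∑ m, Γ i j m * C m i k
        - ∑ m, C i j m * Γ m i k + ∑ m, C i i m * C m j k - ∑ m, C i j m * C m i k := by
    intro i
    simp only [← Finset.sum_add_distrib, ← Finset.sum_sub_distrib]
    exact Finset.sum_congr rfl fun m _ => by ring
  simp only [hexp, Finset.sum_add_distrib, Finset.sum_sub_distrib]
  rw [hT1, hT2, hDg, hM1, hM2, hM3, hM4, hQ1, hQ2]
  ring

end Conformal

/-! ### Ricci tensor and Laplacian of ρ⁻²G. -/

section Conformal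

variable {d : ℕ} {G : Euc d → Matrix (Fin d) (Fin d) ℝ} {u : Euc d} {ρ : Euc d → ℝ}

/-- The components of the Hessian of `ρ`. -/
def hess (G : Euc d → Matrix (Fin d) (Fin d) ℝ) (ρ : Euc d → ℝ) (u : Euc d) (i j : Fin d) : ℝ :=
  pd univ (pd univ ρ j) i u - ∑ k, christoffel univ G k i j u * pd univ ρ k u

/-- The squared norm of the gradient of `ρ`. -/
def gradSq (G : Euc d → Matrix (Fin d) (Fin d) ℝ) (ρ : Euc d → ℝ) (u : Euc d) : ℝ :=
  ∑ i, ∑ j, (G u)⁻¹ i j * (pd univ ρ i u * pd univ ρ j u)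

lemma laplacian_eq_sum_hess :
    laplacian univ G ρ u = ∑ i, ∑ j, (G u)⁻¹ i j * hess G ρ u i j := rfl

lemma contDiffAt_christoffel (hG : ∀ i j, ContDiffAt ℝ 2 (fun w => G w i j) u)
    (hdet : (G u).det ≠ 0) (k i j : Fin d) : ContDiffAt ℝ 1 (christoffel univ G k i j) u := by
  unfold christoffel
  refine contDiffAt_const.mul (ContDiffAt.sum fun l _ => ?_)
  have h1 : ∀ a b c, ContDiffAt ℝ 1 (pd univ (fun w => G w a b) c) u := fun a b c =>
    contDiffAt_pd (hG a b) (by norm_num) c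
  exact ((contDiffAt_inv_apply hG hdet k l).of_le (by norm_num)).mul
    (((h1 _ _ _).add (h1 _ _ _)).sub (h1 _ _ _))

lemma eventually_det_ne_zero (hG : ∀ i j, ContDiffAt ℝ 2 (fun w => G w i j) u)
    (hdet : (G u).det ≠ 0) : ∀ᶠ w in 𝓝 u, (G w).det ≠ 0 :=
  (contDiffAt_det hG).continuousAt.eventually_ne hdet

lemma pd_inv_sq (hρ : DifferentiableAt ℝ ρ u) (h0 : ρ u ≠ 0) (k : Fin d) :
    pd univ (fun w => (ρ w ^ 2)⁻¹) k u = 2 * (ρ u ^ 2)⁻¹ * (-(pd univ ρ k u / ρ u)) := by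
  have h : HasDerivAt (fun t : ℝ => (t ^ 2)⁻¹) (-(2 * ρ u) / (ρ u ^ 2) ^ 2) (ρ u) := by
    simpa using (hasDerivAt_pow 2 (ρ u)).fun_inv (pow_ne_zero 2 h0)
  rw [pd_comp_real h hρ]
  field_simp

lemma pd_log_grad (hρ : ContDiffAt ℝ 2 ρ u) (h0 : ρ u ≠ 0) (a k : Fin d) :
    pd univ (fun w => -(pd univ ρ k w / ρ w)) a u
      = -(pd univ (pd univ ρ k) a u / ρ u) + pd univ ρ a u * pd univ ρ k u / ρ u ^ 2 := by
  have h1 : DifferentiableAt ℝ ρ u := hρ.differentiableAt (by norm_num)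
  have h2 : DifferentiableAt ℝ (pd univ ρ k) u :=
    (contDiffAt_pd (m := 1) hρ (by norm_num) k).differentiableAt (by norm_num)
  have h : HasDerivAt (fun t : ℝ => -t⁻¹) ((ρ u ^ 2)⁻¹) (ρ u) := by
    simpa using (hasDerivAt_inv h0).fun_neg
  have e : (fun w => -(pd univ ρ k w / ρ w)) = fun w => pd univ ρ k w * (-(ρ w)⁻¹) := by
    ext w; rw [div_eq_mul_inv]; ring
  have h3 : DifferentiableAt ℝ (fun w => -(ρ w)⁻¹) u := h.differentiableAt.comp u h1
  rw [e, pd_mul h2 h3, pd_comp_real h h1]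
  field_simp

lemma christoffel_conformal_inv_sq (hsymm : ∀ w i j, G w i j = G w j i)
    (hG : ∀ i j, ContDiffAt ℝ 2 (fun w => G w i j) u)
    (hdet : (G u).det ≠ 0) (hρ : ContDiffAt ℝ 2 ρ u) (h0 : ρ u ≠ 0) (k i j : Fin d) :
    ∀ᶠ w in 𝓝 u, christoffel univ (fun w => (ρ w ^ 2)⁻¹ • G w) k i j w
      = christoffel univ G k i j w + ((if k = i then -(pd univ ρ j w / ρ w) else 0)
        + (if k = j then -(pd univ ρ i w / ρ w) else 0)
        - G w i j * ∑ l, (G w)⁻¹ k l * (-(pd univ ρ l w / ρ w))) := by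
  have hGe : ∀ᶠ w in 𝓝 u, ∀ i j, ContDiffAt ℝ 2 (fun w => G w i j) w := by
    simp only [eventually_all]
    exact fun i j => (hG i j).eventually (by simp)
  filter_upwards [hGe, hρ.eventually (by simp), hρ.continuousAt.eventually_ne h0,
    eventually_det_ne_zero hG hdet] with w hGw hρw h0w hdw
  have h1 : DifferentiableAt ℝ ρ w := hρw.differentiableAt (by norm_num)
  refine christoffel_conformal (f := fun k => -(pd univ ρ k w / ρ w)) hsymm hdw
    (fun i j => (hGw i j).differentiableAt (by norm_num)) (by simpa using h0w)
    ((h1.pow 2).inv (pow_ne_zero 2 h0w)) (fun k => pd_inv_sq h1 h0w k) k i j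

/-- The Ricci tensor of the conformal metric `ρ⁻² G`. -/
theorem ricci_conformal_inv_sq (hsymm : ∀ w i j, G w i j = G w j i)
    (hG : ∀ i j, ContDiffAt ℝ 2 (fun w => G w i j) u)
    (hdet : (G u).det ≠ 0) (hρ : ContDiffAt ℝ 2 ρ u) (h0 : ρ u ≠ 0) (j k : Fin d) :
    ricci univ (fun w => (ρ w ^ 2)⁻¹ • G w) u j k = ricci univ G u j k
      + ((d : ℝ) - 2) / ρ u * hess G ρ u j k
      + (laplacian univ G ρ u / ρ u - ((d : ℝ) - 1) * gradSq G ρ u / ρ u ^ 2) * G u j k := by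
  -- With ρ⁻² = e^(2φ) and φ = -log ρ, f is dφ, F is the gradient of φ with respect to G, and C is
  -- the difference of the two connections.
  set f : Fin d → Euc d → ℝ := fun k w => -(pd univ ρ k w / ρ w) with hfdef
  set F : Fin d → Euc d → ℝ := fun k w => ∑ l, (G w)⁻¹ k l * f l w with hFdef
  set C : Fin d → Fin d → Fin d → Euc d → ℝ := fun k i j w =>
    (if k = i then f j w else 0) + (if k = j then f i w else 0) - G w i j * F k w with hCdef
  have hGd : ∀ i j, DifferentiableAt ℝ (fun w => G w i j) u := fun i j =>
    (hG i j).differentiableAt (by norm_num)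
  have hfd : ∀ k, DifferentiableAt ℝ (f k) u := by
    intro k
    have h2 : DifferentiableAt ℝ (pd univ ρ k) u :=
      (contDiffAt_pd (m := 1) hρ (by norm_num) k).differentiableAt (by norm_num)
    have h1 : DifferentiableAt ℝ ρ u := hρ.differentiableAt (by norm_num)
    simp only [hfdef, div_eq_mul_inv]
    exact (h2.fun_mul (h1.fun_inv h0)).fun_neg
  have hinvd : ∀ k l, DifferentiableAt ℝ (fun w => (G w)⁻¹ k l) u := fun k l =>
    (contDiffAt_inv_apply hG hdet k l).differentiableAt (by norm_num)
  have hFd : ∀ k, DifferentiableAt ℝ (F k) u := fun k =>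
    DifferentiableAt.fun_sum fun l _ => (hinvd k l).mul (hfd l)
  have hCd : ∀ k i j, DifferentiableAt ℝ (C k i j) u := by
    intro k i j
    refine DifferentiableAt.sub (DifferentiableAt.add ?_ ?_) ((hGd i j).mul (hFd k))
    · split_ifs
      · exact hfd j
      · exact differentiableAt_const _
    · split_ifs
      · exact hfd i
      · exact differentiableAt_const _
  have hΓd : ∀ k i j, DifferentiableAt ℝ (christoffel univ G k i j) u := fun k i j =>
    (contDiffAt_christoffel hG hdet k i j).differentiableAt (by norm_num)
  have hΓ : ∀ k i j, ∀ᶠ w in 𝓝 u, christoffel univ (fun w => (ρ w ^ 2)⁻¹ • G w) k i j w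
      = christoffel univ G k i j w + C k i j w := fun k i j =>
    christoffel_conformal_inv_sq hsymm hG hdet hρ h0 k i j
  have hΓu : ∀ k i j, christoffel univ (fun w => (ρ w ^ 2)⁻¹ • G w) k i j u
      = christoffel univ G k i j u + C k i j u := fun k i j => (hΓ k i j).self_of_nhds
  have hΓp : ∀ k i j a, pd univ (christoffel univ (fun w => (ρ w ^ 2)⁻¹ • G w) k i j) a u
      = pd univ (christoffel univ G k i j) a u + pd univ (C k i j) a u := by
    intro k i j a
    rw [(pd_congr univ_mem (hΓ k i j) a).self_of_nhds, pd_add (hΓd k i j) (hCd k i j)]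
  have hGF : ∀ᶠ w in 𝓝 u, ∀ i, ∑ k, G w i k * F k w = f i w := by
    filter_upwards [eventually_det_ne_zero hG hdet] with w hw i
    simp only [hFdef, Finset.mul_sum]
    rw [Finset.sum_comm]
    simp only [← mul_assoc, ← Finset.sum_mul]
    simp [sum_metric_mul_inv hw]
  have hdC : ∀ a k i j, pd univ (C k i j) a u = (if k = i then pd univ (f j) a u else 0)
      + (if k = j then pd univ (f i) a u else 0)
      - (pd univ (fun w => G w i j) a u * F k u + G u i j * pd univ (F k) a u) := by
    intro a k i j
    have e1 : ∀ (p : Prop) [Decidable p] (l : Fin d),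
        DifferentiableAt ℝ (fun w => if p then f l w else 0) u := by
      intro p _ l
      split_ifs
      · exact hfd l
      · exact differentiableAt_const _
    have e2 : ∀ (p : Prop) [Decidable p] (l : Fin d),
        pd univ (fun w => if p then f l w else 0) a u = if p then pd univ (f l) a u else 0 := by
      intro p _ l
      split_ifs
      · rfl
      · exact pd_const _ _ _
    simp only [hCdef]
    rw [pd_sub ((e1 _ _).fun_add (e1 _ _)) ((hGd i j).fun_mul (hFd k)), pd_add (e1 _ _) (e1 _ _),
      pd_mul (hGd i j) (hFd k), e2, e2]
  have hdF : ∀ b k, ∑ i, (pd univ (fun w => G w i k) b u * F i u + G u i k * pd univ (F i) b u)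
      = pd univ (f k) b u := by
    intro b k
    rw [← (pd_congr univ_mem (hGF.mono fun w hw => hw k) b).self_of_nhds,
      pd_sum _ fun i _ => (hGd k i).fun_mul (hFd i)]
    refine Finset.sum_congr rfl fun i _ => ?_
    rw [pd_mul (hGd k i) (hFd i)]
    have : (fun w => G w i k) = fun w => G w k i := by ext w; exact hsymm w i k
    rw [this, hsymm u i k]
  have hf2 : ∀ a k, pd univ (f k) a u
      = -(pd univ (pd univ ρ k) a u / ρ u) + pd univ ρ a u * pd univ ρ k u / ρ u ^ 2 :=
    fun a k => pd_log_grad hρ h0 a k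
  have hf2s : ∀ i j, pd univ (f j) i u = pd univ (f i) j u := by
    intro i j
    rw [hf2, hf2, pd_pd_comm hρ]; ring
  have key := sum_difference_tensor (g := fun i j => G u i j)
    (Γ := fun k i j => christoffel univ G k i j u) (f := fun i => f i u) (F := fun i => F i u)
    (f2 := fun a i => pd univ (f i) a u) (dF := fun a i => pd univ (F i) a u)
    (dg := fun a i j => pd univ (fun w => G w i j) a u) (C := fun k i j => C k i j u)
    (dC := fun a k i j => pd univ (C k i j) a u) (hsymm u)
    (fun k i j => christoffel_symm hsymm k i j) (fun a i j => pd_metric hsymm hdet a i j)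
    (fun i => hGF.self_of_nhds i) hf2s hdF (fun k i j => rfl) hdC j k
  have hR : ricci univ (fun w => (ρ w ^ 2)⁻¹ • G w) u j k = ricci univ G u j k
      + ∑ i, (pd univ (C i j k) i u - pd univ (C i i k) j u
        + ∑ m, ((christoffel univ G i i m u + C i i m u) * (christoffel univ G m j k u + C m j k u)
        - (christoffel univ G i j m u + C i j m u) * (christoffel univ G m i k u + C m i k u)
        - (christoffel univ G i i m u * christoffel univ G m j k u
          - christoffel univ G i j m u * christoffel univ G m i k u))) := by
    simp only [ricci, riemannUp, Matrix.of_apply, hΓp, hΓu, ← Finset.sum_add_distrib]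
    refine Finset.sum_congr rfl fun i _ => ?_
    simp only [Finset.sum_sub_distrib]
    ring
  -- ∇²φ - dφ⊗dφ = -Hess ρ / ρ: the two terms in dρ⊗dρ cancel. This is why the final formula is
  -- linear in Hess ρ.
  have hH : ∀ a b, pd univ (f b) a u - ∑ m, f m u * christoffel univ G m a b u - f a u * f b u
      = -(hess G ρ u a b / ρ u) := by
    intro a b
    rw [hf2, hess]
    simp only [hfdef]
    have : ∑ m, -(pd univ ρ m u / ρ u) * christoffel univ G m a b u
        = -((∑ m, christoffel univ G m a b u * pd univ ρ m u) / ρ u) := by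
      rw [Finset.sum_div, ← Finset.sum_neg_distrib]
      exact Finset.sum_congr rfl fun m _ => by ring
    rw [this]
    field_simp
    ring
  have hfF : ∑ i, f i u * F i u = gradSq G ρ u / ρ u ^ 2 := by
    simp only [hfdef, hFdef, gradSq, Finset.sum_div, Finset.mul_sum]
    exact Finset.sum_congr rfl fun i _ => Finset.sum_congr rfl fun l _ => by field_simp
  have hdiv : ∑ i, (pd univ (F i) i u + ∑ m, christoffel univ G i i m u * F m u)
      = -(laplacian univ G ρ u / ρ u) + gradSq G ρ u / ρ u ^ 2 := by
    -- Lowering an index commutes with the covariant derivative. The divergence of F is then the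
    -- trace of ∇f, that is, the Laplacian of -log ρ.
    have e1 : ∀ b k, pd univ (f k) b u - ∑ m, f m u * christoffel univ G m b k u
        = ∑ m, G u k m * (pd univ (F m) b u + ∑ i, christoffel univ G m b i u * F i u) := by
      intro b k
      have e2 : ∑ i, (∑ m, G u i m * christoffel univ G m b k u) * F i u
          = ∑ m, f m u * christoffel univ G m b k u := by
        simp only [Finset.sum_mul]
        rw [Finset.sum_comm]
        refine Finset.sum_congr rfl fun m _ => ?_
        rw [← hGF.self_of_nhds m, Finset.sum_mul]
        exact Finset.sum_congr rfl fun i _ => by rw [hsymm u i m]; ring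
      rw [← hdF b k]
      simp only [pd_metric hsymm hdet b, Finset.sum_add_distrib, add_mul, e2, mul_add]
      have e3 : ∑ i, (∑ m, G u k m * christoffel univ G m b i u) * F i u
          = ∑ m, G u k m * ∑ i, christoffel univ G m b i u * F i u := by
        simp only [Finset.sum_mul, Finset.mul_sum]
        rw [Finset.sum_comm]
        exact Finset.sum_congr rfl fun m _ => Finset.sum_congr rfl fun i _ => by ring
      rw [e3]
      simp only [hsymm u k]
      ring
    have e4 : ∑ b, ∑ k, (G u)⁻¹ b k * (pd univ (f k) b u
        - ∑ m, f m u * christoffel univ G m b k u)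
        = ∑ i, (pd univ (F i) i u + ∑ m, christoffel univ G i i m u * F m u) := by
      refine Finset.sum_congr rfl fun b _ => ?_
      simp only [e1, Finset.mul_sum]
      rw [Finset.sum_comm]
      simp only [← mul_assoc, ← Finset.sum_mul]
      simp [sum_inv_mul_metric hdet]
    rw [← e4, laplacian_eq_sum_hess, gradSq]
    simp only [Finset.sum_div, ← Finset.sum_neg_distrib, ← Finset.sum_add_distrib]
    refine Finset.sum_congr rfl fun b _ => Finset.sum_congr rfl fun k _ => ?_
    have := hH b k
    rw [sub_eq_iff_eq_add] at this
    rw [this]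
    simp only [hfdef]
    field_simp
  rw [hR, key, hH, hdiv, hfF]
  field_simp
  ring

/-- The Laplacian, with respect to the conformal metric `ρ⁻² G`, of a power of `ρ`. -/
theorem laplacian_conformal_rpow (hsymm : ∀ w i j, G w i j = G w j i)
    (hG : ∀ i j, ContDiffAt ℝ 2 (fun w => G w i j) u)
    (hdet : (G u).det ≠ 0) (hρ : ContDiffAt ℝ 2 ρ u) (h0 : 0 < ρ u) (s : ℝ) :
    laplacian univ (fun w => (ρ w ^ 2)⁻¹ • G w) (fun w => ρ w ^ s) u
      = s * ρ u ^ s * (ρ u * laplacian univ G ρ u + (s + 1 - d) * gradSq G ρ u) := by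
  have hρ1 : DifferentiableAt ℝ ρ u := hρ.differentiableAt (by norm_num)
  have hinv : ((ρ u ^ 2)⁻¹ • G u)⁻¹ = ρ u ^ 2 • (G u)⁻¹ := by
    have := Matrix.inv_smul' (G u) (Units.mk0 ((ρ u ^ 2)⁻¹) (by positivity))
      (isUnit_iff_ne_zero.2 hdet)
    simpa [Units.smul_def] using this
  have hv : ∀ k, ∀ᶠ w in 𝓝 u, pd univ (fun w => ρ w ^ s) k w = s * ρ w ^ (s - 1) * pd univ ρ k w := by
    intro k
    filter_upwards [hρ.eventually (by simp), hρ.continuousAt.eventually_ne h0.ne'] with w hw hw0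
    exact pd_comp_real (Real.hasDerivAt_rpow_const (Or.inl hw0))
      (hw.differentiableAt (by norm_num)) k
  have hv2 : ∀ i j, pd univ (pd univ (fun w => ρ w ^ s) j) i u
      = s * ((s - 1) * ρ u ^ (s - 1 - 1) * pd univ ρ i u) * pd univ ρ j u
        + s * ρ u ^ (s - 1) * pd univ (pd univ ρ j) i u := by
    intro i j
    have hr : HasDerivAt (fun t : ℝ => t ^ (s - 1)) ((s - 1) * ρ u ^ (s - 1 - 1)) (ρ u) :=
      Real.hasDerivAt_rpow_const (Or.inl h0.ne')
    have h1 : DifferentiableAt ℝ (fun w => ρ w ^ (s - 1)) u := hr.differentiableAt.comp u hρ1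
    rw [(pd_congr univ_mem (hv j) i).self_of_nhds, pd_mul (h1.const_mul s)
      ((contDiffAt_pd (m := 1) hρ (by norm_num) j).differentiableAt (by norm_num)),
      pd_const_mul s h1, pd_comp_real hr hρ1]
  have hv1 : ∀ k, pd univ (fun w => ρ w ^ s) k u = s * ρ u ^ (s - 1) * pd univ ρ k u := fun k =>
    (hv k).self_of_nhds
  have hC : ∀ i j, ∑ k, christoffel univ (fun w => (ρ w ^ 2)⁻¹ • G w) k i j u * pd univ ρ k u
      = ∑ k, christoffel univ G k i j u * pd univ ρ k u
        - (2 * (pd univ ρ i u * pd univ ρ j u) - G u i j * gradSq G ρ u) / ρ u := by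
    intro i j
    have e : gradSq G ρ u = -(ρ u * ∑ k, (∑ l, (G u)⁻¹ k l * (-(pd univ ρ l u / ρ u)))
        * pd univ ρ k u) := by
      simp only [gradSq, Finset.mul_sum, Finset.sum_mul, ← Finset.sum_neg_distrib]
      exact Finset.sum_congr rfl fun k _ => Finset.sum_congr rfl fun l _ => by field_simp
    have e1 : ∀ k, christoffel univ (fun w => (ρ w ^ 2)⁻¹ • G w) k i j u = _ := fun k =>
      (christoffel_conformal_inv_sq hsymm hG hdet hρ h0.ne' k i j).self_of_nhds
    simp only [e1, add_mul, sub_mul, Finset.sum_add_distrib, Finset.sum_sub_distrib, ite_mul,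
      zero_mul, Finset.sum_ite_eq', Finset.mem_univ, if_true]
    rw [e]
    simp only [mul_assoc, ← Finset.mul_sum]
    field_simp
    ring
  have hd : ∑ i, ∑ j, (G u)⁻¹ i j * G u i j = d := by
    have : ∀ i, ∑ j, (G u)⁻¹ i j * G u i j = 1 := by
      intro i
      have := sum_inv_mul_metric hdet i i
      simpa [hsymm u i] using this
    simp [this]
  have p1 : ρ u ^ (s - 1 - 1) = ρ u ^ s / ρ u ^ 2 := by
    rw [Real.rpow_sub h0, Real.rpow_sub h0, Real.rpow_one]; field_simp
  have p2 : ρ u ^ (s - 1) = ρ u ^ s / ρ u := by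
    rw [Real.rpow_sub h0, Real.rpow_one]
  have hterm : ∀ i j, (ρ u ^ 2 • (G u)⁻¹) i j * (pd univ (pd univ (fun w => ρ w ^ s) j) i u
      - ∑ k, christoffel univ (fun w => (ρ w ^ 2)⁻¹ • G w) k i j u
        * pd univ (fun w => ρ w ^ s) k u)
      = s * ρ u ^ s * (ρ u * ((G u)⁻¹ i j * hess G ρ u i j)
        + (s + 1) * ((G u)⁻¹ i j * (pd univ ρ i u * pd univ ρ j u))
        - gradSq G ρ u * ((G u)⁻¹ i j * G u i j)) := by
    intro i j
    have e2 : ∑ k, christoffel univ (fun w => (ρ w ^ 2)⁻¹ • G w) k i j u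
        * pd univ (fun w => ρ w ^ s) k u = s * ρ u ^ (s - 1) *
          ∑ k, christoffel univ (fun w => (ρ w ^ 2)⁻¹ • G w) k i j u * pd univ ρ k u := by
      rw [Finset.mul_sum]
      exact Finset.sum_congr rfl fun k _ => by rw [hv1]; ring
    rw [e2, hC, hv2, hess, p1, p2, Matrix.smul_apply, smul_eq_mul]
    field_simp
    ring
  unfold laplacian at *
  simp only [hinv, hterm, ← Finset.mul_sum, Finset.sum_add_distrib, Finset.sum_sub_distrib, hd]
  simp only [hess, gradSq]
  ring

end Conformal

/-! ### Norms of bilinear forms in an orthonormal frame. -/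

section Algebra

variable {n : Type*} [Fintype n] [DecidableEq n]

/-- The squared norm of the bilinear form `A` with respect to the inner product `G`. -/
def formNormSq (G A : Matrix n n ℝ) : ℝ :=
  ∑ i, ∑ j, ∑ a, ∑ b, G⁻¹ i a * G⁻¹ j b * A i j * A a b

open scoped MatrixOrder in
-- Factor G = BᵀB. The columns of B⁻¹ form an orthonormal frame, T holds the components of A in it,
-- and B v those of v. The invariants of A become plain sums, to which the Cauchy-Schwarz inequality
-- applies.
lemma exists_orthonormal_components {G : Matrix n n ℝ} (hG : G.PosDef) (A : Matrix n n ℝ) :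
    ∃ B T : Matrix n n ℝ, formNormSq G A = ∑ k, ∑ l, T k l ^ 2 ∧
      ∑ i, ∑ j, G⁻¹ i j * A i j = ∑ k, T k k ∧
      (∀ v : n → ℝ, v ⬝ᵥ G.mulVec v = ∑ k, (B.mulVec v) k ^ 2) ∧
      ∀ v : n → ℝ, v ⬝ᵥ A.mulVec v = ∑ k, ∑ l, T k l * ((B.mulVec v) k * (B.mulVec v) l) := by
  obtain ⟨B, hB⟩ := CStarAlgebra.nonneg_iff_eq_star_mul_self.1 hG.posSemidef.nonneg
  rw [Matrix.star_eq_conjTranspose, Matrix.conjTranspose_eq_transpose_of_trivial] at hB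
  have hdet : IsUnit B.det := by
    have : G.det ≠ 0 := hG.det_pos.ne'
    rw [hB, Matrix.det_mul, Matrix.det_transpose] at this
    exact isUnit_iff_ne_zero.2 fun h => this (by rw [h]; ring)
  set P := B⁻¹ with hP
  have hinv : G⁻¹ = P * P.transpose := by
    rw [hB, Matrix.mul_inv_rev, hP, Matrix.transpose_nonsing_inv]
  have hinvs : G⁻¹.transpose = G⁻¹ := by rw [hinv]; simp
  set T := P.transpose * A * P with hT
  have hA : A = B.transpose * T * B := by
    have h1 : B.transpose * P.transpose = 1 := by
      rw [← Matrix.transpose_mul, hP, Matrix.nonsing_inv_mul _ hdet, Matrix.transpose_one]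
    have h2 : P * B = 1 := Matrix.nonsing_inv_mul _ hdet
    calc A = (B.transpose * P.transpose) * A * (P * B) := by rw [h1, h2]; simp
      _ = _ := by simp only [hT, Matrix.mul_assoc]
  have hquad : ∀ (C : Matrix n n ℝ) (v : n → ℝ), v ⬝ᵥ (B.transpose * C * B).mulVec v
      = B.mulVec v ⬝ᵥ C.mulVec (B.mulVec v) := by
    intro C v
    rw [Matrix.mul_assoc, ← Matrix.mulVec_mulVec, Matrix.dotProduct_mulVec,
      Matrix.vecMul_transpose, ← Matrix.mulVec_mulVec]
  refine ⟨B, T, ?_, ?_, ?_, ?_⟩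
  · have e1 : formNormSq G A = Matrix.trace (G⁻¹ * (A * (G⁻¹.transpose * A.transpose))) := by
      simp only [formNormSq, Matrix.trace, Matrix.diag, Matrix.mul_apply, Matrix.transpose_apply,
        Finset.mul_sum]
      refine Finset.sum_congr rfl fun i _ => ?_
      rw [Finset.sum_comm]
      refine Finset.sum_congr rfl fun a _ => ?_
      rw [Finset.sum_comm]
      exact Finset.sum_congr rfl fun b _ => Finset.sum_congr rfl fun j _ => by ring
    have e2 : ∑ k, ∑ l, T k l ^ 2 = Matrix.trace (T * T.transpose) := by
      simp [Matrix.trace, Matrix.mul_apply, sq]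
    rw [e1, e2, hinvs, hinv, hT]
    simp only [Matrix.transpose_mul, Matrix.transpose_transpose, ← Matrix.mul_assoc]
    rw [Matrix.trace_mul_comm _ P]
    conv_rhs => rw [Matrix.trace_mul_comm]
    simp only [Matrix.mul_assoc]
    rw [Matrix.trace_mul_comm P]
    simp only [Matrix.mul_assoc]
  · have e1 : ∑ i, ∑ j, G⁻¹ i j * A i j = Matrix.trace (G⁻¹ * A.transpose) := by
      simp [Matrix.trace, Matrix.mul_apply]
    have e2 : ∑ k, T k k = Matrix.trace T := rfl
    rw [e1, e2, ← Matrix.trace_transpose T, hinv, hT]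
    simp only [Matrix.transpose_mul, Matrix.transpose_transpose, Matrix.mul_assoc]
    rw [Matrix.trace_mul_comm]
    simp only [Matrix.mul_assoc]
  · intro v
    have := hquad 1 v
    rw [Matrix.mul_one, ← hB] at this
    rw [this]; simp [dotProduct, sq]
  · intro v
    conv_lhs => rw [hA, hquad T v]
    simp only [dotProduct, Matrix.mulVec, Finset.mul_sum]
    exact Finset.sum_congr rfl fun i _ => Finset.sum_congr rfl fun j _ => by ring_nf

lemma abs_quadForm_le {G : Matrix n n ℝ} (hG : G.PosDef) (A : Matrix n n ℝ) (v : n → ℝ) :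
    |v ⬝ᵥ A.mulVec v| ≤ √(formNormSq G A) * (v ⬝ᵥ G.mulVec v) := by
  obtain ⟨B, T, h1, -, h3, h4⟩ := exists_orthonormal_components hG A
  rw [h1, h3, h4]
  set x := B.mulVec v
  have hx : 0 ≤ ∑ k, x k ^ 2 := Finset.sum_nonneg fun k _ => sq_nonneg _
  have hT : 0 ≤ ∑ k, ∑ l, T k l ^ 2 :=
    Finset.sum_nonneg fun k _ => Finset.sum_nonneg fun l _ => sq_nonneg _
  refine abs_le_of_sq_le_sq ?_ (by positivity)
  rw [mul_pow, Real.sq_sqrt hT]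
  have e1 : ∑ k, ∑ l, T k l * (x k * x l)
      = ∑ kl : n × n, T kl.1 kl.2 * (x kl.1 * x kl.2) := by
    rw [Fintype.sum_prod_type]
  have e2 : ∑ k, ∑ l, T k l ^ 2 = ∑ kl : n × n, T kl.1 kl.2 ^ 2 := by
    rw [Fintype.sum_prod_type]
  have e3 : (∑ k, x k ^ 2) ^ 2 = ∑ kl : n × n, (x kl.1 * x kl.2) ^ 2 := by
    rw [Fintype.sum_prod_type, sq, Finset.sum_mul_sum]
    simp only [mul_pow]
  rw [e1, e2, e3]
  exact Finset.sum_mul_sq_le_sq_mul_sq _ _ _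

/-- Cauchy-Schwarz for the diagonal components in an orthonormal frame, the off-diagonal squares
being dropped. -/
lemma sq_trace_le {G : Matrix n n ℝ} (hG : G.PosDef) (A : Matrix n n ℝ) :
    (∑ i, ∑ j, G⁻¹ i j * A i j) ^ 2 ≤ Fintype.card n * formNormSq G A := by
  obtain ⟨B, T, h1, h2, -, -⟩ := exists_orthonormal_components hG A
  rw [h1, h2]
  have := sq_sum_le_card_mul_sum_sq (s := Finset.univ) (f := fun k => T k k)
  refine this.trans ?_
  rw [Finset.card_univ]
  refine mul_le_mul_of_nonneg_left (Finset.sum_le_sum fun k _ => ?_) (by positivity)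
  exact Finset.single_le_sum (f := fun l => T k l ^ 2) (fun l _ => sq_nonneg _) (Finset.mem_univ k)

end Algebra

/-! ### The equations for ∇ρ and Hess ρ. -/

section Einstein

variable {d : ℕ} {G : Euc d → Matrix (Fin d) (Fin d) ℝ} {u : Euc d} {ρ : Euc d → ℝ}

lemma ricciNorm_eq : ricciNorm univ G u = √(formNormSq (G u) (ricci univ G u)) := rfl

/-- The equations satisfied by the adapted defining function of a Poincaré-Einstein metric. -/
theorem gradSq_and_hess_of_einstein (hd : 5 ≤ d) (hsymm : ∀ w i j, G w i j = G w j i)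
    (hG : ∀ i j, ContDiffAt ℝ 2 (fun w => G w i j) u)
    (hdet : (G u).det ≠ 0) (hρ : ContDiffAt ℝ 2 ρ u) (h0 : 0 < ρ u)
    (hE : ricci univ (fun w => (ρ w ^ 2)⁻¹ • G w) u = (-((d : ℝ) - 1)) • ((ρ u ^ 2)⁻¹ • G u))
    (hA : -laplacian univ (fun w => (ρ w ^ 2)⁻¹ • G w) (fun w => ρ w ^ (((d : ℝ) - 4) / 2)) u
      - (((d : ℝ) - 1) ^ 2 - 9) / 4 * ρ u ^ (((d : ℝ) - 4) / 2) = 0) :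
    gradSq G ρ u = 1 - scalar univ G u * ρ u ^ 2 / (2 * ((d : ℝ) - 1)) ∧
    ∀ j k, hess G ρ u j k = -(ρ u / ((d : ℝ) - 2)) * (ricci univ G u j k
      + ((d : ℝ) - 4) / (4 * ((d : ℝ) - 1)) * scalar univ G u * G u j k) := by
  have hd' : (5 : ℝ) ≤ d := by exact_mod_cast hd
  rw [laplacian_conformal_rpow hsymm hG hdet hρ h0] at hA
  set s : ℝ := ((d : ℝ) - 4) / 2 with hs
  have hsp : 0 < ρ u ^ s := Real.rpow_pos_of_pos h0 s
  -- For s = (d-4)/2, both s + 1 - d = -(d+2)/2 and ((d-1)² - 9)/4 = s(d+2)/2, so s ρ^s factors out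
  -- of the adapted equation.
  have hlap : ρ u * laplacian univ G ρ u = ((d : ℝ) + 2) / 2 * (gradSq G ρ u - 1) := by
    have hs0 : 0 < s := by rw [hs]; linarith
    have : s * ρ u ^ s * (ρ u * laplacian univ G ρ u
        - ((d : ℝ) + 2) / 2 * (gradSq G ρ u - 1)) = 0 := by
      rw [← neg_eq_zero, ← hA, hs]; ring
    have h := (mul_eq_zero.1 this).resolve_left (by positivity)
    linarith
  have hRic : ∀ j k, -((d : ℝ) - 1) * ((ρ u ^ 2)⁻¹ * G u j k) = ricci univ G u j k
      + ((d : ℝ) - 2) / ρ u * hess G ρ u j k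
      + (laplacian univ G ρ u / ρ u - ((d : ℝ) - 1) * gradSq G ρ u / ρ u ^ 2) * G u j k := by
    intro j k
    rw [← ricci_conformal_inv_sq hsymm hG hdet hρ h0.ne', hE]
    rfl
  have hdt : ∑ i, ∑ j, (G u)⁻¹ i j * G u i j = d := by
    have : ∀ i, ∑ j, (G u)⁻¹ i j * G u i j = 1 := by
      intro i
      have := sum_inv_mul_metric hdet i i
      simpa [hsymm u i] using this
    simp [this]
  -- The trace of the Einstein equation. With the value of Δρ just found it determines |∇ρ|², and
  -- the untraced equation then determines Hess ρ.
  have htr : -((d : ℝ) - 1) * (ρ u ^ 2)⁻¹ * d = scalar univ G u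
      + ((d : ℝ) - 2) / ρ u * laplacian univ G ρ u
      + (laplacian univ G ρ u / ρ u - ((d : ℝ) - 1) * gradSq G ρ u / ρ u ^ 2) * d := by
    have hlin : ∀ a : ℝ, ∑ i, ∑ j, (G u)⁻¹ i j * (a * G u i j) = a * d := by
      intro a
      rw [← hdt]
      simp only [Finset.mul_sum]
      exact Finset.sum_congr rfl fun i _ => Finset.sum_congr rfl fun j _ => by ring
    rw [← hlin, ← hlin]
    conv_rhs => rw [laplacian_eq_sum_hess (G := G), scalar]
    rw [laplacian_eq_sum_hess (G := G)] at hRic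
    rw [Finset.mul_sum, ← Finset.sum_add_distrib, ← Finset.sum_add_distrib]
    refine Finset.sum_congr rfl fun i _ => ?_
    rw [Finset.mul_sum, ← Finset.sum_add_distrib, ← Finset.sum_add_distrib]
    refine Finset.sum_congr rfl fun j _ => ?_
    linear_combination (G u)⁻¹ i j * hRic i j
  have hlap' : laplacian univ G ρ u = ((d : ℝ) + 2) / 2 * (gradSq G ρ u - 1) / ρ u := by
    rw [← hlap]; field_simp
  have hgr : gradSq G ρ u = 1 - scalar univ G u * ρ u ^ 2 / (2 * ((d : ℝ) - 1)) := by
    rw [hlap'] at htr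
    have hd1 : (d : ℝ) - 1 ≠ 0 := by linarith
    field_simp at htr ⊢
    linear_combination (-1 / 2) * htr
  refine ⟨hgr, fun j k => ?_⟩
  have h := hRic j k
  rw [hlap', hgr] at h
  have hd1 : (d : ℝ) - 1 ≠ 0 := by linarith
  have hd2 : (d : ℝ) - 2 ≠ 0 := by linarith
  field_simp at h ⊢
  refine mul_left_cancel₀ h0.ne' ?_
  linear_combination (-1) * h

end Einstein

/-! ### Contraction of a weighted metric by -ρ∇ρ, in coordinates. -/

section Push

variable {d : ℕ}

/-- The quadratic form with components `A`. -/
def quad (A : Matrix (Fin d) (Fin d) ℝ) (v : Euc d) : ℝ := ∑ i, ∑ j, A i j * (v i * v j)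

lemma quad_smul (A : Matrix (Fin d) (Fin d) ℝ) (c : ℝ) (v : Euc d) :
    quad (c • A) v = c * quad A v := by
  simp only [quad, Finset.mul_sum, Matrix.smul_apply, smul_eq_mul, mul_assoc]

lemma quad_eq_dotProduct (A : Matrix (Fin d) (Fin d) ℝ) (v : Euc d) :
    quad A v = v ⬝ᵥ A.mulVec v := by
  simp only [quad, dotProduct, Matrix.mulVec, Finset.mul_sum]
  exact Finset.sum_congr rfl fun i _ => Finset.sum_congr rfl fun j _ => by ring

/-- If the derivative of the metric `A` along the vector field `X` is negative at `u₀`, then the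
maps `u ↦ u + s X u` do not increase lengths near `u₀`, for small `s ≥ 0`. -/
theorem eventually_quad_push_le {A : Euc d → Matrix (Fin d) (Fin d) ℝ} {X : Euc d → Euc d}
    {u₀ : Euc d} (hA : ∀ i j, ContDiffAt ℝ 1 (fun w => A w i j) u₀) (hX : ContDiffAt ℝ 1 X u₀)
    (hneg : ∀ v : Euc d, v ≠ 0 → ∑ i, ∑ j, (fderiv ℝ (fun w => A w i j) u₀ (X u₀) * (v i * v j)
      + A u₀ i j * ((fderiv ℝ X u₀ v) i * v j + v i * (fderiv ℝ X u₀ v) j)) < 0) :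
    ∃ s₀ > (0 : ℝ), ∀ᶠ u in 𝓝 u₀, ∀ s ∈ Icc 0 s₀, ∀ v : Euc d,
      quad (A (u + s • X u)) (v + s • fderiv ℝ X u v) ≤ quad (A u) v := by
  -- F (s, u) v is the derivative in s of the squared length of the image of v under u ↦ u + s X u.
  -- At s = 0 it is the Lie derivative of A along X.
  set F : ℝ × Euc d → Euc d → ℝ := fun p v => ∑ i, ∑ j,
    (fderiv ℝ (fun w => A w i j) (p.2 + p.1 • X p.2) (X p.2)
        * ((v + p.1 • fderiv ℝ X p.2 v) i * (v + p.1 • fderiv ℝ X p.2 v) j)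
      + A (p.2 + p.1 • X p.2) i j * ((fderiv ℝ X p.2 v) i * (v + p.1 • fderiv ℝ X p.2 v) j
        + (v + p.1 • fderiv ℝ X p.2 v) i * (fderiv ℝ X p.2 v) j)) with hF
  have hF0 : ∀ v : Euc d, v ≠ 0 → F (0, u₀) v < 0 := by
    intro v hv
    simpa [hF] using hneg v hv
  have hA' : ∀ i j, ContinuousAt (fderiv ℝ (fun w => A w i j)) u₀ := fun i j =>
    ((hA i j).fderiv_right (m := 0) (by norm_num)).continuousAt
  have hX' : ContinuousAt (fderiv ℝ X) u₀ :=
    (hX.fderiv_right (m := 0) (by norm_num)).continuousAt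
  have hcont : ∀ v : Euc d, ContinuousAt (fun q : (ℝ × Euc d) × Euc d => F q.1 q.2)
      ((0, u₀), v) := by
    intro v
    have c1 : ContinuousAt (fun q : (ℝ × Euc d) × Euc d => q.1.2) ((0, u₀), v) := by fun_prop
    have c0 : ContinuousAt (fun q : (ℝ × Euc d) × Euc d => q.1.1) ((0, u₀), v) := by fun_prop
    have c2 : ContinuousAt (fun q : (ℝ × Euc d) × Euc d => X q.1.2) ((0, u₀), v) :=
      ContinuousAt.comp (g := X) (f := fun q : (ℝ × Euc d) × Euc d => q.1.2)
        hX.continuousAt c1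
    have c3 : ContinuousAt (fun q : (ℝ × Euc d) × Euc d => q.1.2 + q.1.1 • X q.1.2)
        ((0, u₀), v) := c1.add (c0.smul c2)
    have c4 : ContinuousAt (fun q : (ℝ × Euc d) × Euc d => fderiv ℝ X q.1.2 q.2)
        ((0, u₀), v) := by
      have := ContinuousAt.comp (g := fderiv ℝ X)
        (f := fun q : (ℝ × Euc d) × Euc d => q.1.2) (x := ((0, u₀), v)) hX' c1
      exact this.clm_apply (by fun_prop)
    have c5 : ContinuousAt (fun q : (ℝ × Euc d) × Euc d =>
        q.2 + q.1.1 • fderiv ℝ X q.1.2 q.2) ((0, u₀), v) :=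
      ContinuousAt.add (by fun_prop) (c0.smul c4)
    have ccoord : ∀ {f : (ℝ × Euc d) × Euc d → Euc d} (i : Fin d),
        ContinuousAt f ((0, u₀), v) → ContinuousAt (fun q => f q i) ((0, u₀), v) := by
      intro f i hf
      exact ((EuclideanSpace.proj (𝕜 := ℝ) i).continuous.continuousAt).comp hf
    have hz : u₀ + (0 : ℝ) • X u₀ = u₀ := by simp
    simp only [hF]
    refine tendsto_finsetSum _ fun i _ => tendsto_finsetSum _ fun j _ => ?_
    refine ContinuousAt.add (ContinuousAt.mul ?_ ((ccoord i c5).mul (ccoord j c5)))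
      (ContinuousAt.mul ?_ (((ccoord i c4).mul (ccoord j c5)).add
        ((ccoord i c5).mul (ccoord j c4))))
    · refine ContinuousAt.clm_apply ?_ c2
      refine ContinuousAt.comp (g := fderiv ℝ (fun w => A w i j))
        (f := fun q : (ℝ × Euc d) × Euc d => q.1.2 + q.1.1 • X q.1.2) ?_ c3
      simpa [hz] using hA' i j
    · refine ContinuousAt.comp (g := fun w => A w i j)
        (f := fun q : (ℝ × Euc d) × Euc d => q.1.2 + q.1.1 • X q.1.2) ?_ c3
      simpa [hz] using (hA i j).continuousAt
  -- Compactness of the unit sphere makes the negativity at u₀ uniform in v; homogeneity of degree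
  -- two extends it to all vectors below.
  have hsphere : ∀ᶠ p in 𝓝 ((0 : ℝ), u₀), ∀ v ∈ Metric.sphere (0 : Euc d) 1, F p v < 0 := by
    refine (isCompact_sphere (0 : Euc d) 1).eventually_forall_of_forall_eventually fun v hv => ?_
    have hv0 : v ≠ 0 := by
      rintro rfl
      simp at hv
    exact (hcont v).eventually_lt continuousAt_const (hF0 v hv0)
  have hAd : ∀ᶠ w in 𝓝 u₀, ∀ i j, DifferentiableAt ℝ (fun w => A w i j) w := by
    simp only [eventually_all]
    exact fun i j => ((hA i j).eventually (by simp)).mono fun w hw =>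
      hw.differentiableAt (by norm_num)
  have hAdp : ∀ᶠ p in 𝓝 ((0 : ℝ), u₀), ∀ i j,
      DifferentiableAt ℝ (fun w => A w i j) (p.2 + p.1 • X p.2) := by
    have c : ContinuousAt (fun p : ℝ × Euc d => p.2 + p.1 • X p.2) (0, u₀) := by
      have c2 : ContinuousAt (fun p : ℝ × Euc d => X p.2) (0, u₀) :=
        ContinuousAt.comp (g := X) (f := fun p : ℝ × Euc d => p.2) hX.continuousAt
          continuousAt_snd
      exact continuousAt_snd.add (continuousAt_fst.smul c2)
    have : Tendsto (fun p : ℝ × Euc d => p.2 + p.1 • X p.2) (𝓝 (0, u₀)) (𝓝 u₀) := by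
      simpa [ContinuousAt] using c
    exact this.eventually hAd
  have hboth := hsphere.and hAdp
  rw [nhds_prod_eq, eventually_prod_iff] at hboth
  obtain ⟨pa, hpa, pb, hpb, hab⟩ := hboth
  obtain ⟨δ, hδ, hball⟩ := Metric.eventually_nhds_iff.1 hpa
  refine ⟨δ / 2, by positivity, hpb.mono fun u hu s hs v => ?_⟩
  have hin : ∀ r ∈ Icc 0 (δ / 2), pa r := fun r hr => hball (by
    rw [Real.dist_eq, sub_zero, abs_of_nonneg hr.1]; linarith [hr.2])
  have hFle : ∀ r ∈ Icc 0 (δ / 2), F (r, u) v ≤ 0 := by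
    intro r hr
    rcases eq_or_ne v 0 with rfl | hv
    · simp [hF]
    · have hn : 0 < ‖v‖ := norm_pos_iff.2 hv
      have h1 := (hab (hin r hr) hu).1 (‖v‖⁻¹ • v) (by
        rw [mem_sphere_zero_iff_norm, norm_smul, norm_inv, norm_norm, inv_mul_cancel₀ hn.ne'])
      have h2 : F (r, u) v = ‖v‖ ^ 2 * F (r, u) (‖v‖⁻¹ • v) := by
        simp only [hF, Finset.mul_sum, map_smul, PiLp.add_apply, PiLp.smul_apply, smul_eq_mul]
        refine Finset.sum_congr rfl fun i _ => Finset.sum_congr rfl fun j _ => ?_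
        field_simp
      rw [h2]
      exact mul_nonpos_of_nonneg_of_nonpos (by positivity) h1.le
  have hderiv : ∀ r ∈ Icc 0 (δ / 2), HasDerivAt
      (fun r => quad (A (u + r • X u)) (v + r • fderiv ℝ X u v)) (F (r, u) v) r := by
    intro r hr
    have hl : HasDerivAt (fun r : ℝ => u + r • X u) (X u) r := by
      simpa using ((hasDerivAt_id r).smul_const (X u)).const_add u
    have hw : HasDerivAt (fun r : ℝ => v + r • fderiv ℝ X u v) (fderiv ℝ X u v) r := by
      simpa using ((hasDerivAt_id r).smul_const (fderiv ℝ X u v)).const_add v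
    have hwi : ∀ i, HasDerivAt (fun r : ℝ => (v + r • fderiv ℝ X u v) i) ((fderiv ℝ X u v) i) r :=
      fun i => (EuclideanSpace.proj (𝕜 := ℝ) i).hasFDerivAt.comp_hasDerivAt r hw
    simp only [quad, hF]
    refine HasDerivAt.fun_sum fun i _ => HasDerivAt.fun_sum fun j _ => ?_
    have hAij : HasDerivAt (fun r : ℝ => A (u + r • X u) i j)
        (fderiv ℝ (fun w => A w i j) (u + r • X u) (X u)) r :=
      HasFDerivAt.comp_hasDerivAt (l := fun w => A w i j) r
        ((hab (hin r hr) hu).2 i j).hasFDerivAt hl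
    exact hAij.fun_mul ((hwi i).fun_mul (hwi j))
  have hanti : AntitoneOn (fun r => quad (A (u + r • X u)) (v + r • fderiv ℝ X u v))
      (Icc 0 (δ / 2)) := by
    refine antitoneOn_of_deriv_nonpos (convex_Icc _ _)
      (fun r hr => (hderiv r hr).continuousAt.continuousWithinAt)
      (fun r hr => (hderiv r (interior_subset hr)).differentiableAt.differentiableWithinAt)
      fun r hr => ?_
    rw [(hderiv r (interior_subset hr)).deriv]
    exact hFle r (interior_subset hr)
  have := hanti (left_mem_Icc.2 (by positivity)) hs hs.1
  simpa using this

variable {G : Euc d → Matrix (Fin d) (Fin d) ℝ} {ρ : Euc d → ℝ} {u₀ : Euc d}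

/-- The components of the vector field `-ρ ∇ρ`. -/
def pushField (G : Euc d → Matrix (Fin d) (Fin d) ℝ) (ρ : Euc d → ℝ) (u : Euc d) : Euc d :=
  WithLp.toLp 2 fun k => -(ρ u * ∑ l, (G u)⁻¹ k l * pd univ ρ l u)

lemma pushField_apply (u : Euc d) (k : Fin d) :
    pushField G ρ u k = -(ρ u * ∑ l, (G u)⁻¹ k l * pd univ ρ l u) := rfl

lemma contDiffAt_pushField (hG : ∀ i j, ContDiffAt ℝ 2 (fun w => G w i j) u₀)
    (hdet : (G u₀).det ≠ 0) (hρ : ContDiffAt ℝ 2 ρ u₀) : ContDiffAt ℝ 1 (pushField G ρ) u₀ := by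
  rw [contDiffAt_euclidean]
  intro k
  simp only [pushField_apply]
  refine ((hρ.of_le (by norm_num)).mul (ContDiffAt.sum fun l _ => ?_)).neg
  exact ((contDiffAt_inv_apply hG hdet k l).of_le (by norm_num)).mul
    (contDiffAt_pd hρ (by norm_num) l)

lemma sum_metric_pushField {u : Euc d} (hdet : (G u).det ≠ 0) (j : Fin d) :
    ∑ k, G u j k * pushField G ρ u k = -(ρ u * pd univ ρ j u) := by
  simp only [pushField_apply, Finset.mul_sum, ← Finset.sum_neg_distrib]
  rw [Finset.sum_comm]
  have : ∀ l, ∑ k, -(G u j k * (ρ u * ((G u)⁻¹ k l * pd univ ρ l u)))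
      = -(ρ u * ((if j = l then 1 else 0) * pd univ ρ l u)) := by
    intro l
    rw [← sum_metric_mul_inv hdet j l, Finset.sum_mul, Finset.mul_sum, ← Finset.sum_neg_distrib]
    exact Finset.sum_congr rfl fun k _ => by ring
  simp [this]

lemma fderiv_pushField (u : Euc d) :
    fderiv ℝ ρ u (pushField G ρ u) = -(ρ u * gradSq G ρ u) := by
  rw [fderiv_apply_eq_sum]
  simp only [pushField_apply, gradSq, Finset.mul_sum, Finset.sum_mul, ← Finset.sum_neg_distrib]
  exact Finset.sum_congr rfl fun i _ => Finset.sum_congr rfl fun l _ => by ring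

/-- The weight `(1 + ρ) ^ (2 κ)`, by which the metric is multiplied. -/
def weightSq (κ : ℝ) (ρ : Euc d → ℝ) (u : Euc d) : ℝ := (1 + ρ u) ^ (2 * κ)

/-- The field `-ρ ∇ρ` contracts the metric `(1 + ρ) ^ (2 κ) G` near a point where `κ` dominates the
Hessian of `ρ`. -/
theorem eventually_quad_pushField_le {κ : ℝ} (hsymm : ∀ w i j, G w i j = G w j i)
    (hG : ∀ i j, ContDiffAt ℝ 2 (fun w => G w i j) u₀) (hdet : (G u₀).det ≠ 0)
    (hρ : ContDiffAt ℝ 2 ρ u₀) (h0 : 0 < ρ u₀)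
    (hpos : ∀ v : Euc d, v ≠ 0 → 0 < κ / (1 + ρ u₀) * gradSq G ρ u₀ * quad (G u₀) v
      + ∑ i, ∑ j, hess G ρ u₀ i j * (v i * v j)) :
    ∃ s₀ > (0 : ℝ), ∀ᶠ u in 𝓝 u₀, ∀ s ∈ Icc 0 s₀, ∀ v : Euc d,
      weightSq κ ρ (u + s • pushField G ρ u)
          * quad (G (u + s • pushField G ρ u)) (v + s • fderiv ℝ (pushField G ρ) u v)
        ≤ weightSq κ ρ u * quad (G u) v := by
  have h1 : (1 + ρ u₀) ≠ 0 := by positivity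
  have hW : ContDiffAt ℝ 1 (weightSq κ ρ) u₀ :=
    ((contDiffAt_const.add hρ).rpow_const_of_ne h1).of_le (by norm_num)
  have hWp : 0 < weightSq κ ρ u₀ := Real.rpow_pos_of_pos (by positivity) _
  have hX := contDiffAt_pushField hG hdet hρ
  set X := pushField G ρ with hXdef
  have hGd : ∀ i j, DifferentiableAt ℝ (fun w => G w i j) u₀ := fun i j =>
    (hG i j).differentiableAt (by norm_num)
  have hXi : ∀ k, DifferentiableAt ℝ (fun w => X w k) u₀ := fun k =>
    (contDiffAt_euclidean.1 hX k).differentiableAt (by norm_num)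
  have hWX : fderiv ℝ (weightSq κ ρ) u₀ (X u₀)
      = -(2 * κ / (1 + ρ u₀) * weightSq κ ρ u₀ * (ρ u₀ * gradSq G ρ u₀)) := by
    have hd : HasDerivAt (fun t : ℝ => (1 + t) ^ (2 * κ))
        (1 * (2 * κ) * (1 + ρ u₀) ^ (2 * κ - 1)) (ρ u₀) :=
      ((hasDerivAt_id (ρ u₀)).const_add 1).rpow_const (Or.inl h1)
    have hc := hd.comp_hasFDerivAt u₀ (hρ.differentiableAt (by norm_num)).hasFDerivAt
    have : fderiv ℝ (weightSq κ ρ) u₀ = _ := hc.fderiv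
    rw [this, smul_apply, hXdef, fderiv_pushField, Real.rpow_sub (by positivity),
      Real.rpow_one, weightSq, smul_eq_mul]
    field_simp
  have hDX : ∀ (v : Euc d) k, (fderiv ℝ X u₀ v) k = ∑ a, v a * pd univ (fun w => X w k) a u₀ := by
    intro v k
    rw [← fderiv_apply_eq_sum]
    have : HasFDerivAt (fun w => X w k)
        ((EuclideanSpace.proj (𝕜 := ℝ) k).comp (fderiv ℝ X u₀)) u₀ :=
      (EuclideanSpace.proj (𝕜 := ℝ) k).hasFDerivAt.comp u₀
        (hX.differentiableAt (by norm_num)).hasFDerivAt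
    rw [this.fderiv]; rfl
  -- The derivative of the identity G X = -ρ dρ.
  have hGX : ∀ a j, ∑ k, (pd univ (fun w => G w j k) a u₀ * X u₀ k
      + G u₀ j k * pd univ (fun w => X w k) a u₀)
      = -(pd univ ρ a u₀ * pd univ ρ j u₀ + ρ u₀ * pd univ (pd univ ρ j) a u₀) := by
    intro a j
    have e1 : ∀ᶠ w in 𝓝 u₀, ∑ k, G w j k * X w k = -1 * (ρ w * pd univ ρ j w) := by
      filter_upwards [eventually_det_ne_zero hG hdet] with w hw
      rw [hXdef, sum_metric_pushField hw]; ring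
    have h2 : DifferentiableAt ℝ (pd univ ρ j) u₀ :=
      (contDiffAt_pd (m := 1) hρ (by norm_num) j).differentiableAt (by norm_num)
    have h3 : DifferentiableAt ℝ ρ u₀ := hρ.differentiableAt (by norm_num)
    have e2 := (pd_congr univ_mem e1 a).self_of_nhds
    rw [pd_sum _ fun k _ => (hGd j k).fun_mul (hXi k), pd_const_mul _ (h3.fun_mul h2),
      pd_mul h3 h2] at e2
    rw [Finset.sum_congr rfl fun k _ => (pd_mul (hGd j k) (hXi k) a).symm, e2]
    ring
  have hess_eq : ∀ a j, ρ u₀ * hess G ρ u₀ a j = ρ u₀ * pd univ (pd univ ρ j) a u₀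
      + (1 / 2) * ∑ k, X u₀ k * (pd univ (fun w => G w j k) a u₀ + pd univ (fun w => G w a k) j u₀
        - pd univ (fun w => G w a j) k u₀) := by
    intro a j
    have e : ∑ m, christoffel univ G m a j u₀ * (ρ u₀ * pd univ ρ m u₀)
        = -∑ k, X u₀ k * ((1 / 2) * (pd univ (fun w => G w j k) a u₀
          + pd univ (fun w => G w a k) j u₀ - pd univ (fun w => G w a j) k u₀)) := by
      have e1 : ∀ m, ρ u₀ * pd univ ρ m u₀ = -∑ k, G u₀ m k * X u₀ k := by
        intro m; rw [hXdef, sum_metric_pushField hdet]; ring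
      simp only [e1, ← sum_metric_christoffel hdet, mul_neg, Finset.sum_neg_distrib,
        Finset.mul_sum]
      rw [Finset.sum_comm]
      congr 1
      refine Finset.sum_congr rfl fun k _ => Finset.sum_congr rfl fun m _ => ?_
      rw [hsymm u₀ m k]; ring
    have e' : ρ u₀ * ∑ m, christoffel univ G m a j u₀ * pd univ ρ m u₀
        = ∑ m, christoffel univ G m a j u₀ * (ρ u₀ * pd univ ρ m u₀) := by
      rw [Finset.mul_sum]; exact Finset.sum_congr rfl fun m _ => by ring
    rw [hess, mul_sub, e', e, Finset.mul_sum, sub_neg_eq_add]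
    congr 1
    exact Finset.sum_congr rfl fun m _ => by ring
  have main : ∀ v : Euc d, v ≠ 0 → ∑ i, ∑ j,
      (fderiv ℝ (fun w => (weightSq κ ρ w • G w) i j) u₀ (X u₀) * (v i * v j)
      + (weightSq κ ρ u₀ • G u₀) i j
        * ((fderiv ℝ X u₀ v) i * v j + v i * (fderiv ℝ X u₀ v) j)) < 0 := by
    intro v hv
    have f1 : ∀ i j, fderiv ℝ (fun w => (weightSq κ ρ w • G w) i j) u₀ (X u₀)
        = fderiv ℝ (weightSq κ ρ) u₀ (X u₀) * G u₀ i j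
          + weightSq κ ρ u₀ * ∑ k, X u₀ k * pd univ (fun w => G w i j) k u₀ := by
      intro i j
      simp only [Matrix.smul_apply, smul_eq_mul]
      rw [fderiv_fun_mul (hW.differentiableAt (by norm_num)) (hGd i j)]
      simp only [add_apply, smul_apply, smul_eq_mul]
      rw [fderiv_apply_eq_sum (fun w => G w i j)]
      ring
    have f2 : ∑ i, ∑ j, G u₀ i j * ((fderiv ℝ X u₀ v) i * v j + v i * (fderiv ℝ X u₀ v) j)
        = 2 * ∑ a, ∑ j, v a * v j * ∑ k, G u₀ j k * pd univ (fun w => X w k) a u₀ := by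
      have g1 : ∑ i, ∑ j, G u₀ i j * (v i * (fderiv ℝ X u₀ v) j)
          = ∑ a, ∑ j, v a * v j * ∑ k, G u₀ j k * pd univ (fun w => X w k) a u₀ := by
        simp only [hDX, Finset.mul_sum]
        have : ∀ i j, ∑ a, G u₀ i j * (v i * (v a * pd univ (fun w => X w j) a u₀))
            = ∑ a, v a * v i * (G u₀ i j * pd univ (fun w => X w j) a u₀) := fun i j =>
          Finset.sum_congr rfl fun a _ => by ring
        simp only [this]
        rw [Finset.sum_congr rfl fun i _ => Finset.sum_comm]
        rw [Finset.sum_comm]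
      have g2 : ∑ i, ∑ j, G u₀ i j * ((fderiv ℝ X u₀ v) i * v j)
          = ∑ i, ∑ j, G u₀ i j * (v i * (fderiv ℝ X u₀ v) j) := by
        rw [Finset.sum_comm]
        refine Finset.sum_congr rfl fun i _ => Finset.sum_congr rfl fun j _ => ?_
        rw [hsymm u₀ j i]; ring
      simp only [mul_add, Finset.sum_add_distrib]
      rw [g2, g1]; ring
    have f3 : ∀ a j, ∑ k, G u₀ j k * pd univ (fun w => X w k) a u₀
        = -(pd univ ρ a u₀ * pd univ ρ j u₀) - ρ u₀ * hess G ρ u₀ a j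
          + (1 / 2) * ∑ k, X u₀ k * (pd univ (fun w => G w a k) j u₀
            - pd univ (fun w => G w a j) k u₀ - pd univ (fun w => G w j k) a u₀) := by
      intro a j
      have e1 := hGX a j
      rw [Finset.sum_add_distrib] at e1
      have e2 := hess_eq a j
      have e3 : ∑ k, X u₀ k * (pd univ (fun w => G w j k) a u₀ + pd univ (fun w => G w a k) j u₀
        - pd univ (fun w => G w a j) k u₀) = ∑ k, X u₀ k * (pd univ (fun w => G w a k) j u₀
            - pd univ (fun w => G w a j) k u₀ - pd univ (fun w => G w j k) a u₀)
          + 2 * ∑ k, pd univ (fun w => G w j k) a u₀ * X u₀ k := by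
        rw [Finset.mul_sum, ← Finset.sum_add_distrib]
        exact Finset.sum_congr rfl fun k _ => by ring
      rw [e3] at e2
      linear_combination e1 + e2
    have f4 : ∑ a, ∑ j, v a * v j * ∑ k, G u₀ j k * pd univ (fun w => X w k) a u₀
        = -(∑ a, v a * pd univ ρ a u₀) ^ 2 - ρ u₀ * ∑ a, ∑ j, hess G ρ u₀ a j * (v a * v j)
          - (1 / 2) * ∑ i, ∑ j, (∑ k, X u₀ k * pd univ (fun w => G w i j) k u₀) * (v i * v j) := by
      -- These two terms of `f3` differ by the exchange of a and j, and cancel in the quadratic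
      -- form.
      have g1 : ∑ a, ∑ j, v a * v j * ∑ k, X u₀ k * pd univ (fun w => G w a k) j u₀
          = ∑ a, ∑ j, v a * v j * ∑ k, X u₀ k * pd univ (fun w => G w j k) a u₀ := by
        rw [Finset.sum_comm]
        exact Finset.sum_congr rfl fun a _ => Finset.sum_congr rfl fun j _ => by ring
      have g2 : ∀ a j, v a * v j * ∑ k, G u₀ j k * pd univ (fun w => X w k) a u₀
          = -((v a * pd univ ρ a u₀) * (v j * pd univ ρ j u₀))
            - ρ u₀ * (hess G ρ u₀ a j * (v a * v j))
            - (1 / 2) * ((∑ k, X u₀ k * pd univ (fun w => G w a j) k u₀) * (v a * v j))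
            + (1 / 2) * (v a * v j * ∑ k, X u₀ k * pd univ (fun w => G w a k) j u₀)
            - (1 / 2) * (v a * v j * ∑ k, X u₀ k * pd univ (fun w => G w j k) a u₀) := by
        intro a j
        rw [f3]
        simp only [mul_sub, Finset.sum_sub_distrib]
        ring
      simp only [g2, Finset.sum_sub_distrib, Finset.sum_add_distrib, ← Finset.mul_sum,
        Finset.sum_neg_distrib, g1, sq, ← Finset.sum_mul]
      ring
    -- The Lie derivative of W G along -ρ∇ρ is -2W (ρ (κ|∇ρ|²/(1+ρ) G + Hess ρ) + dρ⊗dρ), where W is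
    -- the weight (1+ρ)^(2κ). The term dρ⊗dρ has a favourable sign and is only discarded.
    have f5 : ∑ i, ∑ j, (fderiv ℝ (fun w => (weightSq κ ρ w • G w) i j) u₀ (X u₀) * (v i * v j)
        + (weightSq κ ρ u₀ • G u₀) i j
          * ((fderiv ℝ X u₀ v) i * v j + v i * (fderiv ℝ X u₀ v) j))
        = -(2 * weightSq κ ρ u₀) * (ρ u₀ * (κ / (1 + ρ u₀) * gradSq G ρ u₀ * quad (G u₀) v
          + ∑ i, ∑ j, hess G ρ u₀ i j * (v i * v j)) + (∑ a, v a * pd univ ρ a u₀) ^ 2) := by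
      have g3 : ∀ i j, fderiv ℝ (fun w => (weightSq κ ρ w • G w) i j) u₀ (X u₀) * (v i * v j)
        + (weightSq κ ρ u₀ • G u₀) i j
          * ((fderiv ℝ X u₀ v) i * v j + v i * (fderiv ℝ X u₀ v) j)
          = fderiv ℝ (weightSq κ ρ) u₀ (X u₀) * (G u₀ i j * (v i * v j))
            + weightSq κ ρ u₀ * ((∑ k, X u₀ k * pd univ (fun w => G w i j) k u₀) * (v i * v j))
            + weightSq κ ρ u₀
              * (G u₀ i j * ((fderiv ℝ X u₀ v) i * v j + v i * (fderiv ℝ X u₀ v) j)) := by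
        intro i j
        rw [f1, Matrix.smul_apply, smul_eq_mul]; ring
      simp only [g3, Finset.sum_add_distrib, ← Finset.mul_sum]
      rw [f2, f4, hWX, quad]
      field_simp
      ring
    rw [f5]
    have := hpos v hv
    have h6 : 0 < ρ u₀ * (κ / (1 + ρ u₀) * gradSq G ρ u₀ * quad (G u₀) v
          + ∑ i, ∑ j, hess G ρ u₀ i j * (v i * v j)) + (∑ a, v a * pd univ ρ a u₀) ^ 2 := by
      positivity
    nlinarith [mul_pos hWp h6]
  obtain ⟨s₀, hs₀, h⟩ := eventually_quad_push_le (A := fun w => weightSq κ ρ w • G w)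
    (fun i j => hW.mul ((hG i j).of_le (by norm_num))) hX main
  refine ⟨s₀, hs₀, h.mono fun u hu s hs v => ?_⟩
  simpa only [quad_smul] using hu s hs v

end Push

/-! ### Numerical bounds from the decay of the Ricci tensor. -/

section Bounds

variable {d : ℕ} {G : Euc d → Matrix (Fin d) (Fin d) ℝ} {u : Euc d} {ρ : Euc d → ℝ}

lemma quad_pos {A : Matrix (Fin d) (Fin d) ℝ} (hA : A.PosDef) {v : Euc d} (hv : v ≠ 0) :
    0 < quad A v := by
  rw [quad_eq_dotProduct]
  have := hA.dotProduct_mulVec_pos (x := v.ofLp) (by simpa using hv)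
  simpa using this

/-- The trace is at most √d times the norm, and √d ≤ (d+4)/4 by the inequality of arithmetic and
geometric means for d and 4. This avoids square roots of the dimension. -/
lemma scalar_le_ricciNorm (hG : (G u).PosDef) :
    scalar univ G u ≤ ((d : ℝ) + 4) / 4 * ricciNorm univ G u := by
  have h := sq_trace_le hG (ricci univ G u)
  have hN : 0 ≤ ricciNorm univ G u := Real.sqrt_nonneg _
  have hF : formNormSq (G u) (ricci univ G u) ≤ ricciNorm univ G u ^ 2 := by
    rw [ricciNorm_eq, Real.sq_sqrt']
    exact le_max_left _ _
  refine abs_le_of_sq_le_sq' ?_ (by positivity) |>.2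
  refine (show scalar univ G u ^ 2 ≤ _ from h).trans ?_
  rw [Fintype.card_fin]
  calc (d : ℝ) * formNormSq (G u) (ricci univ G u) ≤ d * ricciNorm univ G u ^ 2 := by gcongr
    _ ≤ (((d : ℝ) + 4) / 4 * ricciNorm univ G u) ^ 2 := by
      rw [mul_pow]
      refine mul_le_mul_of_nonneg_right ?_ (sq_nonneg _)
      nlinarith [sq_nonneg ((d : ℝ) - 4)]

/-- Bounds for the gradient and the Hessian of a function that satisfies the equations of
`gradSq_and_hess_of_einstein`, in terms of the norm of the Ricci tensor. -/
lemma gradSq_hess_bounds (hd : 5 ≤ d) (hG : (G u).PosDef) (h0 : 0 < ρ u)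
    (hR : 0 ≤ scalar univ G u)
    (hgr : gradSq G ρ u = 1 - scalar univ G u * ρ u ^ 2 / (2 * ((d : ℝ) - 1)))
    (hhess : ∀ j k, hess G ρ u j k = -(ρ u / ((d : ℝ) - 2)) * (ricci univ G u j k
      + ((d : ℝ) - 4) / (4 * ((d : ℝ) - 1)) * scalar univ G u * G u j k)) :
    gradSq G ρ u ≤ 1 ∧ 1 - 9 / 32 * (ricciNorm univ G u * ρ u ^ 2) ≤ gradSq G ρ u ∧
    ∀ v : Euc d, -(2 / 5 * ρ u * ricciNorm univ G u * quad (G u) v)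
      ≤ ∑ i, ∑ j, hess G ρ u i j * (v i * v j) := by
  have hd' : (5 : ℝ) ≤ d := by exact_mod_cast hd
  have hN : 0 ≤ ricciNorm univ G u := Real.sqrt_nonneg _
  have hRN := scalar_le_ricciNorm hG
  set N := ricciNorm univ G u
  set R := scalar univ G u
  have hd1 : (0 : ℝ) < d - 1 := by linarith
  have hd2 : (0 : ℝ) < d - 2 := by linarith
  refine ⟨?_, ?_, fun v => ?_⟩
  · rw [hgr]
    have : 0 ≤ R * ρ u ^ 2 / (2 * ((d : ℝ) - 1)) := by positivity
    linarith
  · rw [hgr]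
    have : R * ρ u ^ 2 / (2 * ((d : ℝ) - 1)) ≤ 9 / 32 * (N * ρ u ^ 2) := by
      rw [div_le_iff₀ (by positivity)]
      -- (d+4)/4 ≤ (9/16)(d-1) for d ≥ 5, with equality at d = 5.
      have h1 : R ≤ 9 / 16 * ((d : ℝ) - 1) * N := by
        refine hRN.trans (mul_le_mul_of_nonneg_right ?_ hN)
        linarith
      nlinarith [mul_le_mul_of_nonneg_right h1 (sq_nonneg (ρ u))]
    linarith
  · have hq : 0 ≤ quad (G u) v := by
      rcases eq_or_ne v 0 with rfl | hv
      · simp [quad]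
      · exact (quad_pos hG hv).le
    have e : ∑ i, ∑ j, hess G ρ u i j * (v i * v j) = -(ρ u / ((d : ℝ) - 2)) *
        (quad (ricci univ G u) v + ((d : ℝ) - 4) / (4 * ((d : ℝ) - 1)) * R * quad (G u) v) := by
      simp only [hhess, quad, Finset.mul_sum, ← Finset.sum_add_distrib]
      exact Finset.sum_congr rfl fun i _ => Finset.sum_congr rfl fun j _ => by ring
    have hric : quad (ricci univ G u) v ≤ N * quad (G u) v := by
      rw [quad_eq_dotProduct, quad_eq_dotProduct]
      exact (le_abs_self _).trans (abs_quadForm_le hG _ _)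
    -- The constant 2/5 works because 1 + (d-4)(d+4)/(16(d-1)) ≤ (2/5)(d-2) for d ≥ 5.
    have hc : ((d : ℝ) - 4) / (4 * ((d : ℝ) - 1)) * R ≤ (2 / 5 * ((d : ℝ) - 2) - 1) * N := by
      rw [div_mul_eq_mul_div, div_le_iff₀ (by positivity)]
      calc ((d : ℝ) - 4) * R ≤ ((d : ℝ) - 4) * (((d : ℝ) + 4) / 4 * N) :=
            mul_le_mul_of_nonneg_left hRN (by linarith)
        _ = (((d : ℝ) - 4) * (((d : ℝ) + 4) / 4)) * N := by ring
        _ ≤ ((2 / 5 * ((d : ℝ) - 2) - 1) * (4 * ((d : ℝ) - 1))) * N :=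
            mul_le_mul_of_nonneg_right (by nlinarith) hN
        _ = _ := by ring
    rw [e, neg_mul, neg_le_neg_iff, div_mul_eq_mul_div, div_le_iff₀ hd2]
    have h1 := mul_le_mul_of_nonneg_right hc hq
    have h2 : quad (ricci univ G u) v + ((d : ℝ) - 4) / (4 * ((d : ℝ) - 1)) * R * quad (G u) v
        ≤ 2 / 5 * ((d : ℝ) - 2) * N * quad (G u) v := by linarith
    have := mul_le_mul_of_nonneg_left h2 h0.le
    linarith

/-- The weight with exponent `κ = 0.49 ε` dominates the Hessian where `|Ric| (1 + ρ)² ≤ 1.01 ε`. -/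
lemma gradSq_hess_pos {ε : ℝ} (hε0 : 0 < ε) (hε : ε < 1 / 2) (hG : (G u).PosDef) (h0 : 0 < ρ u)
    (hN : ricciNorm univ G u * (1 + ρ u) ^ 2 ≤ 101 / 100 * ε)
    (h1 : 1 - 9 / 32 * (ricciNorm univ G u * ρ u ^ 2) ≤ gradSq G ρ u)
    (h2 : ∀ v : Euc d, -(2 / 5 * ρ u * ricciNorm univ G u * quad (G u) v)
      ≤ ∑ i, ∑ j, hess G ρ u i j * (v i * v j)) :
    85 / 100 ≤ gradSq G ρ u ∧
    ∀ v : Euc d, v ≠ 0 → 0 < 49 / 100 * ε / (1 + ρ u) * gradSq G ρ u * quad (G u) v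
      + ∑ i, ∑ j, hess G ρ u i j * (v i * v j) := by
  have hN0 : 0 ≤ ricciNorm univ G u := Real.sqrt_nonneg _
  set N := ricciNorm univ G u
  have ha : N * ρ u ^ 2 ≤ 101 / 100 * ε := by
    refine le_trans (mul_le_mul_of_nonneg_left ?_ hN0) hN
    nlinarith
  -- 1 - (9/32)(1.01/2) > 0.857, since ε < 1/2.
  have hg : 857 / 1000 ≤ gradSq G ρ u := by linarith
  refine ⟨by linarith, fun v hv => ?_⟩
  have hq := quad_pos hG hv
  have hb : ρ u * N ≤ 101 / 100 * ε / (1 + ρ u) := by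
    rw [le_div_iff₀ (by positivity)]
    refine le_trans ?_ hN
    have := mul_nonneg hN0 (show 0 ≤ 1 + ρ u by positivity)
    nlinarith
  -- The numerical margin: 0.4 · 1.01 = 0.404 is less than 0.49 · 0.857 > 0.419.
  have hc : 2 / 5 * (ρ u * N) < 49 / 100 * ε / (1 + ρ u) * gradSq G ρ u := by
    have hp : 0 < ε / (1 + ρ u) := by positivity
    have e1 : 101 / 100 * ε / (1 + ρ u) = 101 / 100 * (ε / (1 + ρ u)) := by ring
    have e2 : 49 / 100 * ε / (1 + ρ u) = 49 / 100 * (ε / (1 + ρ u)) := by ring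
    rw [e1] at hb; rw [e2]
    nlinarith
  have := mul_lt_mul_of_pos_right hc hq
  linarith [h2 v]

end Bounds

/-! ### Pushes and descent in a proper metric space. -/

section MetricDescent

variable {M : Type*} [MetricSpace M]

/-- A second distance `dw` on `M`, which dominates the first one, is comparable with it on bounded
sets, and for which every point can be approached at every intermediate distance. -/
structure IsWeightedLengthDist (ρ : M → ℝ) (dw : M → M → ℝ) : Prop where
  symm : ∀ x y, dw x y = dw y x
  triangle : ∀ x y z, dw x z ≤ dw x y + dw y z
  dist_le : ∀ x y, dist x y ≤ dw x y
  le_mul_dist : ∀ x y, dw x y ≤ (1 + ρ x + dist x y) * dist x y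
  exists_intermediate : ∀ x z r η, 0 ≤ r → r ≤ dw x z → 0 < η →
    ∃ y, dw x y = r ∧ dw y z ≤ dw x z - r + η

/-- `D` is the distance to `S` associated to `dw`. -/
structure IsDistTo (dw : M → M → ℝ) (S : Set M) (D : M → ℝ) : Prop where
  le : ∀ x, ∀ z ∈ S, D x ≤ dw z x
  exists_eq : ∀ x, ∃ z ∈ S, D x = dw z x

variable {ρ : M → ℝ} {dw : M → M → ℝ} {S : Set M} {D : M → ℝ}

lemma continuous_of_le_mul_dist (hsymm : ∀ x y, dw x y = dw y x)
    (htri : ∀ x y z, dw x z ≤ dw x y + dw y z)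
    (hle : ∀ x y, dw x y ≤ (1 + ρ x + dist x y) * dist x y) (x : M) : Continuous (dw x) := by
  rw [continuous_iff_continuousAt]
  intro y
  have h0 : Tendsto (fun z => (1 + ρ y + dist y z) * dist y z) (𝓝 y) (𝓝 0) := by
    have : Continuous fun z => (1 + ρ y + dist y z) * dist y z := by fun_prop
    simpa using this.tendsto y
  rw [ContinuousAt, tendsto_iff_dist_tendsto_zero]
  refine squeeze_zero (fun _ => dist_nonneg) (fun z => ?_) h0
  have h1 := htri x y z
  have h2 := htri x z y
  rw [hsymm z y] at h2
  refine le_trans ?_ (hle y z)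
  rw [Real.dist_eq, abs_le]
  constructor <;> linarith

namespace IsWeightedLengthDist

lemma self (h : IsWeightedLengthDist ρ dw) (x : M) : dw x x = 0 := by
  refine le_antisymm ?_ (dist_nonneg.trans (h.dist_le x x))
  simpa using h.le_mul_dist x x

lemma nonneg (h : IsWeightedLengthDist ρ dw) (x y : M) : 0 ≤ dw x y :=
  dist_nonneg.trans (h.dist_le x y)

lemma continuous (h : IsWeightedLengthDist ρ dw) (x : M) : Continuous (dw x) :=
  continuous_of_le_mul_dist h.symm h.triangle h.le_mul_dist x

lemma exists_isDistTo (h : IsWeightedLengthDist ρ dw) (hS : IsCompact S) (hne : S.Nonempty) :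
    ∃ D, IsDistTo dw S D := by
  have : ∀ x, ∃ z ∈ S, ∀ z' ∈ S, dw z x ≤ dw z' x := by
    intro x
    have hc : Continuous fun z => dw z x := by
      have e : (fun z => dw z x) = dw x := funext fun z => h.symm z x
      rw [e]; exact h.continuous x
    exact hS.exists_isMinOn hne hc.continuousOn
  choose z hz hmin using this
  exact ⟨fun x => dw (z x) x, fun x z' hz' => hmin x z' hz', fun x => ⟨z x, hz x, rfl⟩⟩

end IsWeightedLengthDist

namespace IsDistTo

lemma nonneg (hD : IsDistTo dw S D) (h : IsWeightedLengthDist ρ dw) (x : M) : 0 ≤ D x := by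
  obtain ⟨z, -, hz⟩ := hD.exists_eq x
  rw [hz]; exact h.nonneg _ _

lemma eq_zero (hD : IsDistTo dw S D) (h : IsWeightedLengthDist ρ dw) {x : M} (hx : x ∈ S) :
    D x = 0 :=
  le_antisymm ((hD.le x x hx).trans (h.self x).le) (hD.nonneg h x)

lemma le_add (hD : IsDistTo dw S D) (h : IsWeightedLengthDist ρ dw) (x y : M) :
    D x ≤ D y + dw y x := by
  obtain ⟨z, hz, e⟩ := hD.exists_eq y
  rw [e]
  exact (hD.le x z hz).trans (h.triangle _ _ _)

lemma continuous (hD : IsDistTo dw S D) (h : IsWeightedLengthDist ρ dw) : Continuous D := by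
  rw [continuous_iff_continuousAt]
  intro y
  have h0 : Tendsto (dw y) (𝓝 y) (𝓝 0) := by
    simpa [h.self] using (h.continuous y).tendsto y
  rw [ContinuousAt, tendsto_iff_dist_tendsto_zero]
  refine squeeze_zero (fun _ => dist_nonneg) (fun z => ?_) h0
  have h1 := hD.le_add h z y
  have h2 := hD.le_add h y z
  rw [h.symm z y] at h2
  rw [Real.dist_eq, abs_le]
  constructor <;> linarith

/-- Intermediate points for `dw` exist only up to an error. The level set {dw x · = r} is compact
since `dw` dominates `dist`, so D attains its minimum on it and the error disappears. -/
lemma exists_intermediate [ProperSpace M] (hD : IsDistTo dw S D) (h : IsWeightedLengthDist ρ dw)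
    {x : M} {r : ℝ} (hr : 0 ≤ r) (hrx : r ≤ D x) : ∃ y, dw x y = r ∧ D y = D x - r := by
  obtain ⟨z, hz, e⟩ := hD.exists_eq x
  have hpt : ∀ η > 0, ∃ y, dw x y = r ∧ D y ≤ D x - r + η := by
    intro η hη
    obtain ⟨y, hy, hyz⟩ := h.exists_intermediate x z r η hr (by rw [h.symm, ← e]; exact hrx) hη
    exact ⟨y, hy, (hD.le y z hz).trans (by rw [h.symm z y, e, h.symm z x]; exact hyz)⟩
  have hK : IsCompact {y | dw x y = r} := by
    refine Metric.isCompact_of_isClosed_isBounded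
      (isClosed_eq (h.continuous x) continuous_const) ?_
    refine Metric.isBounded_closedBall.subset (t := Metric.closedBall x r) fun y hy => ?_
    rw [Metric.mem_closedBall, dist_comm]
    exact (h.dist_le x y).trans (le_of_eq hy)
  obtain ⟨y₀, hy₀, -⟩ := hpt 1 one_pos
  obtain ⟨y, hy, hmin⟩ := hK.exists_isMinOn ⟨y₀, hy₀⟩ (hD.continuous h).continuousOn
  refine ⟨y, hy, le_antisymm (le_of_forall_pos_le_add fun η hη => ?_) ?_⟩
  · obtain ⟨y', hy', hle⟩ := hpt η hη
    exact (hmin hy').trans hle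
  · have := hD.le_add h x y
    rw [h.symm y x, show dw x y = r from hy] at this
    linarith

end IsDistTo

/-- Curves `s ↦ e x s` issued from the points `x` of `M`, with initial speed at most `ρ x`, along
which `ρ` decreases, and which do not move away from each other for the distance `dw`, outside of
the ball of radius `R₀` around `p`. -/
structure IsPush (ρ : M → ℝ) (dw : M → M → ℝ) (p : M) (R₀ : ℝ) (e : M → ℝ → M) : Prop where
  dist_le : ∀ x, ∀ c > 0, ∀ᶠ s in 𝓝[>] (0 : ℝ), dist x (e x s) ≤ (ρ x + c) * s
  rho_le : ∀ x, R₀ < dist x p → 0 < ρ x → ∀ c > 0, ∀ᶠ s in 𝓝[>] (0 : ℝ),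
    ρ (e x s) ≤ ρ x - (85 / 100 * ρ x - c) * s
  nonexpanding : ∀ z, R₀ < dist z p → 0 < ρ z → ∃ U ∈ 𝓝 z, ∀ x ∈ U, ∀ x' ∈ U, ∀ c > 0,
    ∀ᶠ s in 𝓝[>] (0 : ℝ), dw (e x s) (e x' s) ≤ dw x x' + c * s

variable {p : M} {R₀ R : ℝ} {e : M → ℝ → M}

lemma eventually_lt_small {a b : ℝ} (hb : 0 < b) : ∀ᶠ s in 𝓝[>] (0 : ℝ), a * s < b := by
  have : Tendsto (fun s : ℝ => a * s) (𝓝[>] 0) (𝓝 0) := by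
    have h : Continuous fun s : ℝ => a * s := by fun_prop
    simpa using (h.tendsto 0).mono_left nhdsWithin_le_nhds
  exact this.eventually_lt_const hb

variable [ProperSpace M]

/-- The distance `D` to the set `S = {dist · p + 2 ρ ≤ R}` does not increase along the curves of a
push, to first order. -/
theorem IsPush.eventually_le (he : IsPush ρ dw p R₀ e) (h : IsWeightedLengthDist ρ dw)
    (hρ0 : ∀ x, 0 ≤ ρ x) (hρ : LipschitzWith 1 ρ) (hR : 3 * R₀ + 2 * ρ p < R)
    (hD : IsDistTo dw {x | dist x p + 2 * ρ x ≤ R} D) {x : M} (hx : 0 < ρ x) {c : ℝ} (hc : 0 < c) :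
    ∀ᶠ s in 𝓝[>] (0 : ℝ), D (e x s) ≤ D x + c * s := by
  have hρd : ∀ a b, ρ a ≤ ρ b + dist a b := by
    intro a b
    have := hρ.dist_le_mul a b
    rw [Real.dist_eq, NNReal.coe_one, one_mul] at this
    linarith [abs_le.1 this]
  -- As ρ y ≤ ρ p + dist y p, the hypothesis forces 3 dist y p + 2 ρ p ≥ R > 3 R₀ + 2 ρ p. So the
  -- push is contracting off the interior of S.
  have hgood : ∀ y, R ≤ dist y p + 2 * ρ y → R₀ < dist y p := by
    intro y hy
    have := hρd y p
    linarith
  -- Where ρ is small the push is so slow that D changes by at most (c/2) s, whatever the direction.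
  -- This leaves a region with ρ bounded below, where compactness is available.
  have hsmall : ∃ c' > 0, ∀ y, ρ y ≤ c' → ∀ᶠ s in 𝓝[>] (0 : ℝ), D (e y s) ≤ D y + c / 2 * s := by
    refine ⟨min (1 / 2) (c / 8), by positivity, fun y hy => ?_⟩
    set c' := min (1 / 2) (c / 8)
    have hc' : 0 < c' := by positivity
    filter_upwards [he.dist_le y c' hc', eventually_lt_small (a := 2 * c') (b := 1 / 2) (by norm_num),
      self_mem_nhdsWithin] with s hs hs1 hs0
    have hs0 : 0 < s := hs0
    have h1 : dist y (e y s) ≤ 2 * c' * s := hs.trans (by nlinarith)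
    have h2 : dw y (e y s) ≤ 2 * (2 * c' * s) := by
      refine (h.le_mul_dist _ _).trans (mul_le_mul ?_ h1 dist_nonneg (by norm_num))
      have : c' ≤ 1 / 2 := min_le_left _ _
      linarith
    have h3 : c' ≤ c / 8 := min_le_right _ _
    have := hD.le_add h (e y s) y
    nlinarith
  obtain ⟨c', hc', hsmall⟩ := hsmall
  set T := D x with hT
  have hDc := hD.continuous h
  set K : Set M := {y | c' ≤ ρ y ∧ R ≤ dist y p + 2 * ρ y ∧ D y ≤ T} with hK
  have hSb : ∀ z, dist z p + 2 * ρ z ≤ R → dist z p ≤ R := fun z hz => by linarith [hρ0 z]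
  have hKc : IsCompact K := by
    refine Metric.isCompact_of_isClosed_isBounded ?_ ?_
    · have c1 := hρ.continuous
      have c2 : Continuous fun y => dist y p + 2 * ρ y := by fun_prop
      exact (isClosed_le continuous_const c1).inter ((isClosed_le continuous_const
        c2).inter (isClosed_le hDc continuous_const))
    · refine Metric.isBounded_closedBall.subset (t := Metric.closedBall p (R + T)) fun y hy => ?_
      obtain ⟨z, hz, e1⟩ := hD.exists_eq y
      have h1 := h.dist_le z y
      have h2 := hSb z hz
      have h3 := dist_triangle_left y p z
      rw [Metric.mem_closedBall]
      linarith [hy.2.2]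
  have hU : ∀ y : M, ∃ U : Set M, IsOpen U ∧ (R₀ < dist y p → 0 < ρ y → y ∈ U) ∧
      (∀ x ∈ U, 0 < ρ x) ∧ ∀ x ∈ U, ∀ x' ∈ U, ∀ c > 0,
        ∀ᶠ s in 𝓝[>] (0 : ℝ), dw (e x s) (e x' s) ≤ dw x x' + c * s := by
    intro y
    by_cases hy : R₀ < dist y p ∧ 0 < ρ y
    · obtain ⟨U, hU, hUe⟩ := he.nonexpanding y hy.1 hy.2
      have ho : IsOpen {x | 0 < ρ x} := isOpen_lt continuous_const hρ.continuous
      refine ⟨interior U ∩ {x | 0 < ρ x}, isOpen_interior.inter ho,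
        fun _ _ => ⟨mem_interior_iff_mem_nhds.2 hU, hy.2⟩, fun x hx => hx.2,
        fun x hx x' hx' => hUe x (interior_subset hx.1) x' (interior_subset hx'.1)⟩
    · exact ⟨∅, isOpen_empty, fun h1 h2 => (hy ⟨h1, h2⟩).elim, by simp, by simp⟩
  choose U hUo hUm hUρ hUe using hU
  -- Nonexpansion is only local, and a Lebesgue number of the compact set K gives it a uniform scale
  -- δ.
  obtain ⟨δ, hδ, hLeb⟩ := lebesgue_number_lemma_of_metric hKc hUo (fun y hy =>
    mem_iUnion.2 ⟨y, hUm y (hgood y hy.2.1) (hc'.trans_le hy.1)⟩)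
  -- Induction on the number of steps of length δ/2 needed to reach S. The slope c₂ is any number
  -- above c/2, not one depending on n: each step spends only half of the excess c₂ - c/2.
  have hind : ∀ n : ℕ, ∀ y, 0 < ρ y → D y ≤ T → D y ≤ n * (δ / 2) → ∀ c₂ > c / 2,
      ∀ᶠ s in 𝓝[>] (0 : ℝ), D (e y s) ≤ D y + c₂ * s := by
    intro n
    induction n with
    | zero =>
      intro y hy _ hDy c₂ hc₂
      have hDy0 : D y = 0 := le_antisymm (by simpa using hDy) (hD.nonneg h y)
      have hyS : dist y p + 2 * ρ y ≤ R := by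
        obtain ⟨z, hz, e1⟩ := hD.exists_eq y
        have h1 := h.dist_le z y
        rw [← e1, hDy0] at h1
        rw [← dist_le_zero.1 h1]; exact hz
      suffices ∀ᶠ s in 𝓝[>] (0 : ℝ), dist (e y s) p + 2 * ρ (e y s) ≤ R by
        filter_upwards [this, self_mem_nhdsWithin] with s hs hs0
        have hs0 : 0 < s := hs0
        have e1 : D (e y s) = 0 := hD.eq_zero h hs
        rw [e1, hDy0]
        nlinarith
      rcases hyS.lt_or_eq with hlt | heq
      · filter_upwards [he.dist_le y 1 one_pos,
          eventually_lt_small (a := 3 * (ρ y + 1)) (sub_pos.2 hlt)] with s hs hs1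
        have h1 := hρd (e y s) y
        have h2 := dist_triangle_left (e y s) p y
        rw [dist_comm (e y s) y] at h1
        linarith
      -- On the boundary of S the push enters S: dist · p grows at rate at most 1.1 ρ, while 2ρ
      -- decreases at rate at least 2(0.85 - 0.1)ρ = 1.5 ρ. This explains the factor 2 in the
      -- definition of S.
      · have hcp : 0 < ρ y / 10 := by positivity
        filter_upwards [he.dist_le y _ hcp, he.rho_le y (hgood y heq.ge) hy _ hcp,
          self_mem_nhdsWithin] with s hs hs1 hs0
        have hs0 : 0 < s := hs0
        have h2 := dist_triangle_left (e y s) p y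
        have h3 : 0 < ρ y * s := by positivity
        linarith
    | succ n ih =>
      intro y hy hyT hDy c₂ hc₂
      by_cases hyc : ρ y ≤ c'
      · filter_upwards [hsmall y hyc, self_mem_nhdsWithin] with s hs hs0
        have hs0 : 0 < s := hs0
        nlinarith
      by_cases hyn : D y ≤ n * (δ / 2)
      · exact ih y hy hyT hyn c₂ hc₂
      have hyf : R ≤ dist y p + 2 * ρ y := by
        by_contra hcon
        have : D y = 0 := hD.eq_zero h (show y ∈ {x | dist x p + 2 * ρ x ≤ R} from (not_le.1 hcon).le)
        rw [this] at hyn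
        exact hyn (by positivity)
      have hr : ∃ r, 0 ≤ r ∧ r ≤ D y ∧ r ≤ δ / 2 ∧ D y - r ≤ n * (δ / 2) := by
        refine ⟨min (D y) (δ / 2), le_min (hD.nonneg h y) (by positivity), min_le_left _ _,
          min_le_right _ _, ?_⟩
        push_cast at hDy
        rcases min_cases (D y) (δ / 2) with ⟨h1, -⟩ | ⟨h1, -⟩ <;> rw [h1]
        · rw [sub_self]; positivity
        · linarith
      obtain ⟨r, hr0, hrD, hrδ, hrn⟩ := hr
      -- Step from y towards S to a point y' with D y' = D y - r. The induction hypothesis controls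
      -- D along the push of y', and local nonexpansion keeps the pushes of y and y' at distance
      -- about r.
      obtain ⟨y', hy', hDy'⟩ := hD.exists_intermediate h hr0 hrD
      obtain ⟨i, hi⟩ := hLeb y ⟨(not_le.1 hyc).le, hyf, hyT⟩
      have hyU : y ∈ U i := hi (Metric.mem_ball_self hδ)
      have hyU' : y' ∈ U i := hi (by
        rw [Metric.mem_ball, dist_comm]
        exact (h.dist_le y y').trans_lt (by rw [hy']; linarith))
      have hmid : c / 2 < (c / 2 + c₂) / 2 := by linarith
      filter_upwards [ih y' (hUρ i y' hyU') (by rw [hDy']; linarith) (by rw [hDy']; exact hrn) _ hmid,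
        hUe i y' hyU' y hyU ((c₂ - c / 2) / 2) (by linarith)] with s h1 h2
      have h3 := hD.le_add h (e y s) (e y' s)
      rw [h.symm y' y, hy'] at h2
      linarith
  obtain ⟨n, hn⟩ := exists_nat_ge (D x / (δ / 2))
  exact hind n x hx le_rfl ((div_le_iff₀ (by positivity)).1 hn) c (by linarith)

/-- Near a point of `{ρ = 0}` outside of `S`, the distance `D` to `S` decreases along `{ρ = 0}`. -/
theorem IsPush.exists_descent (he : IsPush ρ dw p R₀ e) (h : IsWeightedLengthDist ρ dw)
    (hρ0 : ∀ x, 0 ≤ ρ x) (hρ : LipschitzWith 1 ρ) (hR : 3 * R₀ + 2 * ρ p < R)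
    (hD : IsDistTo dw {x | dist x p + 2 * ρ x ≤ R} D) {y : M} (hy : ρ y = 0)
    (hyS : R < dist y p) {r₀ : ℝ} (hr₀ : 0 < r₀) :
    ∃ z, ρ z = 0 ∧ z ≠ y ∧ dist z y ≤ r₀ ∧ D z ≤ D y - dist z y / 4 := by
  have hρd : ∀ a b, ρ a ≤ ρ b + dist a b := by
    intro a b
    have := hρ.dist_le_mul a b
    rw [Real.dist_eq, NNReal.coe_one, one_mul] at this
    linarith [abs_le.1 this]
  have hDy : 0 < D y := by
    obtain ⟨z, hz, e1⟩ := hD.exists_eq y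
    rw [e1]
    refine lt_of_lt_of_le (dist_pos.2 ?_) (h.dist_le z y)
    rintro rfl
    have hz : dist z p + 2 * ρ z ≤ R := hz
    linarith
  -- The point z will satisfy dist z y ≤ 3 r. The three bounds keep it within r₀ of y, allow a step
  -- of length r towards S, and keep it off the interior of S.
  set r := min (min (r₀ / 3) (D y)) ((dist y p - R) / 3) with hrdef
  have hr : 0 < r := lt_min (lt_min (by positivity) hDy) (by linarith)
  have hr1 : r ≤ r₀ / 3 := (min_le_left _ _).trans (min_le_left _ _)
  have hr2 : r ≤ D y := (min_le_left _ _).trans (min_le_right _ _)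
  have hr3 : r ≤ (dist y p - R) / 3 := min_le_right _ _
  obtain ⟨x, hyx, hDx⟩ := hD.exists_intermediate h hr.le hr2
  have hxd : dist y x ≤ r := (h.dist_le y x).trans hyx.le
  have hxρ : ρ x ≤ r := by have := hρd x y; rw [dist_comm] at this; linarith
  have hDc := hD.continuous h
  have hρc := hρ.continuous
  -- The points that can be reached from x by trading a decrease of ρ for a controlled displacement
  -- and a controlled increase of D. A minimum of ρ on Q must be a zero of ρ, since otherwise a
  -- short push would stay in Q and decrease ρ further. This replaces following the flow for an
  -- infinite time.
  set Q : Set M := {z | dist z x ≤ 2 * (ρ x - ρ z) ∧ D z ≤ D x + (ρ x - ρ z) / 4} with hQ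
  have hQc : IsCompact Q := by
    refine Metric.isCompact_of_isClosed_isBounded ?_ ?_
    · have c1 : Continuous fun z => dist z x := by fun_prop
      have c2 : Continuous fun z => 2 * (ρ x - ρ z) := by fun_prop
      have c3 : Continuous fun z => D x + (ρ x - ρ z) / 4 := by fun_prop
      exact (isClosed_le c1 c2).inter (isClosed_le hDc c3)
    · refine Metric.isBounded_closedBall.subset (t := Metric.closedBall x (2 * ρ x)) fun z hz => ?_
      rw [Metric.mem_closedBall]
      linarith [hz.1, hρ0 z]
  obtain ⟨z, hzQ, hmin⟩ := hQc.exists_isMinOn ⟨x, by simp [hQ]⟩ hρc.continuousOn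
  have hzx : dist z x ≤ 2 * r := by linarith [hzQ.1, hρ0 z]
  have hzy : dist z y ≤ 3 * r := by
    have := dist_triangle z x y
    rw [dist_comm x y] at this
    linarith
  have hz0 : ρ z = 0 := by
    by_contra hne
    have hzpos : 0 < ρ z := lt_of_le_of_ne (hρ0 z) (Ne.symm hne)
    have hzp : R₀ < dist z p := by
      have h1 := dist_triangle_left y p z
      have h2 := hρd z p
      have h3 : R ≤ dist z p + 2 * ρ z := by linarith
      linarith
    have hcp : 0 < ρ z / 100 := by positivity
    have hev : ∀ᶠ s in 𝓝[>] (0 : ℝ), e z s ∈ Q ∧ ρ (e z s) < ρ z := by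
      filter_upwards [he.dist_le z _ hcp, he.rho_le z hzp hzpos _ hcp,
        he.eventually_le h hρ0 hρ hR hD hzpos hcp, self_mem_nhdsWithin] with s h1 h2 h3 hs0
      have hs0 : 0 < s := hs0
      have h4 : 0 < ρ z * s := by positivity
      have h5 := dist_triangle_left (e z s) x z
      -- For ρ = ρ z and errors ρ/100, the displacement rate 1.01 ρ is at most 2 · 0.84 ρ, and the
      -- rate 0.01 ρ for D is at most 0.84 ρ/4.
      refine ⟨⟨?_, ?_⟩, ?_⟩
      · linarith [hzQ.1]
      · linarith [hzQ.2]
      · linarith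
    obtain ⟨s, hsQ, hs⟩ := hev.exists
    exact absurd (hmin hsQ) (not_le.2 hs)
  -- D falls by r on the way to x and regains at most ρ x/4 ≤ r/4 during the push. The net loss 3r/4
  -- is at least dist z y / 4.
  have hDz : D z ≤ D y - r + r / 4 := by
    have := hzQ.2
    rw [hDx, hz0] at this
    linarith
  refine ⟨z, hz0, ?_, by linarith, by linarith⟩
  rintro rfl
  linarith

end MetricDescent

/-! ### Growth of boundary distances. -/

section Growth

variable {M : Type*} [MetricSpace M] [ProperSpace M] {E : Type*} [NormedAddCommGroup E]
  {ρ : M → ℝ} {dw : M → M → ℝ} {p : M} {R₀ : ℝ} {e : M → ℝ → M}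

/-- Under the existence of a push, the distances in the zero set of `ρ`, parametrized by `Φ`, are
controlled by the weighted distance of `M`. -/
theorem IsPush.exists_norm_sub_le [ProperSpace E] (he : IsPush ρ dw p R₀ e) (h : IsWeightedLengthDist ρ dw)
    (hρ0 : ∀ x, 0 ≤ ρ x) (hρ : LipschitzWith 1 ρ) {Φ : E → M} (hΦ : Topology.IsEmbedding Φ)
    (hrange : ∀ x, ρ x = 0 ↔ x ∈ range Φ)
    (hloc : ∀ y₀, ∃ r > 0, ∀ y, dist (Φ y) (Φ y₀) ≤ r → ‖y - y₀‖ ≤ 2 * dist (Φ y) (Φ y₀))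
    (o : E) : ∃ C, ∀ y, ‖y - o‖ ≤ C + 16 * dw (Φ o) (Φ y) := by
  set R : ℝ := max (3 * R₀ + 2 * ρ p + 1) (dist (Φ o) p) with hRdef
  have hR : 3 * R₀ + 2 * ρ p < R := lt_of_lt_of_le (by linarith) (le_max_left _ _)
  have hΦρ : ∀ y, ρ (Φ y) = 0 := fun y => (hrange _).2 ⟨y, rfl⟩
  set S : Set M := {x | dist x p + 2 * ρ x ≤ R} with hS
  have hoS : Φ o ∈ S := by
    rw [hS, mem_ofPred_eq, hΦρ, mul_zero, add_zero]
    exact le_max_right _ _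
  have hρc := hρ.continuous
  have hSc : IsCompact S := by
    refine Metric.isCompact_of_isClosed_isBounded ?_ ?_
    · have c2 : Continuous fun y => dist y p + 2 * ρ y := by fun_prop
      exact isClosed_le c2 continuous_const
    · refine Metric.isBounded_closedBall.subset (t := Metric.closedBall p R) fun z hz => ?_
      have hz : dist z p + 2 * ρ z ≤ R := hz
      rw [Metric.mem_closedBall]
      linarith [hρ0 z]
  obtain ⟨D, hD⟩ := h.exists_isDistTo hSc ⟨_, hoS⟩
  have hcl : Topology.IsClosedEmbedding Φ := by
    refine ⟨hΦ, ?_⟩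
    have : range Φ = {x | ρ x = 0} := by ext x; exact (hrange x).symm
    rw [this]
    exact isClosed_eq hρc continuous_const
  obtain ⟨C, hC⟩ := (hcl.isCompact_preimage hSc).isBounded.subset_closedBall o
  refine ⟨C, fun y => ?_⟩
  have hDc := hD.continuous h
  -- Minimize D (Φ y') + ‖y - y'‖/16. Outside S, a descent step lowers D by dist/4, which is at
  -- least 1/8 of the Euclidean displacement by the local bi-Lipschitz bound, and this beats the
  -- slope 1/16. So the minimum lies over S, within the fixed distance C of o.
  have hJc : Continuous fun y' => D (Φ y') + ‖y - y'‖ / 16 := by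
    have := hΦ.continuous
    fun_prop
  have hJt : Tendsto (fun y' => D (Φ y') + ‖y - y'‖ / 16) (cocompact E) atTop := by
    have h1 : Tendsto (fun y' => ‖y - y'‖ / 16) (cocompact E) atTop := by
      have h2 := tendsto_dist_left_cocompact_atTop y
      refine (h2.atTop_div_const (by norm_num : (0 : ℝ) < 16)).congr fun y' => ?_
      rw [dist_eq_norm]
    exact tendsto_atTop_mono (fun y' => by linarith [hD.nonneg h (Φ y')]) h1
  obtain ⟨y', hy'⟩ := hJc.exists_forall_le hJt
  have hy'S : Φ y' ∈ S := by
    by_contra hcon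
    have hlt : R < dist (Φ y') p := by
      by_contra hle
      refine hcon ?_
      rw [hS, mem_ofPred_eq, hΦρ, mul_zero, add_zero]
      exact not_lt.1 hle
    obtain ⟨r, hr, hloc⟩ := hloc y'
    obtain ⟨z, hz0, hzne, hzr, hDz⟩ := he.exists_descent h hρ0 hρ hR hD (hΦρ y') hlt hr
    obtain ⟨y'', rfl⟩ := (hrange z).1 hz0
    have h1 := hloc y'' hzr
    have h2 : 0 < ‖y'' - y'‖ := norm_pos_iff.2 (sub_ne_zero.2 fun e => hzne (by rw [e]))
    have h3 := hy' y''
    have h4 : ‖y - y''‖ ≤ ‖y - y'‖ + ‖y'' - y'‖ := by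
      rw [norm_sub_rev y'' y']
      exact norm_sub_le_norm_sub_add_norm_sub _ _ _
    linarith
  have h1 := hy' y
  simp only [sub_self, norm_zero, zero_div, add_zero] at h1
  rw [hD.eq_zero h hy'S, zero_add] at h1
  have h2 := hD.le (Φ y) (Φ o) hoS
  have h3 : ‖y' - o‖ ≤ C := by
    have := hC hy'S
    rwa [Metric.mem_closedBall, dist_eq_norm] at this
  have h4 : ‖y - o‖ ≤ ‖y - y'‖ + ‖y' - o‖ := norm_sub_le_norm_sub_add_norm_sub _ _ _
  linarith

/-- If a function `δ` on a normed space grows at least like `‖y - o‖ ≤ C + 16 (1 + δ) ^ κ δ`, its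
infimum on spheres grows faster than any power of exponent less than `1 / (1 + κ)`. -/
theorem tendsto_sInf_sphere_div_rpow [NormedSpace ℝ E] [Nontrivial E] {δ : E → ℝ}
    (hδ : ∀ y, 0 ≤ δ y) {o : E} {C κ β : ℝ} (hκ : 0 ≤ κ) (hβ : 0 < β) (hβκ : β < 1 / (1 + κ))
    (hgrow : ∀ y, ‖y - o‖ ≤ C + 16 * ((1 + δ y) ^ κ * δ y)) :
    Tendsto (fun a : ℝ => sInf (δ '' Metric.sphere o a) / a ^ β) atTop atTop := by
  have hκ1 : 0 < 1 + κ := by positivity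
  set b := 1 / (1 + κ) with hb
  have hlow : ∀ᶠ a : ℝ in atTop,
      (1 / 32) ^ b * a ^ (b - β) - 1 ≤ sInf (δ '' Metric.sphere o a) / a ^ β := by
    filter_upwards [eventually_ge_atTop (2 * C), eventually_ge_atTop (1 : ℝ)] with a haC ha1
    have ha : 0 < a := by linarith
    have haβ : 1 ≤ a ^ β := Real.one_le_rpow ha1 hβ.le
    have hall : (a / 32) ^ b - 1 ≤ sInf (δ '' Metric.sphere o a) := by
      refine le_csInf ((NormedSpace.sphere_nonempty.2 ha.le).image _) ?_
      rintro _ ⟨y, hy, rfl⟩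
      have hn : ‖y - o‖ = a := by rwa [mem_sphere_iff_norm] at hy
      have h1 := hgrow y
      have hδy := hδ y
      rw [hn] at h1
      -- For a ≥ 2 C the constant absorbs at most half of a, leaving a/2 ≤ 16 (1+δ)^(1+κ).
      have h2 : a / 32 ≤ (1 + δ y) ^ (1 + κ) := by
        rw [add_comm 1 κ, Real.rpow_add (by positivity), Real.rpow_one]
        have : (1 + δ y) ^ κ * δ y ≤ (1 + δ y) ^ κ * (1 + δ y) :=
          mul_le_mul_of_nonneg_left (by linarith) (by positivity)
        linarith
      have h3 : (a / 32) ^ b ≤ ((1 + δ y) ^ (1 + κ)) ^ b :=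
        Real.rpow_le_rpow (by positivity) h2 (by positivity)
      rw [← Real.rpow_mul (by positivity), hb, mul_one_div_cancel hκ1.ne', Real.rpow_one] at h3
      linarith
    rw [le_div_iff₀ (by positivity)]
    refine le_trans ?_ hall
    have e1 : a ^ (b - β) * a ^ β = a ^ b := by
      rw [← Real.rpow_add ha]; congr 1; ring
    have e2 : (a / 32) ^ b = (1 / 32) ^ b * a ^ b := by
      rw [← Real.mul_rpow (by norm_num) ha.le]; congr 1; ring
    rw [e2, sub_mul, mul_assoc, e1]
    linarith
  refine tendsto_atTop_mono' _ hlow ?_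
  refine tendsto_atTop_add_const_right _ _ ?_
  exact (tendsto_rpow_atTop (by linarith)).const_mul_atTop (by positivity)

end Growth

open Manifold MeasureTheory

/-! ### Properness of complete length spaces. -/

section HopfRinow

variable {M : Type*} [MetricSpace M]

/-- The Hopf-Rinow theorem: a complete locally compact length space is proper. -/
theorem properSpace_of_exists_intermediate [CompleteSpace M] [LocallyCompactSpace M]
    (h : ∀ (x z : M) (r η : ℝ), 0 ≤ r → r ≤ dist x z → 0 < η →
      ∃ y, dist x y = r ∧ dist y z ≤ dist x z - r + η) : ProperSpace M := by
  refine ⟨fun x => ?_⟩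
  by_contra! hcon
  obtain ⟨r₀, hr₀⟩ := hcon
  set A : Set ℝ := {r | IsCompact (Metric.closedBall x r)} with hA
  have hdown : ∀ r ∈ A, ∀ s ≤ r, s ∈ A := fun r hr s hs =>
    IsCompact.of_isClosed_subset hr Metric.isClosed_closedBall (Metric.closedBall_subset_closedBall hs)
  have hbdd : BddAbove A := ⟨r₀, fun r hr => by
    by_contra hlt
    exact hr₀ (hdown r hr r₀ (not_le.1 hlt).le)⟩
  have h0 : (0 : ℝ) ∈ A := by simp [hA]
  set R := sSup A with hR
  have hR0 : 0 ≤ R := le_csSup hbdd h0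
  have hlt : ∀ r < R, r ∈ A := by
    intro r hr
    obtain ⟨s, hs, hrs⟩ := exists_lt_of_lt_csSup ⟨0, h0⟩ hr
    exact hdown s hs r hrs.le
  -- The supremum is attained: a point of the R-ball is within ε/2 of the compact ball of radius R -
  -- ε/4, whose finite nets therefore also serve the R-ball.
  have hRA : R ∈ A := by
    refine (TotallyBounded.isCompact_of_isClosed ?_ Metric.isClosed_closedBall)
    rw [Metric.totallyBounded_iff]
    intro ε hε
    obtain ⟨t, htf, ht⟩ := Metric.totallyBounded_iff.1 (hlt (R - ε / 4) (by linarith)).totallyBounded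
      (ε / 4) (by positivity)
    by_cases hRε : R ≤ ε / 2
    · refine ⟨{x}, finite_singleton x, fun y hy => ?_⟩
      simp only [mem_singleton_iff, iUnion_iUnion_eq_left, Metric.mem_ball]
      rw [Metric.mem_closedBall] at hy
      linarith
    refine ⟨t, htf, fun y hy => ?_⟩
    rw [Metric.mem_closedBall] at hy
    have : ∃ y', dist x y' ≤ R - ε / 4 ∧ dist y y' ≤ ε / 2 := by
      by_cases hxy : dist x y ≤ R - ε / 4
      · exact ⟨y, hxy, by simp; positivity⟩
      · obtain ⟨y', h1, h2⟩ := h x y (R - ε / 4) (ε / 4) (by linarith) (not_le.1 hxy).le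
          (by positivity)
        refine ⟨y', h1.le, ?_⟩
        rw [dist_comm y y']
        rw [dist_comm] at hy
        linarith
    obtain ⟨y', h1, h2⟩ := this
    have h3 := ht (show y' ∈ Metric.closedBall x (R - ε / 4) by
      rw [Metric.mem_closedBall, dist_comm]; exact h1)
    simp only [mem_iUnion, Metric.mem_ball] at h3 ⊢
    obtain ⟨z, hz, hz'⟩ := h3
    refine ⟨z, hz, ?_⟩
    have := dist_triangle y y' z
    linarith
  -- By local compactness a thickening of the R-ball lies in a compact set. It contains a larger
  -- ball, which contradicts the choice of R.
  obtain ⟨K, hK, hKR⟩ := exists_compact_superset hRA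
  obtain ⟨δ, hδ, hδK⟩ := (hRA : IsCompact (Metric.closedBall x R)).exists_thickening_subset_open
    isOpen_interior hKR
  have : R + δ / 2 ∈ A := by
    refine hK.of_isClosed_subset Metric.isClosed_closedBall fun y hy => interior_subset (hδK ?_)
    rw [Metric.mem_closedBall, dist_comm] at hy
    rw [Metric.mem_thickening_iff]
    by_cases hxy : dist x y ≤ R
    · exact ⟨y, by rwa [Metric.mem_closedBall, dist_comm], by simpa using hδ⟩
    · obtain ⟨y', h1, h2⟩ := h x y R (δ / 4) hR0 (not_le.1 hxy).le (by positivity)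
      refine ⟨y', by rw [Metric.mem_closedBall, dist_comm, h1], ?_⟩
      rw [dist_comm]
      linarith
  linarith [le_csSup hbdd this]

end HopfRinow

/-! ### Length and distance of a conformally weighted metric. -/

section WeightedLength

variable {E : Type*} [NormedAddCommGroup E] [NormedSpace ℝ E] {H : Type*} [TopologicalSpace H]
  (I : ModelWithCorners ℝ E H) {M : Type*} [MetricSpace M] [ChartedSpace H M]
  [Bundle.RiemannianBundle (fun x : M => TangentSpace I x)]

/-- The Riemannian norm, multiplied by the weight `w`. -/
@[reducible] def weightedENorm (w : M → ℝ≥0) (x : M) : ENorm (TangentSpace I x) :=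
  ⟨fun v => w x * ‖v‖ₑ⟩

/-- The length of a path for the metric with weight `w`. -/
def wLength (w : M → ℝ≥0) (γ : ℝ → M) (a b : ℝ) : ℝ≥0∞ :=
  @pathELength E _ _ H _ I M _ _ (weightedENorm I w) γ a b

/-- The extended distance for the metric with weight `w`. -/
def wEDist (w : M → ℝ≥0) (x y : M) : ℝ≥0∞ :=
  @riemannianEDist E _ _ H _ I M _ _ (weightedENorm I w) x y

variable {I} {w : M → ℝ≥0}

lemma wLength_eq (γ : ℝ → M) (a b : ℝ) :
    wLength I w γ a b = ∫⁻ t in Icc a b, w (γ t) * ‖mfderiv 𝓘(ℝ, ℝ) I γ t 1‖ₑ := by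
  exact @pathELength_eq_lintegral_mfderiv_Icc E _ _ H _ I M _ _ (weightedENorm I w) a b γ

lemma wLength_eq_Ioo (γ : ℝ → M) (a b : ℝ) :
    wLength I w γ a b = ∫⁻ t in Ioo a b, w (γ t) * ‖mfderiv 𝓘(ℝ, ℝ) I γ t 1‖ₑ := by
  exact @pathELength_eq_lintegral_mfderiv_Ioo E _ _ H _ I M _ _ (weightedENorm I w) a b γ

/-- With homogeneity of the weighted norm, the general theory of path length and Riemannian distance
applies to it by changing only the norm instance. -/
lemma enormSMulClass_weighted (x : M) :
    @ENormSMulClass ℝ (TangentSpace I x) _ (weightedENorm I w x) _ := by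
  refine @ENormSMulClass.mk ℝ (TangentSpace I x) _ (weightedENorm I w x) _ fun c v => ?_
  show (w x : ℝ≥0∞) * ‖c • v‖ₑ = ‖c‖ₑ * (w x * ‖v‖ₑ)
  rw [enorm_smul]
  ring

lemma wEDist_le_wLength {γ : ℝ → M} {a b : ℝ} (hγ : ContMDiffOn 𝓘(ℝ, ℝ) I 1 γ (Icc a b))
    (hab : a ≤ b) : wEDist I w (γ a) (γ b) ≤ wLength I w γ a b :=
  @riemannianEDist_le_pathELength E _ _ H _ I M _ _ (weightedENorm I w) enormSMulClass_weighted
    _ _ _ _ _ hγ rfl rfl hab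

lemma exists_wLength_lt {x y : M} {r : ℝ≥0∞} (hr : wEDist I w x y < r) :
    ∃ γ : ℝ → M, γ 0 = x ∧ γ 1 = y ∧ ContMDiffOn 𝓘(ℝ, ℝ) I 1 γ (Icc 0 1) ∧
      wLength I w γ 0 1 < r :=
  @exists_lt_of_riemannianEDist_lt E _ _ H _ I M _ _ (weightedENorm I w) _ _ _ hr

lemma wEDist_comm (x y : M) : wEDist I w x y = wEDist I w y x :=
  @riemannianEDist_comm E _ _ H _ I M _ _ (weightedENorm I w) enormSMulClass_weighted _ _

lemma wEDist_triangle (x y z : M) : wEDist I w x z ≤ wEDist I w x y + wEDist I w y z :=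
  @riemannianEDist_triangle E _ _ H _ I M _ _ (weightedENorm I w) enormSMulClass_weighted _ _ _

lemma wLength_add {γ : ℝ → M} {a b c : ℝ} (hab : a ≤ b) (hbc : b ≤ c) :
    wLength I w γ a b + wLength I w γ b c = wLength I w γ a c :=
  @pathELength_add E _ _ H _ I M _ _ (weightedENorm I w) _ _ _ _ hab hbc

variable [IsRiemannianManifold I M]

lemma edist_le_pathELength {γ : ℝ → M} {a b : ℝ} (hγ : ContMDiffOn 𝓘(ℝ, ℝ) I 1 γ (Icc a b))
    (hab : a ≤ b) : edist (γ a) (γ b) ≤ pathELength I γ a b := by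
  rw [IsRiemannianManifold.out (I := I)]
  exact riemannianEDist_le_pathELength hγ rfl rfl hab

lemma edist_le_pathELength_of_mem {γ : ℝ → M} {a b t : ℝ}
    (hγ : ContMDiffOn 𝓘(ℝ, ℝ) I 1 γ (Icc a b)) (ht : t ∈ Icc a b) :
    edist (γ a) (γ t) ≤ pathELength I γ a b :=
  (edist_le_pathELength (hγ.mono (Icc_subset_Icc le_rfl ht.2)) ht.1).trans
    (pathELength_mono le_rfl ht.2)

omit [IsRiemannianManifold I M] in
lemma pathELength_le_wLength (hw : ∀ x, 1 ≤ w x) (γ : ℝ → M) (a b : ℝ) :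
    pathELength I γ a b ≤ wLength I w γ a b := by
  rw [wLength_eq, pathELength_eq_lintegral_mfderiv_Icc]
  refine lintegral_mono fun t => ?_
  calc ‖mfderiv 𝓘(ℝ, ℝ) I γ t 1‖ₑ = 1 * ‖mfderiv 𝓘(ℝ, ℝ) I γ t 1‖ₑ := (one_mul _).symm
    _ ≤ _ := by gcongr; exact_mod_cast hw _

lemma edist_le_wEDist (hw : ∀ x, 1 ≤ w x) (x y : M) : edist x y ≤ wEDist I w x y := by
  refine le_of_forall_gt fun r hr => ?_
  obtain ⟨γ, rfl, rfl, hγ, hl⟩ := exists_wLength_lt hr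
  exact ((edist_le_pathELength hγ zero_le_one).trans (pathELength_le_wLength hw γ 0 1)).trans_lt hl

/-- The weight `(1 + ρ) ^ κ`. -/
def rpowWeight (ρ : M → ℝ) (κ : ℝ) (x : M) : ℝ≥0 := Real.toNNReal ((1 + ρ x) ^ κ)

variable {ρ : M → ℝ} {κ : ℝ}

omit [MetricSpace M] in
lemma one_le_rpowWeight (hρ0 : ∀ x, 0 ≤ ρ x) (hκ0 : 0 ≤ κ) (x : M) : 1 ≤ rpowWeight ρ κ x := by
  rw [rpowWeight, Real.one_le_toNNReal]
  exact Real.one_le_rpow (by linarith [hρ0 x]) hκ0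

/-- A curve from x of length less than r stays where ρ ≤ ρ x + r, so its weight is at most (1 + ρ x
+ r)^κ. Then r decreases to the distance. -/
lemma wEDist_rpowWeight_le (hρ0 : ∀ x, 0 ≤ ρ x) (hρ : LipschitzWith 1 ρ) (hκ0 : 0 ≤ κ) (x y : M) :
    wEDist I (rpowWeight ρ κ) x y
      ≤ ENNReal.ofReal ((1 + ρ x + dist x y) ^ κ * dist x y) := by
  have key : ∀ r > dist x y, wEDist I (rpowWeight ρ κ) x y
      ≤ ENNReal.ofReal ((1 + ρ x + r) ^ κ * r) := by
    intro r hr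
    have hr0 : 0 ≤ r := dist_nonneg.trans hr.le
    have h1 : riemannianEDist I x y < ENNReal.ofReal r := by
      rw [← IsRiemannianManifold.out (I := I), edist_dist]
      exact ENNReal.ofReal_lt_ofReal_iff_of_nonneg dist_nonneg |>.2 hr
    obtain ⟨γ, rfl, rfl, hγ, hl⟩ := exists_lt_of_riemannianEDist_lt h1
    refine (wEDist_le_wLength hγ zero_le_one).trans ?_
    rw [wLength_eq, ENNReal.ofReal_mul (Real.rpow_nonneg (by linarith [hρ0 (γ 0)]) _)]
    refine le_trans ?_ (mul_le_mul_right hl.le _)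
    rw [pathELength_eq_lintegral_mfderiv_Icc, ← lintegral_const_mul' _ _ ENNReal.ofReal_ne_top]
    refine setLIntegral_mono' measurableSet_Icc fun t ht => ?_
    gcongr
    have h2 : dist (γ 0) (γ t) ≤ r := by
      have := (edist_le_pathELength_of_mem hγ ht).trans hl.le
      rw [edist_dist] at this
      exact (ENNReal.ofReal_le_ofReal_iff hr0).1 this
    have h3 : ρ (γ t) ≤ ρ (γ 0) + r := by
      have := hρ.dist_le_mul (γ 0) (γ t)
      rw [Real.dist_eq, NNReal.coe_one, one_mul] at this
      linarith [abs_le.1 this]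
    rw [rpowWeight]
    change ENNReal.ofReal _ ≤ _
    exact ENNReal.ofReal_le_ofReal
      (Real.rpow_le_rpow (by linarith [hρ0 (γ t)]) (by linarith) hκ0)
  have hc : ContinuousAt (fun r : ℝ => ENNReal.ofReal ((1 + ρ x + r) ^ κ * r)) (dist x y) := by
    refine ENNReal.continuous_ofReal.continuousAt.comp ?_
    refine ContinuousAt.mul (ContinuousAt.rpow_const (by fun_prop) (Or.inr hκ0)) continuousAt_id
  exact ge_of_tendsto (hc.tendsto.mono_left nhdsWithin_le_nhds)
    (eventually_nhdsWithin_of_forall (s := Ioi (dist x y)) key)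

variable (I) in
/-- The distance for the metric with weight `(1 + ρ) ^ κ`. -/
def wDist (ρ : M → ℝ) (κ : ℝ) (x y : M) : ℝ := (wEDist I (rpowWeight ρ κ) x y).toReal

lemma wEDist_eq_ofReal (hρ0 : ∀ x, 0 ≤ ρ x) (hρ : LipschitzWith 1 ρ) (hκ0 : 0 ≤ κ) (x y : M) :
    wEDist I (rpowWeight ρ κ) x y = ENNReal.ofReal (wDist I ρ κ x y) :=
  (ENNReal.ofReal_toReal
    ((wEDist_rpowWeight_le hρ0 hρ hκ0 x y).trans_lt ENNReal.ofReal_lt_top).ne).symm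

lemma wDist_le_rpow (hρ0 : ∀ x, 0 ≤ ρ x) (hρ : LipschitzWith 1 ρ) (hκ0 : 0 ≤ κ) (x y : M) :
    wDist I ρ κ x y ≤ (1 + ρ x + dist x y) ^ κ * dist x y :=
  ENNReal.toReal_le_of_le_ofReal (mul_nonneg (Real.rpow_nonneg
    (by linarith [hρ0 x, dist_nonneg (x := x) (y := y)]) _) dist_nonneg)
    (wEDist_rpowWeight_le hρ0 hρ hκ0 x y)

theorem isWeightedLengthDist_wDist (hρ0 : ∀ x, 0 ≤ ρ x) (hρ : LipschitzWith 1 ρ) (hκ0 : 0 ≤ κ)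
    (hκ1 : κ ≤ 1) : IsWeightedLengthDist ρ (wDist I ρ κ) := by
  have hofReal := wEDist_eq_ofReal (I := I) hρ0 hρ hκ0
  have hnn : ∀ x y, 0 ≤ wDist I ρ κ x y := fun x y => ENNReal.toReal_nonneg
  have hsymm : ∀ x y, wDist I ρ κ x y = wDist I ρ κ y x := fun x y => by
    rw [wDist, wDist, wEDist_comm]
  have htri : ∀ x y z, wDist I ρ κ x z ≤ wDist I ρ κ x y + wDist I ρ κ y z := by
    intro x y z
    have := wEDist_triangle (I := I) (w := rpowWeight ρ κ) x y z
    rw [hofReal, hofReal, hofReal, ← ENNReal.ofReal_add (hnn _ _) (hnn _ _)] at this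
    exact (ENNReal.ofReal_le_ofReal_iff (add_nonneg (hnn _ _) (hnn _ _))).1 this
  have hle : ∀ x y, wDist I ρ κ x y ≤ (1 + ρ x + dist x y) * dist x y := by
    intro x y
    refine (wDist_le_rpow hρ0 hρ hκ0 x y).trans (mul_le_mul_of_nonneg_right ?_ dist_nonneg)
    have h1 : 1 ≤ 1 + ρ x + dist x y := by linarith [hρ0 x, dist_nonneg (x := x) (y := y)]
    simpa using Real.rpow_le_rpow_of_exponent_le h1 hκ1
  refine ⟨hsymm, htri, fun x y => ?_, hle, fun x z r η hr hrz hη => ?_⟩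
  · have := edist_le_wEDist (I := I) (one_le_rpowWeight hρ0 hκ0) x y
    rw [hofReal, edist_dist] at this
    exact (ENNReal.ofReal_le_ofReal_iff (hnn _ _)).1 this
  -- An almost minimizing curve crosses the weighted sphere of radius r by the intermediate value
  -- theorem. Splitting its length at the crossing gives the bound.
  · have hlt : wEDist I (rpowWeight ρ κ) x z < ENNReal.ofReal (wDist I ρ κ x z + η) := by
      rw [hofReal]
      exact (ENNReal.ofReal_lt_ofReal_iff_of_nonneg (hnn _ _)).2 (by linarith)
    obtain ⟨γ, rfl, rfl, hγ, hl⟩ := exists_wLength_lt hlt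
    have hcont : ContinuousOn (fun t => wDist I ρ κ (γ 0) (γ t)) (Icc 0 1) :=
      (continuous_of_le_mul_dist hsymm htri hle (γ 0)).comp_continuousOn hγ.continuousOn
    have h00 : wDist I ρ κ (γ 0) (γ 0) ≤ 0 := by simpa using hle (γ 0) (γ 0)
    obtain ⟨t, ht, htr⟩ := intermediate_value_Icc zero_le_one hcont
      (show r ∈ Icc _ _ from ⟨h00.trans hr, hrz⟩)
    refine ⟨γ t, htr, ?_⟩
    have h1 := wEDist_le_wLength (w := rpowWeight ρ κ) (hγ.mono (Icc_subset_Icc le_rfl ht.2)) ht.1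
    have h2 := wEDist_le_wLength (w := rpowWeight ρ κ) (hγ.mono (Icc_subset_Icc ht.1 le_rfl)) ht.2
    have h3 := (add_le_add h1 h2).trans ((wLength_add ht.1 ht.2).le.trans hl.le)
    rw [hofReal, hofReal, ← ENNReal.ofReal_add (hnn _ _) (hnn _ _)] at h3
    have h4 := (ENNReal.ofReal_le_ofReal_iff (by linarith [hnn (γ 0) (γ 1)])).1 h3
    simp only at htr
    linarith

omit [IsRiemannianManifold I M] in
/-- A complete finite dimensional Riemannian manifold, possibly with boundary, is proper. -/
theorem properSpace_of_riemannian (hM : IsRiemannianManifold I M) [CompleteSpace M]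
    [LocallyCompactSpace M] : ProperSpace M := by
  refine properSpace_of_exists_intermediate fun x z r η hr hrz hη => ?_
  -- For the exponent 0 the weighted distance is the Riemannian one, which therefore has approximate
  -- intermediate points.
  have h := isWeightedLengthDist_wDist (I := I) (M := M) (ρ := fun _ => 0) (κ := 0) (fun _ => le_rfl)
    (LipschitzWith.const' 0) le_rfl zero_le_one
  have he : ∀ a b : M, wDist I (fun _ => 0) 0 a b = dist a b := by
    intro a b
    refine le_antisymm ?_ (h.dist_le a b)
    simpa using wDist_le_rpow (I := I) (M := M) (ρ := fun _ => 0) (κ := 0) (fun _ => le_rfl)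
      (LipschitzWith.const' 0) le_rfl a b
  simpa only [he] using h.exists_intermediate x z r η hr (by rwa [he]) hη

end WeightedLength

/-! ### The metric in charts, at interior points. -/

section Charts

variable {d : ℕ} [NeZero d] {M : Type*} [MetricSpace M] [ChartedSpace (EuclideanHalfSpace d) M]

/-- The derivative of the inverse of the chart around `c`, at the coordinates `u`. -/
def chartDeriv (c : M) (u : Euc d) :
    Euc d →L[ℝ] TangentSpace (𝓡∂ d) ((extChartAt (𝓡∂ d) c).symm u) :=
  mfderivWithin 𝓘(ℝ, Euc d) (𝓡∂ d) (extChartAt (𝓡∂ d) c).symm (range (𝓡∂ d)) u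

lemma mem_target_of_mem_interior {c : M} {u : Euc d}
    (hu : u ∈ interior (extChartAt (𝓡∂ d) c).target) : u ∈ (extChartAt (𝓡∂ d) c).target :=
  interior_subset hu

lemma range_mem_nhds_of_mem_interior {c : M} {u : Euc d}
    (hu : u ∈ interior (extChartAt (𝓡∂ d) c).target) : range (𝓡∂ d) ∈ 𝓝 u :=
  mem_of_superset (mem_interior_iff_mem_nhds.1 hu) (extChartAt_target_subset_range c)

section

variable [IsManifold (𝓡∂ d) ∞ M]

lemma isInteriorPoint_iff_mem {c x : M} (hx : x ∈ (extChartAt (𝓡∂ d) c).source) :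
    x ∈ (𝓡∂ d).interior M ↔ extChartAt (𝓡∂ d) c x ∈ interior (extChartAt (𝓡∂ d) c).target :=
  (𝓡∂ d).isInteriorPoint_iff_of_mem_atlas (n := ∞) (by simp) (chart_mem_atlas _ c)
    (by rwa [extChartAt_source] at hx)

lemma symm_mem_interior {c : M} {u : Euc d}
    (hu : u ∈ interior (extChartAt (𝓡∂ d) c).target) :
    (extChartAt (𝓡∂ d) c).symm u ∈ (𝓡∂ d).interior M := by
  have h := mem_target_of_mem_interior hu
  rw [isInteriorPoint_iff_mem ((extChartAt (𝓡∂ d) c).map_target h),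
    (extChartAt (𝓡∂ d) c).right_inv h]
  exact hu

lemma chartDeriv_isInvertible {c : M} {u : Euc d} (hu : u ∈ (extChartAt (𝓡∂ d) c).target) :
    (chartDeriv c u).IsInvertible :=
  isInvertible_mfderivWithin_extChartAt_symm hu

lemma hasMFDerivAt_symm {c : M} {u : Euc d}
    (hu : u ∈ interior (extChartAt (𝓡∂ d) c).target) :
    HasMFDerivAt 𝓘(ℝ, Euc d) (𝓡∂ d) (extChartAt (𝓡∂ d) c).symm u (chartDeriv c u) :=
  (mdifferentiableWithinAt_extChartAt_symm (mem_target_of_mem_interior hu)).hasMFDerivWithinAt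
    |>.hasMFDerivAt (range_mem_nhds_of_mem_interior hu)

/-- The velocity of a curve, given in coordinates. -/
lemma hasMFDerivAt_symm_comp {c : M} {σ : ℝ → Euc d} {σ' : Euc d} {t : ℝ}
    (hσ : HasDerivAt σ σ' t) (hu : σ t ∈ interior (extChartAt (𝓡∂ d) c).target) :
    HasMFDerivAt 𝓘(ℝ, ℝ) (𝓡∂ d) (fun s => (extChartAt (𝓡∂ d) c).symm (σ s)) t
      ((chartDeriv c (σ t)).comp (ContinuousLinearMap.toSpanSingleton ℝ σ')) :=
  (hasMFDerivAt_symm hu).comp t hσ.hasFDerivAt.hasMFDerivAt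

lemma mfderiv_symm_comp_one {c : M} {σ : ℝ → Euc d} {σ' : Euc d} {t : ℝ}
    (hσ : HasDerivAt σ σ' t) (hu : σ t ∈ interior (extChartAt (𝓡∂ d) c).target) :
    mfderiv 𝓘(ℝ, ℝ) (𝓡∂ d) (fun s => (extChartAt (𝓡∂ d) c).symm (σ s)) t (1 : ℝ)
      = chartDeriv c (σ t) σ' := by
  rw [(hasMFDerivAt_symm_comp hσ hu).mfderiv]
  change chartDeriv c (σ t) (ContinuousLinearMap.toSpanSingleton ℝ σ' (1 : ℝ)) = _
  rw [ContinuousLinearMap.toSpanSingleton_apply, one_smul]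

/-- The coordinates of a curve are differentiable where the curve is. -/
lemma hasDerivAt_extChartAt_comp {c : M} {γ : ℝ → M} {t : ℝ}
    (hγ : MDifferentiableAt 𝓘(ℝ, ℝ) (𝓡∂ d) γ t) (ht : γ t ∈ (extChartAt (𝓡∂ d) c).source) :
    ∃ σ', HasDerivAt (fun s => extChartAt (𝓡∂ d) c (γ s)) σ' t := by
  have h1 : MDifferentiableAt (𝓡∂ d) 𝓘(ℝ, Euc d) (extChartAt (𝓡∂ d) c) (γ t) :=
    mdifferentiableAt_extChartAt (by rwa [extChartAt_source] at ht)
  have h2 := (h1.comp t hγ).differentiableAt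
  exact ⟨_, h2.hasDerivAt⟩

variable [Bundle.RiemannianBundle (fun x : M => TangentSpace (𝓡∂ d) x)]

omit [IsManifold (𝓡∂ d) ∞ M] in
lemma coordMatrix_apply (c : M) (u : Euc d) (i j : Fin d) :
    coordMatrix (metricForm d M) c u i j = inner ℝ (chartDeriv c u (EuclideanSpace.single i 1))
      (chartDeriv c u (EuclideanSpace.single j 1)) := rfl

omit [IsManifold (𝓡∂ d) ∞ M] in
lemma coordMatrix_symm (c : M) (u : Euc d) (i j : Fin d) :
    coordMatrix (metricForm d M) c u i j = coordMatrix (metricForm d M) c u j i := by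
  rw [coordMatrix_apply, coordMatrix_apply, real_inner_comm]

omit [NeZero d] in
lemma sum_smul_single (v : Euc d) : ∑ i, v i • EuclideanSpace.single i (1 : ℝ) = v := by
  ext j
  simp [Pi.single_apply]

omit [IsManifold (𝓡∂ d) ∞ M] in
lemma inner_chartDeriv (c : M) (u v w : Euc d) :
    inner ℝ (chartDeriv c u v) (chartDeriv c u w)
      = ∑ j, (∑ i, coordMatrix (metricForm d M) c u j i * v i) * w j := by
  conv_lhs => rw [← sum_smul_single v, ← sum_smul_single w]
  simp only [map_sum, map_smul, sum_inner, inner_sum, inner_smul_left, inner_smul_right,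
    Finset.sum_mul, Finset.mul_sum, conj_trivial]
  refine Finset.sum_congr rfl fun j _ => Finset.sum_congr rfl fun i _ => ?_
  rw [coordMatrix_symm, coordMatrix_apply]
  ring

omit [IsManifold (𝓡∂ d) ∞ M] in
lemma quad_coordMatrix (c : M) (u v : Euc d) :
    quad (coordMatrix (metricForm d M) c u) v = ‖chartDeriv c u v‖ ^ 2 := by
  rw [← real_inner_self_eq_norm_sq, inner_chartDeriv, quad]
  refine Finset.sum_congr rfl fun j _ => ?_
  rw [Finset.sum_mul]
  exact Finset.sum_congr rfl fun i _ => by ring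

lemma coordMatrix_posDef {c : M} {u : Euc d} (hu : u ∈ (extChartAt (𝓡∂ d) c).target) :
    (coordMatrix (metricForm d M) c u).PosDef := by
  refine Matrix.PosDef.of_dotProduct_mulVec_pos ?_ fun v hv => ?_
  · ext i j
    simpa using coordMatrix_symm c u j i
  · have h := quad_eq_dotProduct (coordMatrix (metricForm d M) c u) (WithLp.toLp 2 v)
    simp only [star_trivial]
    rw [← h, quad_coordMatrix]
    have : chartDeriv c u (WithLp.toLp 2 v) ≠ 0 := by
      intro h0
      have hinj := (chartDeriv_isInvertible hu).injective
      have h2 := hinj (h0.trans (map_zero _).symm)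
      exact hv (by simpa using congrArg WithLp.ofLp h2)
    positivity

lemma coordMatrix_det_ne_zero {c : M} {u : Euc d} (hu : u ∈ (extChartAt (𝓡∂ d) c).target) :
    (coordMatrix (metricForm d M) c u).det ≠ 0 :=
  (coordMatrix_posDef hu).det_pos.ne'

end

lemma IsC2HolderForm.contDiffAt {α : ℝ≥0} {h : FormField d M} (hh : IsC2HolderForm α h) {c : M}
    {u : Euc d} (hu : u ∈ interior (extChartAt (𝓡∂ d) c).target) (i j : Fin d) :
    ContDiffAt ℝ 2 (fun w => coordMatrix h c w i j) u :=
  (hh c i j).1.contDiffAt (mem_interior_iff_mem_nhds.1 hu)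

lemma IsC2HolderFun.contDiffAt {α : ℝ≥0} {f : M → ℝ} (hf : IsC2HolderFun d α f) {c : M}
    {u : Euc d} (hu : u ∈ interior (extChartAt (𝓡∂ d) c).target) :
    ContDiffAt ℝ 2 (f ∘ (extChartAt (𝓡∂ d) c).symm) u :=
  (hf c).1.contDiffAt (mem_interior_iff_mem_nhds.1 hu)

lemma IsC2HolderFun.contMDiff [IsManifold (𝓡∂ d) ∞ M] {α : ℝ≥0} {f : M → ℝ}
    (hf : IsC2HolderFun d α f) : ContMDiff (𝓡∂ d) 𝓘(ℝ, ℝ) 2 f := by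
  intro x
  have h1 : ContMDiffWithinAt 𝓘(ℝ, Euc d) 𝓘(ℝ, ℝ) 2 (f ∘ (extChartAt (𝓡∂ d) x).symm)
      (extChartAt (𝓡∂ d) x).target (extChartAt (𝓡∂ d) x x) :=
    ((hf x).1 _ (mem_extChartAt_target x)).contMDiffWithinAt
  have h2 : ContMDiffAt (𝓡∂ d) 𝓘(ℝ, Euc d) 2 (extChartAt (𝓡∂ d) x) x :=
    contMDiffAt_extChartAt
  have h3 := h1.comp (s := (extChartAt (𝓡∂ d) x).source) x h2.contMDiffWithinAt
    (fun y hy => (extChartAt (𝓡∂ d) x).map_source hy)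
  refine (h3.contMDiffAt (extChartAt_source_mem_nhds x)).congr_of_eventuallyEq ?_
  filter_upwards [extChartAt_source_mem_nhds (I := 𝓡∂ d) x] with y hy
  rw [Function.comp_apply, Function.comp_apply, (extChartAt (𝓡∂ d) x).left_inv hy]

end Charts

/-! ### Localization of the curvature quantities. -/

section Congr

variable {d : ℕ} {S : Set (Euc d)} {G G' : Euc d → Matrix (Fin d) (Fin d) ℝ} {u : Euc d}

lemma scalar_congr (hS : S ∈ 𝓝 u) (h : G =ᶠ[𝓝 u] G') : scalar S G u = scalar univ G' u := by
  simp only [scalar, ricci_congr hS h, h.self_of_nhds]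

lemma ricciNorm_congr (hS : S ∈ 𝓝 u) (h : G =ᶠ[𝓝 u] G') :
    ricciNorm S G u = ricciNorm univ G' u := by
  simp only [ricciNorm, ricci_congr hS h, h.self_of_nhds]

end Congr

/-! ### Gradient of ρ on the manifold and its Lipschitz bound. -/

section Interior

variable {d : ℕ} [NeZero d] {M : Type*} [MetricSpace M] [ChartedSpace (EuclideanHalfSpace d) M]
  [IsManifold (𝓡∂ d) ∞ M] [Bundle.RiemannianBundle (fun x : M => TangentSpace (𝓡∂ d) x)]
  {α : ℝ≥0} {ρ : M → ℝ}

variable (d) in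
/-- The differential of a function at `x`, as a linear form. -/
def differential (f : M → ℝ) (x : M) : TangentSpace (𝓡∂ d) x →L[ℝ] ℝ :=
  mfderiv (𝓡∂ d) 𝓘(ℝ, ℝ) f x

omit [IsManifold (𝓡∂ d) ∞ M] [Bundle.RiemannianBundle (fun x : M => TangentSpace (𝓡∂ d) x)] in
lemma IsDefiningFunction.pos_iff (hρ : IsDefiningFunction d α ρ) (x : M) :
    0 < ρ x ↔ x ∈ (𝓡∂ d).interior M := by
  have h := hρ.eq_zero_iff x
  rw [(hρ.nonneg x).lt_iff_ne', Ne, h, ← (𝓡∂ d).compl_boundary, mem_compl_iff]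

lemma coordMatrix_conformal {gplus : FormField d M}
    (hconf : ∀ x ∈ (𝓡∂ d).interior M, metricForm d M x = ρ x ^ 2 • gplus x)
    (hρ : IsDefiningFunction d α ρ) {c : M} {u : Euc d}
    (hu : u ∈ interior (extChartAt (𝓡∂ d) c).target) :
    coordMatrix gplus c u = ((ρ ∘ (extChartAt (𝓡∂ d) c).symm) u ^ 2)⁻¹ •
      coordMatrix (metricForm d M) c u := by
  have hx := symm_mem_interior hu
  have h0 := (hρ.pos_iff _).2 hx
  ext i j
  simp only [coordMatrix, Matrix.smul_apply, Matrix.of_apply, hconf _ hx, LinearMap.smul_apply,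
    smul_eq_mul, Function.comp_apply]
  rw [inv_mul_cancel_left₀ (pow_ne_zero 2 h0.ne')]

/-- Bounds in the interior for the gradient and the Hessian of the adapted defining function. -/
theorem gradSq_hess_bounds_of_adapted (hd : 5 ≤ d) (hg : IsC2HolderForm α (metricForm d M))
    {gplus : FormField d M} (hE : IsPoincareEinstein gplus) (hρ : IsDefiningFunction d α ρ)
    (hconf : ∀ x ∈ (𝓡∂ d).interior M, metricForm d M x = ρ x ^ 2 • gplus x)
    (hA : IsAdapted gplus ρ) (hscal : ∀ x, 0 ≤ scalarAt (metricForm d M) x)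
    {x : M} (hx : x ∈ (𝓡∂ d).interior M) {G : Euc d → Matrix (Fin d) (Fin d) ℝ} {r : Euc d → ℝ}
    {u : Euc d} (hG : G = coordMatrix (metricForm d M) x)
    (hr : r = ρ ∘ (extChartAt (𝓡∂ d) x).symm) (hu : u = extChartAt (𝓡∂ d) x x) :
    gradSq G r u ≤ 1 ∧ 1 - 9 / 32 * (ricciNorm univ G u * r u ^ 2) ≤ gradSq G r u ∧
    ∀ v : Euc d, -(2 / 5 * r u * ricciNorm univ G u * quad (G u) v)
      ≤ ∑ i, ∑ j, hess G r u i j * (v i * v j) := by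
  have hui : u ∈ interior (extChartAt (𝓡∂ d) x).target := by
    rw [hu]; exact (isInteriorPoint_iff_mem (mem_extChartAt_source x)).1 hx
  have hS := range_mem_nhds_of_mem_interior hui
  have hru : r u = ρ x := by
    rw [hr, hu, Function.comp_apply, extChartAt_to_inv]
  have h0 : 0 < r u := by rw [hru]; exact (hρ.pos_iff x).2 hx
  have hpos : (G u).PosDef := by rw [hG]; exact coordMatrix_posDef (interior_subset hui)
  have hplus : coordMatrix gplus x =ᶠ[𝓝 u] fun w => (r w ^ 2)⁻¹ • G w := by
    filter_upwards [isOpen_interior.mem_nhds hui] with w hw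
    rw [coordMatrix_conformal hconf hρ hw, hr, hG]
  have hEx := hE x hx
  rw [← hu, ricci_congr hS hplus, hplus.self_of_nhds] at hEx
  have hAx := hA x hx
  rw [laplacianAt, ← hu, ← hru, laplacian_congr (f' := fun w => r w ^ (((d : ℝ) - 4) / 2))
    hS hplus (by rw [hr]; rfl)] at hAx
  obtain ⟨h1, h2⟩ := gradSq_and_hess_of_einstein hd
    (fun w i j => by rw [hG]; exact coordMatrix_symm x w i j)
    (fun i j => by rw [hG]; exact hg.contDiffAt hui i j) hpos.det_pos.ne'
    (by rw [hr]; exact hρ.regular.contDiffAt hui) h0 hEx hAx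
  refine gradSq_hess_bounds hd hpos h0 ?_ h1 h2
  have := hscal x
  rwa [scalarAt, ← hu, scalar_congr hS (G' := G) (by rw [hG])] at this

/-- The components of the vector field `-ρ ∇ρ` in the chart around `c`. -/
def chartPush (ρ : M → ℝ) (c : M) : Euc d → Euc d :=
  pushField (coordMatrix (metricForm d M) c) (ρ ∘ (extChartAt (𝓡∂ d) c).symm)

lemma contDiffAt_chartPush (hg : IsC2HolderForm α (metricForm d M))
    (hρ : IsDefiningFunction d α ρ) {c : M} {u : Euc d}
    (hu : u ∈ interior (extChartAt (𝓡∂ d) c).target) : ContDiffAt ℝ 1 (chartPush ρ c) u :=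
  contDiffAt_pushField (fun i j => hg.contDiffAt hu i j) (coordMatrix_det_ne_zero
    (interior_subset hu)) (hρ.regular.contDiffAt hu)

omit [Bundle.RiemannianBundle (fun x : M => TangentSpace (𝓡∂ d) x)] in
lemma fderiv_comp_symm (hρ : IsDefiningFunction d α ρ) {c : M} {u : Euc d}
    (hu : u ∈ interior (extChartAt (𝓡∂ d) c).target) (w : Euc d) :
    fderiv ℝ (ρ ∘ (extChartAt (𝓡∂ d) c).symm) u w
      = differential d ρ ((extChartAt (𝓡∂ d) c).symm u) (chartDeriv c u w) := by
  have h1 : HasMFDerivAt (𝓡∂ d) 𝓘(ℝ, ℝ) ρ ((extChartAt (𝓡∂ d) c).symm u) _ :=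
    (hρ.regular.contMDiff.mdifferentiableAt (by norm_num)).hasMFDerivAt
  have h2 : HasFDerivAt (𝕜 := ℝ) (E := Euc d) (F := ℝ) (ρ ∘ (extChartAt (𝓡∂ d) c).symm)
      ((differential d ρ ((extChartAt (𝓡∂ d) c).symm u)).comp (chartDeriv c u)) u :=
    (h1.comp u (hasMFDerivAt_symm hu)).hasFDerivAt
  exact congrArg (fun L : Euc d →L[ℝ] ℝ => L w) h2.fderiv

/-- Characterizes -ρ∇ρ by its inner products with tangent vectors, without reference to the chart.
Chart independence of the field and the bound |dρ| ≤ 1 both follow from it. -/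
lemma inner_chartPush (hρ : IsDefiningFunction d α ρ) {c : M} {u : Euc d}
    (hu : u ∈ interior (extChartAt (𝓡∂ d) c).target) (w : Euc d) :
    inner ℝ (chartDeriv c u (chartPush ρ c u)) (chartDeriv c u w)
      = -(ρ ((extChartAt (𝓡∂ d) c).symm u) *
        differential d ρ ((extChartAt (𝓡∂ d) c).symm u) (chartDeriv c u w)) := by
  rw [← fderiv_comp_symm hρ hu, inner_chartDeriv, fderiv_apply_eq_sum, Finset.mul_sum,
    ← Finset.sum_neg_distrib]
  refine Finset.sum_congr rfl fun j _ => ?_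
  rw [chartPush, sum_metric_pushField (coordMatrix_det_ne_zero (interior_subset hu)),
    Function.comp_apply]
  ring

lemma norm_chartPush_sq (hρ : IsDefiningFunction d α ρ) {c : M} {u : Euc d}
    (hu : u ∈ interior (extChartAt (𝓡∂ d) c).target) :
    ‖chartDeriv c u (chartPush ρ c u)‖ ^ 2 = ρ ((extChartAt (𝓡∂ d) c).symm u) ^ 2
      * gradSq (coordMatrix (metricForm d M) c) (ρ ∘ (extChartAt (𝓡∂ d) c).symm) u := by
  rw [← real_inner_self_eq_norm_sq, inner_chartPush hρ hu, ← fderiv_comp_symm hρ hu, chartPush,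
    fderiv_pushField, Function.comp_apply]
  ring

lemma norm_chartPush_le (hρ : IsDefiningFunction d α ρ) {c : M} {u : Euc d}
    (hu : u ∈ interior (extChartAt (𝓡∂ d) c).target)
    (h : gradSq (coordMatrix (metricForm d M) c) (ρ ∘ (extChartAt (𝓡∂ d) c).symm) u ≤ 1) :
    ‖chartDeriv c u (chartPush ρ c u)‖ ≤ ρ ((extChartAt (𝓡∂ d) c).symm u) := by
  refine abs_le_of_sq_le_sq' ?_ (hρ.nonneg _) |>.2
  rw [norm_chartPush_sq hρ hu]
  exact mul_le_of_le_one_right (sq_nonneg _) h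

/-- The differential of `ρ` has norm at most one where its gradient does. -/
lemma abs_mfderiv_le (hρ : IsDefiningFunction d α ρ) {x : M} (hx : x ∈ (𝓡∂ d).interior M)
    (h : gradSq (coordMatrix (metricForm d M) x) (ρ ∘ (extChartAt (𝓡∂ d) x).symm)
      (extChartAt (𝓡∂ d) x x) ≤ 1) (v : TangentSpace (𝓡∂ d) x) :
    |differential d ρ x v| ≤ ‖v‖ := by
  have hu := (isInteriorPoint_iff_mem (mem_extChartAt_source x)).1 hx
  have key : ∀ v : TangentSpace (𝓡∂ d) ((extChartAt (𝓡∂ d) x).symm (extChartAt (𝓡∂ d) x x)),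
      |differential d ρ ((extChartAt (𝓡∂ d) x).symm (extChartAt (𝓡∂ d) x x)) v|
        ≤ ‖v‖ := by
    intro v
    obtain ⟨w, rfl⟩ := (chartDeriv_isInvertible (interior_subset hu)).surjective v
    have h1 := inner_chartPush hρ hu w
    have h2 := norm_chartPush_le hρ hu h
    have h3 := abs_real_inner_le_norm (chartDeriv x (extChartAt (𝓡∂ d) x x)
      (chartPush ρ x (extChartAt (𝓡∂ d) x x))) (chartDeriv x (extChartAt (𝓡∂ d) x x) w)
    have h0 : 0 < ρ ((extChartAt (𝓡∂ d) x).symm (extChartAt (𝓡∂ d) x x)) := by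
      rw [extChartAt_to_inv]; exact (hρ.pos_iff x).2 hx
    rw [h1, abs_neg, abs_mul, abs_of_pos h0] at h3
    refine le_of_mul_le_mul_left (h3.trans ?_) h0
    exact mul_le_mul_of_nonneg_right h2 (norm_nonneg _)
  rw [extChartAt_to_inv] at key
  exact key v

/-- Integrates |dρ| ≤ 1 along curves. No bound is needed on the boundary: when a curve touches it at
an interior time, ρ along the curve has a minimum there and its derivative vanishes. -/
lemma lipschitzWith_of_abs_mfderiv_le [IsRiemannianManifold (𝓡∂ d) M]
    (hρ : IsDefiningFunction d α ρ)
    (h : ∀ x ∈ (𝓡∂ d).interior M, ∀ v : TangentSpace (𝓡∂ d) x,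
      |differential d ρ x v| ≤ ‖v‖) : LipschitzWith 1 ρ := by
  intro x y
  rw [ENNReal.coe_one, one_mul]
  refine le_of_forall_gt fun r hr => ?_
  rw [IsRiemannianManifold.out (I := 𝓡∂ d)] at hr
  obtain ⟨γ, rfl, rfl, hγ, hl⟩ := exists_lt_of_riemannianEDist_lt hr
  refine lt_of_le_of_lt ?_ hl
  have hc : ContMDiffOn 𝓘(ℝ, ℝ) 𝓘(ℝ, ℝ) 1 (ρ ∘ γ) (Icc 0 1) :=
    (hρ.regular.contMDiff.of_le (by norm_num)).comp_contMDiffOn hγ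
  refine (edist_le_pathELength (I := 𝓘(ℝ, ℝ)) hc zero_le_one).trans ?_
  rw [pathELength_eq_lintegral_mfderiv_Ioo, pathELength_eq_lintegral_mfderiv_Ioo]
  refine setLIntegral_mono' measurableSet_Ioo fun t ht => ?_
  have hγt : MDifferentiableAt 𝓘(ℝ, ℝ) (𝓡∂ d) γ t :=
    (hγ.contMDiffAt (Icc_mem_nhds ht.1 ht.2)).mdifferentiableAt one_ne_zero
  have hρt : MDifferentiableAt (𝓡∂ d) 𝓘(ℝ, ℝ) ρ (γ t) :=
    hρ.regular.contMDiff.mdifferentiableAt (by norm_num)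
  by_cases hint : γ t ∈ (𝓡∂ d).interior M
  · rw [mfderiv_comp t hρt hγt]
    have := h _ hint (mfderiv 𝓘(ℝ, ℝ) (𝓡∂ d) γ t (1 : ℝ))
    rw [enorm_tangentSpace_vectorSpace, ← ofReal_norm]
    exact (ofReal_norm (E := ℝ) _).symm.trans_le (ENNReal.ofReal_le_ofReal this)
  · have h0 : ρ (γ t) = 0 := by
      rw [hρ.eq_zero_iff, ← (𝓡∂ d).compl_interior]; exact hint
    have hmin : IsLocalMin (ρ ∘ γ) t := Eventually.of_forall fun s => by
      simp only [Function.comp_apply, h0]; exact hρ.nonneg _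
    rw [mfderiv_eq_fderiv, hmin.fderiv_eq_zero]
    rw [enorm_tangentSpace_vectorSpace]
    exact (enorm_zero (E := ℝ)).trans_le zero_le

end Interior

/-! ### Short curves directed by -ρ∇ρ. -/

section Curves

variable {d : ℕ} [NeZero d] {M : Type*} [MetricSpace M] [ChartedSpace (EuclideanHalfSpace d) M]
  [IsManifold (𝓡∂ d) ∞ M] [Bundle.RiemannianBundle (fun x : M => TangentSpace (𝓡∂ d) x)]
  {α : ℝ≥0} {ρ : M → ℝ}

omit [IsManifold (𝓡∂ d) ∞ M] in
lemma norm_eq_of_eq {x y : M} (h : x = y) (v : Euc d) :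
    @norm (TangentSpace (𝓡∂ d) x) _ v = @norm (TangentSpace (𝓡∂ d) y) _ v := by
  subst h; rfl

/-- The speed of a curve, in coordinates. -/
lemma norm_mfderiv_sq {c : M} {γ : ℝ → M} {t : ℝ} {σ' : Euc d}
    (hγ : ContinuousAt γ t) (hs : γ t ∈ (extChartAt (𝓡∂ d) c).source)
    (hi : γ t ∈ (𝓡∂ d).interior M)
    (hσ : HasDerivAt (fun s => extChartAt (𝓡∂ d) c (γ s)) σ' t) :
    ‖mfderiv 𝓘(ℝ, ℝ) (𝓡∂ d) γ t (1 : ℝ)‖ ^ 2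
      = quad (coordMatrix (metricForm d M) c (extChartAt (𝓡∂ d) c (γ t))) σ' := by
  have hu := (isInteriorPoint_iff_mem hs).1 hi
  have he : γ =ᶠ[𝓝 t] fun s => (extChartAt (𝓡∂ d) c).symm (extChartAt (𝓡∂ d) c (γ s)) := by
    filter_upwards [hγ.preimage_mem_nhds ((isOpen_extChartAt_source c).mem_nhds hs)] with s hs
    exact ((extChartAt (𝓡∂ d) c).left_inv hs).symm
  have h1 : ‖mfderiv 𝓘(ℝ, ℝ) (𝓡∂ d) γ t (1 : ℝ)‖ = ‖mfderiv 𝓘(ℝ, ℝ) (𝓡∂ d)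
      (fun s => (extChartAt (𝓡∂ d) c).symm (extChartAt (𝓡∂ d) c (γ s))) t (1 : ℝ)‖ := by
    refine (norm_eq_of_eq he.self_of_nhds _).trans ?_
    have h2 : ∀ L L' : ℝ →L[ℝ] TangentSpace (𝓡∂ d)
        ((extChartAt (𝓡∂ d) c).symm (extChartAt (𝓡∂ d) c (γ t))), L = L' → ‖L 1‖ = ‖L' 1‖ := by
      rintro L _ rfl
      rfl
    exact h2 _ _ he.mfderiv_eq
  rw [h1, mfderiv_symm_comp_one hσ hu, quad_coordMatrix]

/-- A bound for the distance between the ends of a curve which is given in coordinates. -/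
lemma edist_symm_le [IsRiemannianManifold (𝓡∂ d) M] {c : M} {σ : ℝ → Euc d} {a b C : ℝ}
    (hab : a ≤ b) (hσ : ContDiff ℝ 1 σ)
    (hmem : ∀ t ∈ Icc a b, σ t ∈ interior (extChartAt (𝓡∂ d) c).target)
    (hC : ∀ t ∈ Ioo a b, ‖chartDeriv c (σ t) (deriv σ t)‖ ≤ C) :
    edist ((extChartAt (𝓡∂ d) c).symm (σ a)) ((extChartAt (𝓡∂ d) c).symm (σ b))
      ≤ ENNReal.ofReal C * ENNReal.ofReal (b - a) := by
  have hγ : ContMDiffOn 𝓘(ℝ, ℝ) (𝓡∂ d) 1 (fun t => (extChartAt (𝓡∂ d) c).symm (σ t))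
      (Icc a b) :=
    (contMDiffOn_extChartAt_symm c).comp hσ.contMDiff.contMDiffOn
      fun t ht => mem_target_of_mem_interior (hmem t ht)
  refine (edist_le_pathELength hγ hab).trans ?_
  rw [pathELength_eq_lintegral_mfderiv_Ioo, ← Real.volume_Ioo, ← setLIntegral_const]
  refine setLIntegral_mono' measurableSet_Ioo fun t ht => ?_
  rw [← ofReal_norm]
  refine ENNReal.ofReal_le_ofReal (le_of_eq_of_le ?_ (hC t ht))
  exact congrArg norm (mfderiv_symm_comp_one ((hσ.differentiable one_ne_zero) t).hasDerivAt
    (hmem t (Ioo_subset_Icc_self ht)))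

omit [NeZero d] in
lemma quad_le_sum_abs (A : Matrix (Fin d) (Fin d) ℝ) (v : Euc d) :
    quad A v ≤ (∑ i, ∑ j, |A i j|) * ‖v‖ ^ 2 := by
  have h : ∀ i, |v i| ≤ ‖v‖ := fun i => PiLp.norm_apply_le v i
  simp only [quad, Finset.sum_mul]
  refine Finset.sum_le_sum fun i _ => Finset.sum_le_sum fun j _ => ?_
  refine (le_abs_self _).trans ?_
  rw [abs_mul, abs_mul, pow_two]
  gcongr
  exacts [h i, h j]

/-- The inverse of a chart is Lipschitz near an interior point. -/
lemma exists_dist_symm_le [IsRiemannianManifold (𝓡∂ d) M]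
    (hg : IsC2HolderForm α (metricForm d M)) {c : M} {u₀ : Euc d}
    (hu₀ : u₀ ∈ interior (extChartAt (𝓡∂ d) c).target) :
    ∃ C : ℝ, 0 < C ∧ ∃ r > 0, ∀ u ∈ Metric.ball u₀ r, ∀ v ∈ Metric.ball u₀ r,
      dist ((extChartAt (𝓡∂ d) c).symm u) ((extChartAt (𝓡∂ d) c).symm v) ≤ C * ‖v - u‖ := by
  set G := coordMatrix (metricForm d M) c with hGdef
  set B := ∑ i, ∑ j, |G u₀ i j| + 1 with hB
  have hB0 : 0 < B := by positivity
  have hcont : ContinuousAt (fun u => ∑ i, ∑ j, |G u i j|) u₀ := by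
    refine tendsto_finsetSum _ fun i _ => tendsto_finsetSum _ fun j _ => ?_
    exact ((hg.contDiffAt hu₀ i j).continuousAt).abs
  have hev : ∀ᶠ u in 𝓝 u₀, ∑ i, ∑ j, |G u i j| < B ∧
      u ∈ interior (extChartAt (𝓡∂ d) c).target :=
    (hcont.eventually_lt_const (by rw [hB]; linarith)).and (isOpen_interior.mem_nhds hu₀)
  obtain ⟨r, hr, hball⟩ := Metric.eventually_nhds_iff_ball.1 hev
  refine ⟨√B, by positivity, r, hr, fun u hu v hv => ?_⟩
  have hline : ContDiff ℝ 1 (fun t : ℝ => u + t • (v - u)) := by fun_prop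
  have hder : ∀ t, deriv (fun t : ℝ => u + t • (v - u)) t = v - u := fun t => by
    have : HasDerivAt (fun t : ℝ => u + t • (v - u)) ((1 : ℝ) • (v - u)) t :=
      ((hasDerivAt_id t).smul_const (v - u)).const_add u
    rw [this.deriv, one_smul]
  have hmem : ∀ t ∈ Icc (0 : ℝ) 1, u + t • (v - u) ∈ Metric.ball u₀ r := fun t ht =>
    (convex_ball u₀ r).add_smul_sub_mem hu hv ht
  have := edist_symm_le (c := c) (C := √B * ‖v - u‖) zero_le_one hline
    (fun t ht => (hball _ (hmem t ht)).2) fun t ht => by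
      rw [hder]
      refine abs_le_of_sq_le_sq' ?_ (by positivity) |>.2
      rw [← quad_coordMatrix, mul_pow, Real.sq_sqrt hB0.le]
      exact (quad_le_sum_abs _ _).trans (mul_le_mul_of_nonneg_right
        (hball _ (hmem t (Ioo_subset_Icc_self ht))).1.le (sq_nonneg _))
  rw [sub_zero, ENNReal.ofReal_one, mul_one, zero_smul, add_zero, one_smul, add_sub_cancel,
    edist_dist] at this
  exact (ENNReal.ofReal_le_ofReal_iff (by positivity)).1 this

/-- The curve issued from `x` which is, in the chart around `x`, a segment directed by `-ρ ∇ρ`. -/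
def pushCurve (ρ : M → ℝ) (x : M) (s : ℝ) : M :=
  (extChartAt (𝓡∂ d) x).symm (extChartAt (𝓡∂ d) x x + s • chartPush ρ x (extChartAt (𝓡∂ d) x x))

omit [IsManifold (𝓡∂ d) ∞ M] in
-- The field vanishes with ρ, so boundary points do not move and no estimate at the boundary is
-- required.
lemma pushCurve_of_eq_zero {x : M} (hx : ρ x = 0) (s : ℝ) :
    pushCurve (d := d) ρ x s = x := by
  have : chartPush ρ x (extChartAt (𝓡∂ d) x x) = 0 := by
    ext k
    rw [chartPush, pushField_apply, Function.comp_apply, extChartAt_to_inv, hx]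
    simp
  rw [pushCurve, this, smul_zero, add_zero, extChartAt_to_inv]

omit [NeZero d] in
lemma hasDerivAt_line (u X : Euc d) (t : ℝ) : HasDerivAt (fun s : ℝ => u + s • X) X t := by
  simpa using ((hasDerivAt_id t).smul_const X).const_add u

omit [NeZero d] in
lemma tendsto_line (u X : Euc d) : Tendsto (fun s : ℝ => u + s • X) (𝓝 0) (𝓝 u) := by
  simpa [ContinuousAt] using (hasDerivAt_line u X 0).continuousAt

/-- The initial speed is ρ|∇ρ| ≤ ρ, and by continuity the speed stays below ρ + c for a short time.
-/
lemma dist_pushCurve_le [IsRiemannianManifold (𝓡∂ d) M]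
    (hg : IsC2HolderForm α (metricForm d M)) (hρ : IsDefiningFunction d α ρ) {x : M}
    (hx : x ∈ (𝓡∂ d).interior M)
    (hgr : gradSq (coordMatrix (metricForm d M) x) (ρ ∘ (extChartAt (𝓡∂ d) x).symm)
      (extChartAt (𝓡∂ d) x x) ≤ 1) {c : ℝ} (hc : 0 < c) :
    ∀ᶠ s in 𝓝[>] (0 : ℝ), dist x (pushCurve (d := d) ρ x s) ≤ (ρ x + c) * s := by
  have hu := (isInteriorPoint_iff_mem (mem_extChartAt_source x)).1 hx
  set u := extChartAt (𝓡∂ d) x x with hudef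
  set X := chartPush ρ x u with hX
  have hρx := (hρ.pos_iff x).2 hx
  have hq : ContinuousAt (fun w => quad (coordMatrix (metricForm d M) x w) X) u := by
    refine tendsto_finsetSum _ fun i _ => tendsto_finsetSum _ fun j _ => ?_
    exact (hg.contDiffAt hu i j).continuousAt.mul_const _
  have hq0 : quad (coordMatrix (metricForm d M) x u) X < (ρ x + c) ^ 2 := by
    have h1 := (norm_chartPush_le hρ hu hgr).trans_eq (congrArg ρ (extChartAt_to_inv x))
    rw [quad_coordMatrix]
    exact pow_lt_pow_left₀ (h1.trans_lt (lt_add_of_pos_right _ hc)) (norm_nonneg _) two_ne_zero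
  have hev : ∀ᶠ s in 𝓝 (0 : ℝ), quad (coordMatrix (metricForm d M) x (u + s • X)) X < (ρ x + c) ^ 2
      ∧ u + s • X ∈ interior (extChartAt (𝓡∂ d) x).target :=
    (tendsto_line u X).eventually ((hq.eventually_lt_const hq0).and (isOpen_interior.mem_nhds hu))
  obtain ⟨δ, hδ, hball⟩ := Metric.eventually_nhds_iff_ball.1 hev
  filter_upwards [Ioo_mem_nhdsGT hδ] with s hs
  have hsub : ∀ t ∈ Icc 0 s, t ∈ Metric.ball (0 : ℝ) δ := fun t ht => by
    rw [Metric.mem_ball, dist_zero_right, Real.norm_eq_abs, abs_of_nonneg ht.1]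
    exact ht.2.trans_lt hs.2
  have := edist_symm_le (c := x) (σ := fun t : ℝ => u + t • X) (C := ρ x + c) hs.1.le (by fun_prop)
    (fun t ht => (hball t (hsub t ht)).2) fun t ht => by
      rw [(hasDerivAt_line u X t).deriv]
      refine abs_le_of_sq_le_sq' ?_ (by positivity) |>.2
      rw [← quad_coordMatrix]
      exact (hball t (hsub t (Ioo_subset_Icc_self ht))).1.le
  rw [zero_smul, add_zero, hudef, extChartAt_to_inv, sub_zero, ← ENNReal.ofReal_mul (by positivity),
    edist_dist] at this
  exact (ENNReal.ofReal_le_ofReal_iff (mul_nonneg (by positivity) hs.1.le)).1 this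

/-- The derivative of ρ along the curve at time 0 is -ρ|∇ρ|². -/
lemma rho_pushCurve_le (hρ : IsDefiningFunction d α ρ) {x : M}
    (hx : x ∈ (𝓡∂ d).interior M) {b : ℝ}
    (hgr : b ≤ gradSq (coordMatrix (metricForm d M) x) (ρ ∘ (extChartAt (𝓡∂ d) x).symm)
      (extChartAt (𝓡∂ d) x x)) {c : ℝ} (hc : 0 < c) :
    ∀ᶠ s in 𝓝[>] (0 : ℝ), ρ (pushCurve (d := d) ρ x s) ≤ ρ x - (b * ρ x - c) * s := by
  have hu := (isInteriorPoint_iff_mem (mem_extChartAt_source x)).1 hx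
  set u := extChartAt (𝓡∂ d) x x with hudef
  set X := chartPush ρ x u with hX
  have hρx := (hρ.pos_iff x).2 hx
  have h1 : HasFDerivAt (ρ ∘ (extChartAt (𝓡∂ d) x).symm)
      (fderiv ℝ (ρ ∘ (extChartAt (𝓡∂ d) x).symm) u) (u + (0 : ℝ) • X) := by
    rw [zero_smul, add_zero]
    exact ((hρ.regular.contDiffAt hu).differentiableAt (by norm_num)).hasFDerivAt
  have h2 := h1.comp_hasDerivAt 0 (hasDerivAt_line u X 0)
  have h4 : (ρ ∘ (extChartAt (𝓡∂ d) x).symm) u = ρ x := by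
    rw [Function.comp_apply, extChartAt_to_inv]
  rw [hX, chartPush, fderiv_pushField, h4] at h2
  have h3 := (hasDerivAt_iff_isLittleO.1 h2).def hc
  rw [← nhdsWithin_univ] at h3
  filter_upwards [nhdsWithin_mono 0 (subset_univ (Ioi (0 : ℝ))) h3, self_mem_nhdsWithin] with s hs hs0
  have hs0 : 0 < s := hs0
  have h5 : ρ (pushCurve (d := d) ρ x s) = ((ρ ∘ (extChartAt (𝓡∂ d) x).symm) ∘ fun s : ℝ =>
    u + s • pushField (coordMatrix (metricForm d M) x) (ρ ∘ (extChartAt (𝓡∂ d) x).symm) u) s := rfl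
  have h6 : ((ρ ∘ (extChartAt (𝓡∂ d) x).symm) ∘ fun s : ℝ => u + s • pushField
      (coordMatrix (metricForm d M) x) (ρ ∘ (extChartAt (𝓡∂ d) x).symm) u) 0
      = (ρ ∘ (extChartAt (𝓡∂ d) x).symm) u := by
    rw [Function.comp_apply, zero_smul, add_zero]
  rw [h6, sub_zero] at hs
  rw [← h5, h4, Real.norm_eq_abs, Real.norm_eq_abs, abs_of_pos hs0] at hs
  have h6 := (abs_le.1 hs).2
  rw [smul_eq_mul] at h6
  nlinarith [mul_le_mul_of_nonneg_left hgr (mul_nonneg hs0.le hρx.le)]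

end Curves

/-! ### Comparison of the push in different charts. -/

section Push

variable {d : ℕ} [NeZero d] {M : Type*} [MetricSpace M] [ChartedSpace (EuclideanHalfSpace d) M]
  [IsManifold (𝓡∂ d) ∞ M] [Bundle.RiemannianBundle (fun x : M => TangentSpace (𝓡∂ d) x)]
  {α : ℝ≥0} {ρ : M → ℝ}

/-- The vector field `-ρ ∇ρ` does not depend on the chart. -/
lemma mfderiv_extChartAt_chartPush (hρ : IsDefiningFunction d α ρ) {c c' : M} {v : Euc d}
    (hv : v ∈ interior (extChartAt (𝓡∂ d) c).target)
    (hc : (extChartAt (𝓡∂ d) c).symm v ∈ (extChartAt (𝓡∂ d) c').source) :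
    mfderiv (𝓡∂ d) 𝓘(ℝ, Euc d) (extChartAt (𝓡∂ d) c') ((extChartAt (𝓡∂ d) c).symm v)
      (chartDeriv c v (chartPush ρ c v))
      = chartPush ρ c' (extChartAt (𝓡∂ d) c' ((extChartAt (𝓡∂ d) c).symm v)) := by
  have key : ∀ y : M, y ∈ (𝓡∂ d).interior M → y ∈ (extChartAt (𝓡∂ d) c').source →
      ∃ V : TangentSpace (𝓡∂ d) y, mfderiv (𝓡∂ d) 𝓘(ℝ, Euc d) (extChartAt (𝓡∂ d) c') y V
        = chartPush ρ c' (extChartAt (𝓡∂ d) c' y) ∧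
        ∀ w : TangentSpace (𝓡∂ d) y, inner ℝ V w = -(ρ y * differential d ρ y w) := by
    intro y hyi hys
    obtain ⟨u', hu', rfl⟩ : ∃ u' ∈ interior (extChartAt (𝓡∂ d) c').target,
        (extChartAt (𝓡∂ d) c').symm u' = y :=
      ⟨_, (isInteriorPoint_iff_mem hys).1 hyi, (extChartAt (𝓡∂ d) c').left_inv hys⟩
    refine ⟨chartDeriv c' u' (chartPush ρ c' u'), ?_, fun w => ?_⟩
    · rw [(extChartAt (𝓡∂ d) c').right_inv (interior_subset hu')]
      exact DFunLike.congr_fun (mfderiv_extChartAt_comp_mfderivWithin_extChartAt_symm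
        (I := 𝓡∂ d) (interior_subset hu')) (chartPush ρ c' u')
    · obtain ⟨w, rfl⟩ := (chartDeriv_isInvertible (interior_subset hu')).surjective w
      exact inner_chartPush hρ hu' w
  obtain ⟨V, hV, hVw⟩ := key _ (symm_mem_interior hv) hc
  have : chartDeriv c v (chartPush ρ c v) = V := by
    refine ext_inner_right ℝ fun w => ?_
    rw [hVw]
    obtain ⟨w, rfl⟩ := (chartDeriv_isInvertible (interior_subset hv)).surjective w
    exact inner_chartPush hρ hv w
  rw [this, hV]

/-- The map which is `u ↦ u - s ρ ∇ρ` in the chart around `z`. -/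
def chartFlow (ρ : M → ℝ) (z : M) (s : ℝ) (x : M) : M :=
  (extChartAt (𝓡∂ d) z).symm (extChartAt (𝓡∂ d) z x + s • chartPush ρ z (extChartAt (𝓡∂ d) z x))

/-- The curves `pushCurve` and `chartFlow` have the same velocity at the initial point. -/
lemma eventually_dist_pushCurve_le [IsRiemannianManifold (𝓡∂ d) M]
    (hg : IsC2HolderForm α (metricForm d M)) (hρ : IsDefiningFunction d α ρ) {z x : M}
    (hx : x ∈ (𝓡∂ d).interior M) (hxz : x ∈ (extChartAt (𝓡∂ d) z).source) {c : ℝ} (hc : 0 < c) :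
    ∀ᶠ s in 𝓝[>] (0 : ℝ), dist (pushCurve (d := d) ρ x s) (chartFlow (d := d) ρ z s x) ≤ c * s := by
  have hu := (isInteriorPoint_iff_mem (mem_extChartAt_source x)).1 hx
  have hv := (isInteriorPoint_iff_mem hxz).1 hx
  have hvx : (extChartAt (𝓡∂ d) z).symm (extChartAt (𝓡∂ d) z x) = x :=
    (extChartAt (𝓡∂ d) z).left_inv hxz
  obtain ⟨C, hC, r, hr, hL⟩ := exists_dist_symm_le hg hu
  set v := extChartAt (𝓡∂ d) z x with hvdef
  set u := extChartAt (𝓡∂ d) x x with hudef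
  set Y := chartPush ρ z v with hY
  set X := chartPush ρ x u with hX
  set a : ℝ → Euc d := fun s => extChartAt (𝓡∂ d) x ((extChartAt (𝓡∂ d) z).symm (v + s • Y)) with ha
  have hsrc : (extChartAt (𝓡∂ d) z).symm v ∈ (extChartAt (𝓡∂ d) x).source := by
    rw [hvx]; exact mem_extChartAt_source x
  -- The change of charts sends the field in the chart of z to the field in the chart of x. Both
  -- curves thus have the same velocity at time 0, and differ by o(s).
  obtain ⟨T, hT, hTY⟩ : ∃ T : Euc d →L[ℝ] Euc d, HasFDerivAt
      (fun w => extChartAt (𝓡∂ d) x ((extChartAt (𝓡∂ d) z).symm w)) T v ∧ T Y = X := by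
    refine ⟨(mfderiv (𝓡∂ d) 𝓘(ℝ, Euc d) (extChartAt (𝓡∂ d) x)
      ((extChartAt (𝓡∂ d) z).symm v)).comp (chartDeriv z v),
      ((mdifferentiableAt_extChartAt (by rwa [extChartAt_source] at hsrc)).hasMFDerivAt.comp v
      (hasMFDerivAt_symm hv)).hasFDerivAt, (mfderiv_extChartAt_chartPush hρ hv hsrc).trans ?_⟩
    rw [hvx]
  have ha0 : a 0 = u := by simp only [ha, zero_smul, add_zero, hvx, hudef]
  have hda : HasDerivAt a X 0 := by
    rw [← hTY]
    exact HasFDerivAt.comp_hasDerivAt (0 : ℝ) (by rwa [zero_smul, add_zero])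
      (hasDerivAt_line v Y 0)
  have hlo := (hasDerivAt_iff_isLittleO.1 hda).def (show 0 < c / C by positivity)
  rw [ha0] at hlo
  have hcont : ContinuousAt (fun s : ℝ => (extChartAt (𝓡∂ d) z).symm (v + s • Y)) 0 := by
    refine ContinuousAt.comp (g := (extChartAt (𝓡∂ d) z).symm) ?_ (hasDerivAt_line v Y 0).continuousAt
    simpa using (hasMFDerivAt_symm hv).continuousAt
  have e1 : ∀ᶠ s in 𝓝 (0 : ℝ), (extChartAt (𝓡∂ d) z).symm (v + s • Y)
      ∈ (extChartAt (𝓡∂ d) x).source := by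
    refine hcont.eventually_mem ((isOpen_extChartAt_source x).mem_nhds ?_)
    simpa using hsrc
  have e2 : ∀ᶠ s in 𝓝 (0 : ℝ), a s ∈ Metric.ball u r := by
    refine hda.continuousAt.eventually_mem ?_
    rw [ha0]; exact Metric.ball_mem_nhds _ hr
  have e3 : ∀ᶠ s in 𝓝 (0 : ℝ), u + s • X ∈ Metric.ball u r :=
    (tendsto_line u X).eventually_mem (Metric.ball_mem_nhds _ hr)
  rw [← nhdsWithin_univ] at e1 e2 e3 hlo
  have hm : 𝓝[>] (0 : ℝ) ≤ 𝓝[univ] 0 := nhdsWithin_mono 0 (subset_univ _)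
  filter_upwards [hm e1, hm e2, hm e3, hm hlo, self_mem_nhdsWithin] with s h1 h2 h3 h4 hs
  have hs : 0 < s := hs
  have h5 : chartFlow (d := d) ρ z s x = (extChartAt (𝓡∂ d) x).symm (a s) :=
    ((extChartAt (𝓡∂ d) x).left_inv h1).symm
  have h6 : pushCurve (d := d) ρ x s = (extChartAt (𝓡∂ d) x).symm (u + s • X) := rfl
  rw [h5, h6]
  refine (hL _ h3 _ h2).trans ?_
  rw [sub_zero, Real.norm_eq_abs, abs_of_pos hs] at h4
  calc C * ‖a s - (u + s • X)‖ = C * ‖a s - u - s • X‖ := by rw [sub_sub]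
    _ ≤ C * (c / C * s) := by gcongr
    _ = c * s := by field_simp

end Push

/-! ### Nonexpansion of the weighted distance. -/

section Contraction

variable {d : ℕ} [NeZero d] {M : Type*} [MetricSpace M] [ChartedSpace (EuclideanHalfSpace d) M]
  [IsManifold (𝓡∂ d) ∞ M] [Bundle.RiemannianBundle (fun x : M => TangentSpace (𝓡∂ d) x)]
  {α : ℝ≥0} {ρ : M → ℝ} {κ : ℝ}

omit [IsManifold (𝓡∂ d) ∞ M] in
lemma rpowWeight_mul_enorm_le {x y : M} {v : TangentSpace (𝓡∂ d) x} {w : TangentSpace (𝓡∂ d) y}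
    (hρ0 : ∀ x, 0 ≤ ρ x)
    (h : (1 + ρ x) ^ (2 * κ) * ‖v‖ ^ 2 ≤ (1 + ρ y) ^ (2 * κ) * ‖w‖ ^ 2) :
    (rpowWeight ρ κ x : ℝ≥0∞) * ‖v‖ₑ ≤ rpowWeight ρ κ y * ‖w‖ₑ := by
  have hsq : ∀ x, (1 + ρ x) ^ (2 * κ) = ((1 + ρ x) ^ κ) ^ 2 := fun x => by
    rw [← Real.rpow_natCast, ← Real.rpow_mul (by linarith [hρ0 x]), mul_comm]
    norm_num
  have hnn : ∀ x, 0 ≤ (1 + ρ x) ^ κ := fun x => Real.rpow_nonneg (by linarith [hρ0 x]) _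
  rw [hsq, hsq, ← mul_pow, ← mul_pow] at h
  have h2 := (abs_le_of_sq_le_sq' h (mul_nonneg (hnn y) (norm_nonneg w))).2
  have e : ∀ x, ∀ v : TangentSpace (𝓡∂ d) x, (rpowWeight ρ κ x : ℝ≥0∞) * ‖v‖ₑ
      = ENNReal.ofReal ((1 + ρ x) ^ κ * ‖v‖) := fun x v => by
    rw [ENNReal.ofReal_mul (hnn x), ofReal_norm]; rfl
  rw [e, e]
  exact ENNReal.ofReal_le_ofReal h2

/-- The flow of `-ρ ∇ρ` in a chart does not increase the weighted lengths of the curves. -/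
lemma wLength_chartFlow_le (hρ : IsDefiningFunction d α ρ) {z : M} {s : ℝ} {N : Set (Euc d)}
    (hN : ∀ u ∈ N, u ∈ interior (extChartAt (𝓡∂ d) z).target ∧
      u + s • chartPush ρ z u ∈ interior (extChartAt (𝓡∂ d) z).target ∧
      ContDiffAt ℝ 1 (chartPush ρ z) u ∧ ∀ v : Euc d,
      weightSq κ (ρ ∘ (extChartAt (𝓡∂ d) z).symm) (u + s • chartPush ρ z u)
          * quad (coordMatrix (metricForm d M) z (u + s • chartPush ρ z u))
            (v + s • fderiv ℝ (chartPush ρ z) u v)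
        ≤ weightSq κ (ρ ∘ (extChartAt (𝓡∂ d) z).symm) u
          * quad (coordMatrix (metricForm d M) z u) v)
    {γ : ℝ → M} (hγ : ContMDiffOn 𝓘(ℝ, ℝ) (𝓡∂ d) 1 γ (Icc 0 1))
    (hγs : ∀ t ∈ Icc (0 : ℝ) 1, γ t ∈ (extChartAt (𝓡∂ d) z).source)
    (hγN : ∀ t ∈ Icc (0 : ℝ) 1, extChartAt (𝓡∂ d) z (γ t) ∈ N) :
    ContMDiffOn 𝓘(ℝ, ℝ) (𝓡∂ d) 1 (fun t => chartFlow (d := d) ρ z s (γ t)) (Icc 0 1) ∧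
    wLength (𝓡∂ d) (rpowWeight ρ κ) (fun t => chartFlow (d := d) ρ z s (γ t)) 0 1
      ≤ wLength (𝓡∂ d) (rpowWeight ρ κ) γ 0 1 := by
  have hσ : ContMDiffOn 𝓘(ℝ, ℝ) 𝓘(ℝ, Euc d) 1 (fun t => extChartAt (𝓡∂ d) z (γ t)) (Icc 0 1) :=
    (contMDiffOn_extChartAt (n := 1)).comp hγ fun t ht =>
      (by simpa only [extChartAt_source] using hγs t ht : γ t ∈ (chartAt _ z).source)
  have hP : ContMDiffOn 𝓘(ℝ, Euc d) 𝓘(ℝ, Euc d) 1 (fun u => u + s • chartPush ρ z u) N :=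
    ContDiffOn.contMDiffOn fun u hu =>
      ContDiffWithinAt.add contDiffWithinAt_id
        ((hN u hu).2.2.1.contDiffWithinAt.const_smul s)
  have hΓ : ContMDiffOn 𝓘(ℝ, ℝ) (𝓡∂ d) 1 (fun t => chartFlow (d := d) ρ z s (γ t)) (Icc 0 1) :=
    (contMDiffOn_extChartAt_symm z).comp (hP.comp hσ hγN) fun t ht =>
      mem_target_of_mem_interior (hN _ (hγN t ht)).2.1
  refine ⟨hΓ, ?_⟩
  rw [wLength_eq_Ioo, wLength_eq_Ioo]
  refine setLIntegral_mono' measurableSet_Ioo fun t ht => ?_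
  have htI := Ioo_subset_Icc_self ht
  have hnhds := Icc_mem_nhds ht.1 ht.2
  obtain ⟨h1, h2, h3, h4⟩ := hN _ (hγN t htI)
  obtain ⟨σ', hσ'⟩ := hasDerivAt_extChartAt_comp
    ((hγ.contMDiffAt hnhds).mdifferentiableAt one_ne_zero) (hγs t htI)
  have hγt := (hγ.contMDiffAt hnhds).continuousAt
  have hint : γ t ∈ (𝓡∂ d).interior M := (isInteriorPoint_iff_mem (hγs t htI)).2 h1
  have e1 := norm_mfderiv_sq hγt (hγs t htI) hint hσ'
  have hX := (h3.differentiableAt one_ne_zero).hasFDerivAt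
  have hτ : HasDerivAt (fun r => extChartAt (𝓡∂ d) z (γ r)
      + s • chartPush ρ z (extChartAt (𝓡∂ d) z (γ r)))
      (σ' + s • fderiv ℝ (chartPush ρ z) (extChartAt (𝓡∂ d) z (γ t)) σ') t :=
    hσ'.add ((hX.comp_hasDerivAt t hσ').const_smul s)
  have e2 : ‖mfderiv 𝓘(ℝ, ℝ) (𝓡∂ d) (fun t => chartFlow (d := d) ρ z s (γ t)) t (1 : ℝ)‖ ^ 2 = _ :=
    (congrArg (fun v => ‖v‖ ^ 2) (mfderiv_symm_comp_one (c := z) hτ h2)).trans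
      (quad_coordMatrix z _ _).symm
  refine rpowWeight_mul_enorm_le hρ.nonneg ?_
  refine (congrArg _ e2).trans_le ((h4 σ').trans_eq (Eq.trans ?_ (congrArg _ e1.symm)))
  rw [weightSq, Function.comp_apply, (extChartAt (𝓡∂ d) z).left_inv (hγs t htI)]

/-- Nearby points are joined by curves of almost minimal weighted length, and `wLength_chartFlow_le`
bounds the lengths of their images. The neighbourhood is small in both distances: a curve of
weighted length below 2r/3 starting in the ball of radius r/3 cannot leave the ball of radius r
where the infinitesimal estimate holds. -/
lemma exists_wDist_chartFlow_le [IsRiemannianManifold (𝓡∂ d) M]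
    (hg : IsC2HolderForm α (metricForm d M)) (hρ : IsDefiningFunction d α ρ)
    (hLip : LipschitzWith 1 ρ) (hκ0 : 0 ≤ κ) (hκ1 : κ ≤ 1) {z : M}
    (hz : z ∈ (𝓡∂ d).interior M)
    (hpos : ∀ v : Euc d, v ≠ 0 → 0 < κ / (1 + ρ z)
      * gradSq (coordMatrix (metricForm d M) z) (ρ ∘ (extChartAt (𝓡∂ d) z).symm)
          (extChartAt (𝓡∂ d) z z)
        * quad (coordMatrix (metricForm d M) z (extChartAt (𝓡∂ d) z z)) v
      + ∑ i, ∑ j, hess (coordMatrix (metricForm d M) z) (ρ ∘ (extChartAt (𝓡∂ d) z).symm)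
          (extChartAt (𝓡∂ d) z z) i j * (v i * v j)) :
    ∃ s₁ > (0 : ℝ), ∃ U ∈ 𝓝 z, (∀ x ∈ U, x ∈ (𝓡∂ d).interior M ∧
        x ∈ (extChartAt (𝓡∂ d) z).source) ∧
      ∀ s ∈ Icc 0 s₁, ∀ x ∈ U, ∀ x' ∈ U,
        wDist (𝓡∂ d) ρ κ (chartFlow (d := d) ρ z s x) (chartFlow (d := d) ρ z s x')
          ≤ wDist (𝓡∂ d) ρ κ x x' := by
  have hu := (isInteriorPoint_iff_mem (mem_extChartAt_source z)).1 hz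
  set u₀ := extChartAt (𝓡∂ d) z z with hu₀
  have hr0 : (ρ ∘ (extChartAt (𝓡∂ d) z).symm) u₀ = ρ z := by
    rw [Function.comp_apply, extChartAt_to_inv]
  obtain ⟨s₀, hs₀, hev⟩ := eventually_quad_pushField_le (κ := κ) (coordMatrix_symm z)
    (fun i j => hg.contDiffAt hu i j) (coordMatrix_det_ne_zero (interior_subset hu))
    (hρ.regular.contDiffAt hu) (by rw [hr0]; exact (hρ.pos_iff z).2 hz) (by rw [hr0]; exact hpos)
  have hXc := contDiffAt_chartPush hg hρ hu
  have hcont : ContinuousAt (fun q : Euc d × ℝ => q.1 + q.2 • chartPush ρ z q.1) (u₀, 0) := by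
    have h1 : ContinuousAt (fun q : Euc d × ℝ => chartPush ρ z q.1) (u₀, 0) :=
      ContinuousAt.comp (g := chartPush ρ z) hXc.continuousAt continuousAt_fst
    exact continuousAt_fst.add (continuousAt_snd.smul h1)
  have hmem : ∀ᶠ q : Euc d × ℝ in 𝓝 u₀ ×ˢ 𝓝 0,
      q.1 + q.2 • chartPush ρ z q.1 ∈ interior (extChartAt (𝓡∂ d) z).target := by
    rw [← nhds_prod_eq]
    refine hcont.eventually_mem (isOpen_interior.mem_nhds ?_)
    simpa using hu
  obtain ⟨P, hP, Q, hQ, hPQ⟩ := eventually_prod_iff.1 hmem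
  obtain ⟨δ, hδ, hball⟩ := Metric.eventually_nhds_iff_ball.1 hQ
  set s₁ := min s₀ (δ / 2) with hs₁
  have hs₁0 : 0 < s₁ := by positivity
  have hNev : ∀ᶠ x in 𝓝 z, x ∈ (extChartAt (𝓡∂ d) z).source ∧
      extChartAt (𝓡∂ d) z x ∈ interior (extChartAt (𝓡∂ d) z).target ∧
      P (extChartAt (𝓡∂ d) z x) ∧ ∀ s ∈ Icc 0 s₀, ∀ v : Euc d,
      weightSq κ (ρ ∘ (extChartAt (𝓡∂ d) z).symm)
          (extChartAt (𝓡∂ d) z x + s • chartPush ρ z (extChartAt (𝓡∂ d) z x))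
          * quad (coordMatrix (metricForm d M) z
            (extChartAt (𝓡∂ d) z x + s • chartPush ρ z (extChartAt (𝓡∂ d) z x)))
            (v + s • fderiv ℝ (chartPush ρ z) (extChartAt (𝓡∂ d) z x) v)
        ≤ weightSq κ (ρ ∘ (extChartAt (𝓡∂ d) z).symm) (extChartAt (𝓡∂ d) z x)
          * quad (coordMatrix (metricForm d M) z (extChartAt (𝓡∂ d) z x)) v := by
    refine Eventually.and (extChartAt_source_mem_nhds (I := 𝓡∂ d) z) ?_
    exact (continuousAt_extChartAt (I := 𝓡∂ d) z).eventually
      ((isOpen_interior.eventually_mem hu).and (hP.and hev))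
  obtain ⟨r, hr, hrW⟩ := Metric.eventually_nhds_iff_ball.1 hNev
  have hw := isWeightedLengthDist_wDist (I := 𝓡∂ d) hρ.nonneg hLip hκ0 hκ1
  refine ⟨s₁, hs₁0, Metric.ball z (r / 3) ∩ {x | wDist (𝓡∂ d) ρ κ z x < r / 3}, inter_mem
    (Metric.ball_mem_nhds _ (by positivity)) (((hw.continuous z).tendsto z).eventually_lt_const
      (by rw [hw.self]; positivity)), fun x hx => ?_, fun s hs x hx x' hx' => ?_⟩
  · obtain ⟨h1, h2, -⟩ := hrW x (Metric.ball_subset_ball (by linarith) hx.1)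
    exact ⟨(isInteriorPoint_iff_mem h1).2 h2, h1⟩
  have hxx' : wDist (𝓡∂ d) ρ κ x x' < 2 * r / 3 := by
    have h1 := hw.triangle x z x'
    have h2 : wDist (𝓡∂ d) ρ κ z x < r / 3 := hx.2
    have h3 : wDist (𝓡∂ d) ρ κ z x' < r / 3 := hx'.2
    rw [hw.symm x z] at h1
    linarith
  refine le_of_forall_gt_imp_ge_of_dense fun b hb => ?_
  wlog hbr : b < 2 * r / 3 generalizing b
  · obtain ⟨b', hb1, hb2⟩ := exists_between hxx'
    exact (this b' hb1 hb2).trans (hb2.le.trans (not_lt.1 hbr))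
  have hb0 : 0 ≤ b := (hw.nonneg x x').trans hb.le
  have hlt : wEDist (𝓡∂ d) (rpowWeight ρ κ) x x' < ENNReal.ofReal b := by
    rw [wEDist_eq_ofReal hρ.nonneg hLip hκ0]
    exact (ENNReal.ofReal_lt_ofReal_iff_of_nonneg (hw.nonneg _ _)).2 hb
  obtain ⟨γ, rfl, rfl, hγ, hl⟩ := exists_wLength_lt hlt
  have hγb : ∀ t ∈ Icc (0 : ℝ) 1, γ t ∈ Metric.ball z r := by
    intro t ht
    have h1 := ((edist_le_pathELength_of_mem hγ ht).trans (pathELength_le_wLength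
      (one_le_rpowWeight hρ.nonneg hκ0) γ 0 1)).trans hl.le
    rw [edist_dist] at h1
    have h2 := (ENNReal.ofReal_le_ofReal_iff hb0).1 h1
    have h3 : dist (γ 0) z < r / 3 := hx.1
    have h4 := dist_triangle_left (γ t) z (γ 0)
    rw [Metric.mem_ball]
    linarith
  obtain ⟨hΓ, hlen⟩ := wLength_chartFlow_le (κ := κ) (s := s) hρ
    (N := {u | u ∈ interior (extChartAt (𝓡∂ d) z).target ∧
      u + s • chartPush ρ z u ∈ interior (extChartAt (𝓡∂ d) z).target ∧
      ContDiffAt ℝ 1 (chartPush ρ z) u ∧ ∀ v : Euc d,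
      weightSq κ (ρ ∘ (extChartAt (𝓡∂ d) z).symm) (u + s • chartPush ρ z u)
          * quad (coordMatrix (metricForm d M) z (u + s • chartPush ρ z u))
            (v + s • fderiv ℝ (chartPush ρ z) u v)
        ≤ weightSq κ (ρ ∘ (extChartAt (𝓡∂ d) z).symm) u
          * quad (coordMatrix (metricForm d M) z u) v}) (fun u hu => hu) hγ
    (fun t ht => (hrW _ (hγb t ht)).1) fun t ht => by
      obtain ⟨-, h2, h3, h4⟩ := hrW _ (hγb t ht)
      refine ⟨h2, hPQ h3 (hball s ?_), contDiffAt_chartPush hg hρ h2,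
        h4 s ⟨hs.1, hs.2.trans (min_le_left _ _)⟩⟩
      rw [Metric.mem_ball, dist_zero_right, Real.norm_eq_abs, abs_of_nonneg hs.1]
      linarith [hs.2.trans (min_le_right _ _)]
  have := ((wEDist_le_wLength hΓ zero_le_one).trans hlen).trans hl.le
  rw [wEDist_eq_ofReal hρ.nonneg hLip hκ0] at this
  exact (ENNReal.ofReal_le_ofReal_iff hb0).1 this

/-- The curves `pushCurve` form a push in the sense of `IsPush`. -/
theorem isPush_pushCurve [IsRiemannianManifold (𝓡∂ d) M]
    (hg : IsC2HolderForm α (metricForm d M)) (hρ : IsDefiningFunction d α ρ)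
    (hLip : LipschitzWith 1 ρ) (hκ0 : 0 ≤ κ) (hκ1 : κ ≤ 1) {p : M} {R₀ : ℝ}
    (hgr : ∀ x ∈ (𝓡∂ d).interior M, gradSq (coordMatrix (metricForm d M) x)
      (ρ ∘ (extChartAt (𝓡∂ d) x).symm) (extChartAt (𝓡∂ d) x x) ≤ 1)
    (hgood : ∀ x ∈ (𝓡∂ d).interior M, R₀ < dist x p →
      85 / 100 ≤ gradSq (coordMatrix (metricForm d M) x) (ρ ∘ (extChartAt (𝓡∂ d) x).symm)
        (extChartAt (𝓡∂ d) x x) ∧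
      ∀ v : Euc d, v ≠ 0 → 0 < κ / (1 + ρ x)
      * gradSq (coordMatrix (metricForm d M) x) (ρ ∘ (extChartAt (𝓡∂ d) x).symm)
          (extChartAt (𝓡∂ d) x x)
        * quad (coordMatrix (metricForm d M) x (extChartAt (𝓡∂ d) x x)) v
      + ∑ i, ∑ j, hess (coordMatrix (metricForm d M) x) (ρ ∘ (extChartAt (𝓡∂ d) x).symm)
          (extChartAt (𝓡∂ d) x x) i j * (v i * v j)) :
    IsPush ρ (wDist (𝓡∂ d) ρ κ) p R₀ (pushCurve (d := d) ρ) := by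
  have hw := isWeightedLengthDist_wDist (I := 𝓡∂ d) hρ.nonneg hLip hκ0 hκ1
  have hdist : ∀ x, ∀ c > 0, ∀ᶠ s in 𝓝[>] (0 : ℝ),
      dist x (pushCurve (d := d) ρ x s) ≤ (ρ x + c) * s := by
    intro x c hc
    by_cases hx : x ∈ (𝓡∂ d).interior M
    · exact dist_pushCurve_le hg hρ hx (hgr x hx) hc
    · have h0 : ρ x = 0 := by
        rw [hρ.eq_zero_iff, ← (𝓡∂ d).compl_interior]; exact hx
      filter_upwards [self_mem_nhdsWithin] with s hs
      have hs : 0 < s := hs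
      rw [pushCurve_of_eq_zero h0, dist_self, h0]
      positivity
  refine ⟨hdist, fun x hx hx0 c hc => ?_, fun z hz hz0 => ?_⟩
  · have hxi := (hρ.pos_iff x).1 hx0
    exact rho_pushCurve_le hρ hxi (hgood x hxi hx).1 hc
  · have hzi := (hρ.pos_iff z).1 hz0
    obtain ⟨s₁, hs₁, U, hU, hUi, hUs⟩ := exists_wDist_chartFlow_le hg hρ hLip hκ0 hκ1 hzi
      (hgood z hzi hz).2
    -- `pushCurve` uses a different chart for each point, whereas contraction is known for the
    -- single map `chartFlow`. The two agree to first order, also for the weighted distance, since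
    -- the weight is locally bounded.
    have hnear : ∀ x ∈ U, ∀ c > 0, ∀ᶠ s in 𝓝[>] (0 : ℝ),
        wDist (𝓡∂ d) ρ κ (pushCurve (d := d) ρ x s) (chartFlow (d := d) ρ z s x) ≤ c * s := by
      intro x hx c hc
      have hρx := hρ.nonneg x
      filter_upwards [eventually_dist_pushCurve_le hg hρ (hUi x hx).1 (hUi x hx).2
        (show 0 < c / (ρ x + 3) by positivity), hdist x 1 one_pos,
        eventually_lt_small (a := ρ x + 1) one_pos, eventually_lt_small (a := c / (ρ x + 3)) one_pos]
        with s h1 h2 h3 h4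
      refine (hw.le_mul_dist _ _).trans ?_
      have h5 := hLip.dist_le_mul (pushCurve (d := d) ρ x s) x
      rw [Real.dist_eq, NNReal.coe_one, one_mul, dist_comm] at h5
      have h6 := (abs_le.1 h5).2
      calc _ ≤ (ρ x + 3) * (c / (ρ x + 3) * s) :=
            mul_le_mul (by linarith) h1 dist_nonneg (by positivity)
        _ = c * s := by field_simp
    refine ⟨U, hU, fun x hx x' hx' c hc => ?_⟩
    filter_upwards [hnear x hx (c / 2) (by positivity), hnear x' hx' (c / 2) (by positivity),
      Ioo_mem_nhdsGT hs₁] with s h1 h2 hs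
    have h3 := hUs s (Ioo_subset_Icc_self hs) x hx x' hx'
    have h4 := hw.triangle (pushCurve (d := d) ρ x s) (chartFlow (d := d) ρ z s x)
      (pushCurve (d := d) ρ x' s)
    have h5 := hw.triangle (chartFlow (d := d) ρ z s x) (chartFlow (d := d) ρ z s x')
      (pushCurve (d := d) ρ x' s)
    rw [hw.symm (chartFlow (d := d) ρ z s x') (pushCurve (d := d) ρ x' s)] at h5
    linarith

end Contraction

/-! ### Local Lipschitz bounds from bounds on the differential. -/

section LocalBound

variable {E : Type*} [NormedAddCommGroup E] [NormedSpace ℝ E] {H : Type*} [TopologicalSpace H]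
  (I : ModelWithCorners ℝ E H) {M : Type*} [MetricSpace M] [ChartedSpace H M]
  [Bundle.RiemannianBundle (fun x : M => TangentSpace I x)]

theorem isContinuousRiemannianBundle_of_contMDiff [IsManifold I 1 M] (n : ℕ∞ω)
    [h : IsContMDiffRiemannianBundle I n E (fun x : M => TangentSpace I x)] :
    IsContinuousRiemannianBundle E (fun x : M => TangentSpace I x) := by
  obtain ⟨g, hg, hg'⟩ := h.exists_contMDiff
  exact ⟨g, hg.continuous, hg'⟩

/-- A function on a Riemannian manifold whose differential has norm at most `C` near `x₀` is
`C`-Lipschitz at `x₀`. -/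
lemma eventually_dist_le_of_mfderiv_le [IsRiemannianManifold I M] {F : Type*}
    [NormedAddCommGroup F] [InnerProductSpace ℝ F] {f : M → F} {x₀ : M} {C : ℝ} (hC0 : 0 ≤ C)
    (hf : ∀ᶠ x in 𝓝 x₀, ContMDiffAt I 𝓘(ℝ, F) 1 f x ∧
      ∃ f' : TangentSpace I x →L[ℝ] F, HasMFDerivAt I 𝓘(ℝ, F) f x f' ∧ ∀ v, ‖f' v‖ ≤ C * ‖v‖) :
    ∀ᶠ x in 𝓝 x₀, dist (f x₀) (f x) ≤ C * dist x₀ x := by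
  obtain ⟨r, hr, hball⟩ := Metric.eventually_nhds_iff_ball.1 hf
  filter_upwards [Metric.ball_mem_nhds x₀ hr] with x hx
  have hx' : dist x₀ x < r := by rwa [dist_comm]
  have key : ∀ b ∈ Ioo (dist x₀ x) r, dist (f x₀) (f x) ≤ C * b := by
    intro b hb
    have hb0 : 0 ≤ b := dist_nonneg.trans hb.1.le
    have h1 : riemannianEDist I x₀ x < ENNReal.ofReal b := by
      rw [← IsRiemannianManifold.out (I := I), edist_dist]
      exact (ENNReal.ofReal_lt_ofReal_iff_of_nonneg dist_nonneg).2 hb.1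
    obtain ⟨γ, rfl, rfl, hγ, hl⟩ := exists_lt_of_riemannianEDist_lt h1
    have hmem : ∀ t ∈ Icc (0 : ℝ) 1, γ t ∈ Metric.ball (γ 0) r := by
      intro t ht
      have := (edist_le_pathELength_of_mem hγ ht).trans hl.le
      rw [edist_dist] at this
      have := (ENNReal.ofReal_le_ofReal_iff hb0).1 this
      rw [Metric.mem_ball, dist_comm]
      exact this.trans_lt hb.2
    have hc : ContMDiffOn 𝓘(ℝ, ℝ) 𝓘(ℝ, F) 1 (f ∘ γ) (Icc 0 1) := fun t ht =>
      (hball _ (hmem t ht)).1.comp_contMDiffWithinAt t (hγ t ht)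
    have h2 : edist (f (γ 0)) (f (γ 1)) ≤ ENNReal.ofReal C * pathELength I γ 0 1 := by
      refine (edist_le_pathELength (I := 𝓘(ℝ, F)) hc zero_le_one).trans ?_
      rw [pathELength_eq_lintegral_mfderiv_Ioo, pathELength_eq_lintegral_mfderiv_Ioo,
        ← lintegral_const_mul' _ _ ENNReal.ofReal_ne_top]
      refine setLIntegral_mono' measurableSet_Ioo fun t ht => ?_
      have hγt : MDifferentiableAt 𝓘(ℝ, ℝ) I γ t :=
        (hγ.contMDiffAt (Icc_mem_nhds ht.1 ht.2)).mdifferentiableAt one_ne_zero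
      obtain ⟨-, f', h3, h4⟩ := hball _ (hmem t (Ioo_subset_Icc_self ht))
      rw [(h3.comp t hγt.hasMFDerivAt).mfderiv]
      rw [enorm_tangentSpace_vectorSpace, ← ofReal_norm, ← ENNReal.ofReal_mul hC0]
      exact (ofReal_norm (E := F) _).symm.trans_le (ENNReal.ofReal_le_ofReal (h4 _))
    have h5 := h2.trans (mul_le_mul_right hl.le _)
    rw [← ENNReal.ofReal_mul hC0, edist_dist] at h5
    exact (ENNReal.ofReal_le_ofReal_iff (mul_nonneg hC0 hb0)).1 h5
  have hcont : Continuous fun b : ℝ => C * b := by fun_prop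
  refine ge_of_tendsto ((hcont.tendsto (dist x₀ x)).mono_left 
    (nhdsWithin_le_nhds (s := Ioi (dist x₀ x)))) ?_
  filter_upwards [Ioo_mem_nhdsGT hx'] with b hb using key b hb

end LocalBound

/-! ### The isometric parametrization of the boundary. -/

section BoundaryChart

variable {d : ℕ} [NeZero d] {M : Type*} [MetricSpace M] [ChartedSpace (EuclideanHalfSpace d) M]
  [IsManifold (𝓡∂ d) ∞ M] [Bundle.RiemannianBundle (fun x : M => TangentSpace (𝓡∂ d) x)]

omit [IsManifold (𝓡∂ d) ∞ M] in
/-- The boundary distance dominates the distance. -/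
lemma IsBoundaryIsometry.dist_le_norm_sub [IsRiemannianManifold (𝓡∂ d) M]
    {Φ : Euc (d - 1) → M} (hΦ : IsBoundaryIsometry d M Φ) (y o : Euc (d - 1)) :
    dist (Φ y) (Φ o) ≤ ‖y - o‖ := by
  have hline : ContDiff ℝ 1 (fun t : ℝ => y + t • (o - y)) := by fun_prop
  have hc : ContMDiffOn 𝓘(ℝ, ℝ) (𝓡∂ d) 1 (fun t : ℝ => Φ (y + t • (o - y))) (Icc 0 1) :=
    (hΦ.contMDiff.comp hline.contMDiff).contMDiffOn
  have h1 := edist_le_pathELength hc zero_le_one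
  have h2 : pathELength (𝓡∂ d) (fun t : ℝ => Φ (y + t • (o - y))) 0 1
      ≤ ENNReal.ofReal ‖y - o‖ := by
    rw [pathELength_eq_lintegral_mfderiv_Ioo]
    refine (setLIntegral_mono' (g := fun _ => ENNReal.ofReal ‖y - o‖) measurableSet_Ioo
      fun t ht => ?_).trans ?_
    · have hl : HasDerivAt (fun t : ℝ => y + t • (o - y)) (o - y) t := by
        simpa using ((hasDerivAt_id t).smul_const (o - y)).const_add y
      have h3 : HasMFDerivAt 𝓘(ℝ, ℝ) (𝓡∂ d) (fun t : ℝ => Φ (y + t • (o - y))) t _ :=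
        ((hΦ.contMDiff.mdifferentiableAt one_ne_zero).hasMFDerivAt.comp t
          hl.hasFDerivAt.hasMFDerivAt)
      rw [h3.mfderiv, ← ofReal_norm]
      refine ENNReal.ofReal_le_ofReal (le_of_eq ?_)
      have h4 := hΦ.pullback_eq (y + t • (o - y)) (o - y) (o - y)
      rw [real_inner_self_eq_norm_sq] at h4
      have h5 : ‖mfderiv 𝓘(ℝ, Euc (d - 1)) (𝓡∂ d) Φ (y + t • (o - y)) (o - y)‖ ^ 2
          = ‖o - y‖ ^ 2 := (real_inner_self_eq_norm_sq _).symm.trans h4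
      rw [norm_sub_rev y o, ← (sq_eq_sq₀ (norm_nonneg _) (norm_nonneg _)).1 h5]
      refine congrArg norm ?_
      change mfderiv 𝓘(ℝ, Euc (d - 1)) (𝓡∂ d) Φ (y + t • (o - y)) ((1 : ℝ) • (o - y)) = _
      rw [one_smul]
    · simp
  simp only [zero_smul, add_zero, one_smul, add_sub_cancel] at h1
  rw [edist_dist] at h1
  exact (ENNReal.ofReal_le_ofReal_iff (norm_nonneg _)).1 (h1.trans h2)

omit [IsManifold (𝓡∂ d) ∞ M] in
/-- An isometric linear map has a left inverse of norm at most one. -/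
lemma exists_left_inverse_of_isometry {x : M} (A : Euc (d - 1) →L[ℝ] TangentSpace (𝓡∂ d) x)
    (hA : ∀ v w, inner ℝ (A v) (A w) = inner ℝ v w) :
    ∃ β : TangentSpace (𝓡∂ d) x →L[ℝ] Euc (d - 1), (∀ v, β (A v) = v) ∧ ∀ w, ‖β w‖ ≤ ‖w‖ := by
  -- β is the adjoint of A, written in the standard basis.
  set β : TangentSpace (𝓡∂ d) x →L[ℝ] Euc (d - 1) :=
    (EuclideanSpace.equiv (Fin (d - 1)) ℝ).symm.toContinuousLinearMap.comp
      (ContinuousLinearMap.pi fun k => innerSL ℝ (A (EuclideanSpace.single k 1))) with hβ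
  have hβk : ∀ w k, β w k = inner ℝ (A (EuclideanSpace.single k 1)) w := fun w k => rfl
  have hadj : ∀ v w, inner ℝ (A v) w = inner ℝ v (β w) := by
    intro v w
    conv_lhs => rw [← sum_smul_single v]
    simp only [map_sum, map_smul, sum_inner, inner_smul_left, PiLp.inner_apply, hβk, conj_trivial]
    exact Finset.sum_congr rfl fun k _ => mul_comm _ _
  refine ⟨β, fun v => ext_inner_left ℝ fun u => by rw [← hadj, hA], fun w => ?_⟩
  have h1 : ‖β w‖ ^ 2 ≤ ‖β w‖ * ‖w‖ := by
    rw [← real_inner_self_eq_norm_sq (β w), ← hadj]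
    refine (real_inner_le_norm _ _).trans (mul_le_mul_of_nonneg_right (le_of_eq ?_) (norm_nonneg _))
    rw [← sq_eq_sq₀ (norm_nonneg _) (norm_nonneg _), ← real_inner_self_eq_norm_sq, hA,
      real_inner_self_eq_norm_sq]
  by_contra! h
  have := norm_nonneg w
  nlinarith

variable [IsContMDiffRiemannianBundle (𝓡∂ d) 2 (EuclideanSpace ℝ (Fin d))
      (fun x : M => TangentSpace (𝓡∂ d) x)]

/-- In the chart around `x₀`, the norm of a tangent vector at a point near `x₀` is almost the norm
of the tangent vector at `x₀` with the same components. -/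
lemma eventually_norm_mfderiv_extChartAt_le (x₀ : M) :
    ∀ᶠ y in 𝓝 x₀, ∀ v : TangentSpace (𝓡∂ d) y,
      @norm (TangentSpace (𝓡∂ d) x₀) _ (mfderiv (𝓡∂ d) 𝓘(ℝ, Euc d) (extChartAt (𝓡∂ d) x₀) y v)
        ≤ 3 / 2 * ‖v‖ := by
  have := isContinuousRiemannianBundle_of_contMDiff (M := M) (𝓡∂ d) 2
  filter_upwards [eventually_norm_symmL_trivializationAt_self_comp_lt (Euc d)
    (fun x : M => TangentSpace (𝓡∂ d) x) x₀ (r := 3 / 2) (by norm_num),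
    chart_source_mem_nhds (EuclideanHalfSpace d) x₀] with y hy hys v
  have h1 := (ContinuousLinearMap.le_opNorm _ v).trans
    (mul_le_mul_of_nonneg_right hy.le (norm_nonneg v))
  rw [TangentBundle.symmL_trivializationAt (mem_chart_source _ x₀),
    TangentBundle.continuousLinearMapAt_trivializationAt hys,
    mfderivWithin_range_extChartAt_symm] at h1
  exact h1

/-- An isometric parametrization of the boundary is bi-Lipschitz near every point. -/
lemma IsBoundaryIsometry.exists_norm_sub_le [IsRiemannianManifold (𝓡∂ d) M]
    {Φ : Euc (d - 1) → M} (hΦ : IsBoundaryIsometry d M Φ) (y₀ : Euc (d - 1)) :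
    ∃ r > 0, ∀ y, dist (Φ y) (Φ y₀) ≤ r → ‖y - y₀‖ ≤ 2 * dist (Φ y) (Φ y₀) := by
  have hΦd : MDifferentiableAt 𝓘(ℝ, Euc (d - 1)) (𝓡∂ d) Φ y₀ :=
    hΦ.contMDiff.mdifferentiableAt one_ne_zero
  obtain ⟨β, hβA, hβ⟩ := exists_left_inverse_of_isometry
    (mfderiv 𝓘(ℝ, Euc (d - 1)) (𝓡∂ d) Φ y₀) (hΦ.pullback_eq y₀)
  set L : Euc d →L[ℝ] Euc (d - 1) := β with hL
  -- A local left inverse of Φ to first order: f is 3/2-Lipschitz at Φ y₀ and f ∘ Φ has derivative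
  -- the identity at y₀. An error of 1/8 gives (7/8)‖y - y₀‖ ≤ (3/2) dist, within the factor 2.
  set f : M → Euc (d - 1) := fun x => L (extChartAt (𝓡∂ d) (Φ y₀) x) with hf
  have hfd : ∀ x ∈ (chartAt (EuclideanHalfSpace d) (Φ y₀)).source,
      HasMFDerivAt (𝓡∂ d) 𝓘(ℝ, Euc (d - 1)) f x
        (L.comp (mfderiv (𝓡∂ d) 𝓘(ℝ, Euc d) (extChartAt (𝓡∂ d) (Φ y₀)) x)) := fun x hx =>
    L.hasMFDerivAt.comp x (mdifferentiableAt_extChartAt hx).hasMFDerivAt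
  have hlip : ∀ᶠ x in 𝓝 (Φ y₀), dist (f (Φ y₀)) (f x) ≤ 3 / 2 * dist (Φ y₀) x := by
    refine eventually_dist_le_of_mfderiv_le (𝓡∂ d) (by norm_num) ?_
    filter_upwards [eventually_norm_mfderiv_extChartAt_le (d := d) (Φ y₀),
      chart_source_mem_nhds (EuclideanHalfSpace d) (Φ y₀)] with x hx hxs
    refine ⟨L.contMDiff.contMDiffAt.comp x (contMDiffAt_extChartAt' hxs), _, hfd x hxs, fun v => ?_⟩
    exact (hβ _).trans (hx v)
  have hder : HasFDerivAt (f ∘ Φ) (ContinuousLinearMap.id ℝ (Euc (d - 1))) y₀ := by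
    have h1 := ((hfd _ (mem_chart_source _ _)).comp y₀ hΦd.hasMFDerivAt).hasFDerivAt
    rw [mfderiv_extChartAt_self] at h1
    refine h1.congr_fderiv ?_
    ext1 v
    exact hβA v
  have hlow := (hasFDerivAt_iff_isLittleO.1 hder).def (show (0 : ℝ) < 1 / 8 by norm_num)
  have hev : ∀ᶠ y in 𝓝 y₀, ‖y - y₀‖ ≤ 2 * dist (Φ y) (Φ y₀) := by
    filter_upwards [hlow, hΦ.contMDiff.continuous.continuousAt.eventually hlip] with y h1 h2
    have h3 : ‖y - y₀‖ ≤ ‖f (Φ y) - f (Φ y₀)‖ + ‖f (Φ y) - f (Φ y₀) - (y - y₀)‖ := by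
      have := norm_sub_norm_le (y - y₀) (f (Φ y) - f (Φ y₀))
      rw [norm_sub_rev (y - y₀)] at this
      linarith
    rw [dist_comm, dist_eq_norm, dist_comm] at h2
    have h4 : ‖f (Φ y) - f (Φ y₀) - (y - y₀)‖ ≤ 1 / 8 * ‖y - y₀‖ := h1
    have := dist_nonneg (x := Φ y) (y := Φ y₀)
    linarith
  -- The embedding property turns closeness in the domain into closeness in M. A point y far from y₀
  -- with Φ y near Φ y₀ is thereby excluded.
  rw [hΦ.isEmbedding.nhds_eq_comap, eventually_comap] at hev
  obtain ⟨r, hr, hball⟩ := Metric.eventually_nhds_iff_ball.1 hev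
  refine ⟨r / 2, by positivity, fun y hy => hball (Φ y) ?_ y rfl⟩
  rw [Metric.mem_ball]
  linarith

end BoundaryChart

/-! ### From the decay hypothesis to a push. -/

section DecayRegion

/-- A condition on the limit superior at infinity, as a bound outside of a ball. -/
lemma exists_bound_of_limsup_lt {M : Type*} [MetricSpace M] {f : M → ℝ} {ε : ℝ} (p : M)
    (h : limsup (fun x => ENNReal.ofReal (f x)) (Bornology.cobounded M) < ENNReal.ofReal ε) :
    0 < ε ∧ ∃ R, ∀ x, R < dist x p → f x < ε := by
  -- Positivity of ε is implied by the strict inequality in the extended nonnegative reals.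
  have hε : 0 < ε := ENNReal.ofReal_pos.1 ((zero_le).trans_lt h)
  have hev := eventually_lt_of_limsup_lt h
  obtain ⟨R, -, hR⟩ := (Metric.hasBasis_cobounded_compl_closedBall p).eventually_iff.1 hev
  refine ⟨hε, R, fun x hx => (ENNReal.ofReal_lt_ofReal_iff hε).1 (hR ?_)⟩
  rw [mem_compl_iff, Metric.mem_closedBall]
  exact not_le.2 hx

variable {d : ℕ} [NeZero d] {M : Type*} [MetricSpace M] [ChartedSpace (EuclideanHalfSpace d) M]
  [IsManifold (𝓡∂ d) ∞ M] [Bundle.RiemannianBundle (fun x : M => TangentSpace (𝓡∂ d) x)]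
  [IsRiemannianManifold (𝓡∂ d) M] {α : ℝ≥0} {ρ : M → ℝ}

/-- Under the decay assumption on the Ricci tensor, the flow of `-ρ ∇ρ` does not increase the
distances for the weight `(1 + ρ) ^ (49 / 100 * ε)`, outside of a ball. -/
theorem exists_isPush_of_adapted (hd : 5 ≤ d) (hg : IsC2HolderForm α (metricForm d M))
    {gplus : FormField d M} (hE : IsPoincareEinstein gplus) (hρ : IsDefiningFunction d α ρ)
    (hconf : ∀ x ∈ (𝓡∂ d).interior M, metricForm d M x = ρ x ^ 2 • gplus x)
    (hA : IsAdapted gplus ρ) (hscal : ∀ x, 0 ≤ scalarAt (metricForm d M) x) {p : M} {ε R : ℝ}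
    (hε0 : 0 < ε) (hε : ε < 1 / 2)
    (hR : ∀ x, R < dist x p → ricciNormAt (metricForm d M) x * (1 + dist x p) ^ 2 < ε) :
    LipschitzWith 1 ρ ∧ ∃ R₀, IsPush ρ (wDist (𝓡∂ d) ρ (49 / 100 * ε)) p R₀
      (pushCurve (d := d) ρ) := by
  have hb := fun x (hx : x ∈ (𝓡∂ d).interior M) =>
    gradSq_hess_bounds_of_adapted hd hg hE hρ hconf hA hscal hx rfl rfl rfl
  have hLip : LipschitzWith 1 ρ := lipschitzWith_of_abs_mfderiv_le hρ fun x hx =>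
    abs_mfderiv_le hρ hx (hb x hx).1
  -- For dist x p > 250 ρ p, 1 + ρ x ≤ 1.004 (1 + dist x p), and 1.004² < 1.01 is the loss allowed
  -- in `gradSq_hess_pos`.
  refine ⟨hLip, max R (250 * ρ p), isPush_pushCurve hg hρ hLip (by positivity) (by linarith)
    (fun x hx => (hb x hx).1) fun x hx hxR => ?_⟩
  have hu := (isInteriorPoint_iff_mem (mem_extChartAt_source x)).1 hx
  have hr : (ρ ∘ (extChartAt (𝓡∂ d) x).symm) (extChartAt (𝓡∂ d) x x) = ρ x := by
    rw [Function.comp_apply, extChartAt_to_inv]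
  have hN : ricciNorm univ (coordMatrix (metricForm d M) x) (extChartAt (𝓡∂ d) x x)
      = ricciNormAt (metricForm d M) x :=
    (ricciNorm_congr (range_mem_nhds_of_mem_interior hu) EventuallyEq.rfl).symm
  have hN0 : 0 ≤ ricciNormAt (metricForm d M) x := Real.sqrt_nonneg _
  have h1 := hR x ((le_max_left _ _).trans_lt hxR)
  have h2 : 250 * ρ p < dist x p := (le_max_right _ _).trans_lt hxR
  have h3 : ρ x ≤ ρ p + dist x p := by
    have := hLip.dist_le_mul x p
    rw [Real.dist_eq, NNReal.coe_one, one_mul] at this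
    linarith [abs_le.1 this]
  have h0 := (hρ.pos_iff x).2 hx
  have h4 : (1 + ρ x) ^ 2 ≤ 101 / 100 * (1 + dist x p) ^ 2 := by
    have h5 : 1 + ρ x ≤ 1004 / 1000 * (1 + dist x p) := by
      linarith [dist_nonneg (x := x) (y := p)]
    have h6 := pow_le_pow_left₀ (by positivity) h5 2
    nlinarith [sq_nonneg (1 + dist x p)]
  obtain ⟨-, h5, h6⟩ := hb x hx
  have h7 := gradSq_hess_pos hε0 hε (coordMatrix_posDef (interior_subset hu))
    (by rw [hr]; exact h0) (by rw [hr, hN]; nlinarith) h5 h6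
  rwa [hr] at h7

end DecayRegion

end AdaptedEinstein

end

/-! ### Conclusion. -/

theorem theorem2 {d : ℕ} [NeZero d] (hd : 5 ≤ d) {M : Type*} [MetricSpace M]
    [ChartedSpace (EuclideanHalfSpace d) M] [IsManifold (𝓡∂ d) ∞ M]
    [ConnectedSpace M] [CompleteSpace M]
    [Bundle.RiemannianBundle (fun x : M => TangentSpace (𝓡∂ d) x)]
    [IsContMDiffRiemannianBundle (𝓡∂ d) 2 (EuclideanSpace ℝ (Fin d))
      (fun x : M => TangentSpace (𝓡∂ d) x)]
    [IsRiemannianManifold (𝓡∂ d) M]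
    (α : ℝ≥0) (hα₀ : 0 < α) (hα₁ : α < 1)
    (hg : AdaptedEinstein.IsC2HolderForm α (AdaptedEinstein.metricForm d M))
    (gplus : AdaptedEinstein.FormField d M)
    (hEinstein : AdaptedEinstein.IsPoincareEinstein gplus)
    (ρ : M → ℝ) (hρ : AdaptedEinstein.IsDefiningFunction d α ρ)
    (hconf : ∀ x ∈ (𝓡∂ d).interior M, AdaptedEinstein.metricForm d M x = ρ x ^ 2 • gplus x)
    (hadapted : AdaptedEinstein.IsAdapted gplus ρ)
    (Φ : EuclideanSpace ℝ (Fin (d - 1)) → M)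
    (hΦ : AdaptedEinstein.IsBoundaryIsometry d M Φ)
    (hscal : ∀ x, 0 ≤ AdaptedEinstein.scalarAt (AdaptedEinstein.metricForm d M) x)
    (hRm : ∀ x, AdaptedEinstein.riemannNormAt (AdaptedEinstein.metricForm d M) x ≤ 1)
    (p : M) (ε : ℝ)
    (hRic : Filter.limsup
        (fun x => ENNReal.ofReal
          (AdaptedEinstein.ricciNormAt (AdaptedEinstein.metricForm d M) x * (1 + dist x p) ^ 2))
        (Bornology.cobounded M) < ENNReal.ofReal ε)
    (hε : ε < 1 / 2)
    (hinj : AdaptedEinstein.InteriorInjRadiusPos (AdaptedEinstein.metricForm d M))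
    (hinj' : AdaptedEinstein.BoundaryInjRadiusPos (AdaptedEinstein.metricForm d M) Φ)
    (o : EuclideanSpace ℝ (Fin (d - 1))) :
    (∀ y, dist (Φ y) (Φ o) ≤ ‖y - o‖) ∧
    Filter.Tendsto
      (fun a : ℝ => sInf ((fun y => dist (Φ y) (Φ o)) '' Metric.sphere o a) /
        a ^ (1 / (1 + ε / 2)))
      Filter.atTop Filter.atTop := by
  have : LocallyCompactSpace M := Manifold.locallyCompact_of_finiteDimensional (𝓡∂ d)
  have : ProperSpace M := AdaptedEinstein.properSpace_of_riemannian (I := 𝓡∂ d) (M := M) inferInstance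
  -- Makes the spheres of positive radius nonempty, so that the infimum over them is not the default
  -- value 0.
  have : Nontrivial (EuclideanSpace ℝ (Fin (d - 1))) := by
    have : Nonempty (Fin (d - 1)) := ⟨⟨0, by omega⟩⟩
    infer_instance
  refine ⟨fun y => hΦ.dist_le_norm_sub y o, ?_⟩
  obtain ⟨hε0, R, hR⟩ := AdaptedEinstein.exists_bound_of_limsup_lt p hRic
  obtain ⟨hLip, R₀, hpush⟩ := AdaptedEinstein.exists_isPush_of_adapted hd hg hEinstein hρ hconf
    hadapted hscal hε0 hε hR
  have hκ0 : 0 ≤ 49 / 100 * ε := by positivity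
  have hrange : ∀ x, ρ x = 0 ↔ x ∈ Set.range Φ := fun x => by
    rw [hρ.eq_zero_iff, hΦ.range_eq]
  obtain ⟨C, hC⟩ := hpush.exists_norm_sub_le (AdaptedEinstein.isWeightedLengthDist_wDist hρ.nonneg
    hLip hκ0 (by linarith)) hρ.nonneg hLip hΦ.isEmbedding hrange hΦ.exists_norm_sub_le o
  refine AdaptedEinstein.tendsto_sInf_sphere_div_rpow (δ := fun y => dist (Φ y) (Φ o)) (C := C)
    (fun y => dist_nonneg) hκ0 (by positivity) ?_ fun y => (hC y).trans ?_
  -- κ = 0.49 ε is strictly below ε/2, and this gap turns a lower bound by a power of a into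
  -- divergence.
  · exact one_div_lt_one_div_of_lt (by positivity) (by linarith)
  · have h := AdaptedEinstein.wDist_le_rpow (I := 𝓡∂ d) hρ.nonneg hLip hκ0 (Φ o) (Φ y)
    rw [(hrange (Φ o)).2 ⟨o, rfl⟩, add_zero, dist_comm] at h
    linarith
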